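/- Work over $\mathbb{C}$. Let $C \subset \mathbb{P}^3$ be a smooth irreducible curve of degree $6$ and genus $3$ (i.e. its Hilbert polynomial is $6n+1-3$) which is an intersection of cubic surfaces: $C$ is, as a set, the common zero locus of a set of cubic forms. Then the blowup $Y$ of $\mathbb{P}^3$ with center $C$ exists, and $Y$ is isomorphic, as a scheme over $\mathbb{C}$, to the scheme-theoretic intersection $(\mathbb{P}^3\times\mathbb{P}^3)\cap \Lambda$ of the Segre variety $\mathbb{P}^3\times\mathbb{P}^3 \subset \mathbb{P}^{15}$ (the image of $([x],[y])\mapsto [x_iy_j]$) with a linear subspace $\Lambda\subset\mathbb{P}^{15}$ of codimension $3$ (depending on $C$). -/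

import Mathlib

open AlgebraicGeometry CategoryTheory Filter

namespace SexticBlowup

noncomputable section

/-! ### Projective schemes over a field, given by homogeneous ideals -/

section Graded

variable {k A : Type} [CommRing k] [CommRing A] [Algebra k A]
variable (𝒜 : ℕ → Submodule k A) [GradedAlgebra 𝒜]

/-- The degree-`n` piece `(A ⧸ I)ₙ` of the quotient of a graded algebra by a homogeneous ideal:
the image of `Aₙ`. -/
def quotientGrading (I : HomogeneousIdeal 𝒜) (n : ℕ) : Submodule k (A ⧸ I.toIdeal) :=
  (𝒜 n).map (Ideal.Quotient.mkₐ k I.toIdeal).toLinearMap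

variable {𝒜} in
lemma mk_mem_quotientGrading (I : HomogeneousIdeal 𝒜) {n : ℕ} {a : A} (ha : a ∈ 𝒜 n) :
    Ideal.Quotient.mk I.toIdeal a ∈ quotientGrading 𝒜 I n :=
  Submodule.mem_map.2 ⟨a, ha, rfl⟩

instance (I : HomogeneousIdeal 𝒜) : SetLike.GradedMonoid (quotientGrading 𝒜 I) where
  one_mem := mk_mem_quotientGrading I SetLike.GradedOne.one_mem
  mul_mem := by
    rintro i j _ _ ⟨a, ha, rfl⟩ ⟨b, hb, rfl⟩
    exact mk_mem_quotientGrading I (SetLike.GradedMul.mul_mem ha hb)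

/-- The map `Aₙ → (A ⧸ I)ₙ`. -/
def quotientComponent (I : HomogeneousIdeal 𝒜) (n : ℕ) : 𝒜 n →+ quotientGrading 𝒜 I n where
  toFun a := ⟨Ideal.Quotient.mk I.toIdeal a, mk_mem_quotientGrading I a.2⟩
  map_zero' := by ext; simp
  map_add' a b := by ext; simp

/-- The decomposition of a class in `A ⧸ I` into homogeneous components. -/
def quotientDecompose (I : HomogeneousIdeal 𝒜) :
    A ⧸ I.toIdeal →+ DirectSum ℕ (fun n => quotientGrading 𝒜 I n) :=
  QuotientAddGroup.lift I.toIdeal.toAddSubgroup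
    ((DirectSum.map (quotientComponent 𝒜 I)).comp
      (DirectSum.decomposeAddEquiv 𝒜).toAddMonoidHom) <| by
    intro a ha
    refine DFinsupp.ext fun n => Subtype.ext ?_
    exact Ideal.Quotient.eq_zero_iff_mem.2 (I.isHomogeneous n ha)

lemma quotientDecompose_mk (I : HomogeneousIdeal 𝒜) {n : ℕ} (a : 𝒜 n) :
    quotientDecompose 𝒜 I (Ideal.Quotient.mk I.toIdeal a) =
      DirectSum.of (fun n => quotientGrading 𝒜 I n) n (quotientComponent 𝒜 I n a) := by
  change DirectSum.map (quotientComponent 𝒜 I) (DirectSum.decompose 𝒜 (a : A)) = _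
  rw [DirectSum.decompose_coe, DirectSum.map_of]

instance (I : HomogeneousIdeal 𝒜) : DirectSum.Decomposition (quotientGrading 𝒜 I) where
  decompose' := quotientDecompose 𝒜 I
  left_inv x := by
    obtain ⟨a, rfl⟩ := Ideal.Quotient.mk_surjective x
    induction a using DirectSum.Decomposition.inductionOn 𝒜 with
    | zero => simp
    | homogeneous a => rw [quotientDecompose_mk, DirectSum.coeAddMonoidHom_of]; rfl
    | add a b ha hb => rw [map_add, map_add, map_add, ha, hb]
  right_inv x := by
    induction x using DirectSum.induction_on with
    | zero => simp
    | of n x =>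
      obtain ⟨_, a, ha, rfl⟩ := x
      rw [DirectSum.coeAddMonoidHom_of]
      exact quotientDecompose_mk 𝒜 I ⟨a, ha⟩
    | add x y hx hy => rw [map_add, map_add, hx, hy]

instance (I : HomogeneousIdeal 𝒜) : GradedAlgebra (quotientGrading 𝒜 I) where

/-- The structure morphism `Proj 𝒜 ⟶ Spec k` of a graded `k`-algebra. -/
def structureMap : Proj 𝒜 ⟶ Spec (.of k) :=
  Proj.toSpecZero 𝒜 ≫ Spec.map (CommRingCat.ofHom (algebraMap k (𝒜 0)))

end Graded

/-! ### Projective space -/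

/-- The standard grading of the polynomial ring `ℂ[X_s : s ∈ σ]`. -/
abbrev polyGrading (σ : Type) : ℕ → Submodule ℂ (MvPolynomial σ ℂ) :=
  MvPolynomial.homogeneousSubmodule σ ℂ

instance polyGradedAlgebra (σ : Type) : GradedAlgebra (polyGrading σ) := MvPolynomial.gradedAlgebra

/-- Complex projective space with homogeneous coordinates indexed by `σ`. -/
abbrev projSpace (σ : Type) : Scheme.{0} := Proj (polyGrading σ)

/-- The closed subscheme of projective space defined by a homogeneous ideal `I`: the scheme
`Proj (ℂ[X] ⧸ I)`. -/
abbrev projSubscheme {σ : Type} (I : HomogeneousIdeal (polyGrading σ)) : Scheme.{0} :=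
  Proj (quotientGrading (polyGrading σ) I)

/-! ### Curves in projective space -/

/-- The homogeneous ideal of a reduced closed subscheme `i : C ⟶ ℙ` of projective space: all
polynomials that vanish at all points of `C`. -/
def idealOf {σ : Type} {C : Scheme.{0}} (i : C ⟶ projSpace σ) : HomogeneousIdeal (polyGrading σ) :=
  ProjectiveSpectrum.vanishingIdeal (Set.range i : Set (ProjectiveSpectrum (polyGrading σ)))

/-- The Hilbert function `n ↦ dim_ℂ (ℂ[X] ⧸ I)ₙ` of a homogeneous ideal. -/
def hilbertFunction {σ : Type} (I : HomogeneousIdeal (polyGrading σ)) (n : ℕ) : ℕ :=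
  Module.finrank ℂ (quotientGrading (polyGrading σ) I n)

/-- The projective curve with homogeneous ideal `I` has degree `d` and (arithmetic) genus `g`:
its Hilbert polynomial is `d n + 1 - g`. -/
def HasDegreeGenus {σ : Type} (I : HomogeneousIdeal (polyGrading σ)) (d g : ℤ) : Prop :=
  ∀ᶠ n : ℕ in atTop, (hilbertFunction I n : ℤ) = d * n + 1 - g

/-- A subset of projective space is (set-theoretically) an intersection of hypersurfaces of
degree `d`. -/
def IsIntersectionOfDegree {σ : Type} (d : ℕ) (Z : Set (projSpace σ)) : Prop :=
  ∃ T : Set (MvPolynomial σ ℂ), T ⊆ polyGrading σ d ∧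
    Z = ProjectiveSpectrum.zeroLocus (polyGrading σ) T

/-! ### Blowups -/

/-- An ideal sheaf is invertible (the ideal of an effective Cartier divisor) if locally it is
generated by one nonzerodivisor. -/
def IsInvertibleIdeal {X : Scheme.{0}} (I : X.IdealSheafData) : Prop :=
  ∀ x : X, ∃ U : X.affineOpens, x ∈ U.1 ∧
    ∃ a ∈ nonZeroDivisors Γ(X, U.1), I.ideal U = Ideal.span {a}

/-- `π : Y ⟶ X` is the blowup of `X` along the closed subscheme with ideal sheaf `I`: the inverse
image ideal sheaf on `Y` is invertible, and `π` is universal with this property. -/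
structure IsBlowup {X Y : Scheme.{0}} (π : Y ⟶ X) (I : X.IdealSheafData) : Prop where
  isInvertible_comap : IsInvertibleIdeal (I.comap π)
  existsUnique_lift : ∀ {T : Scheme.{0}} (g : T ⟶ X), IsInvertibleIdeal (I.comap g) →
    ∃! h : T ⟶ Y, h ≫ π = g

/-! ### The Segre variety and its linear sections -/

/-- Substitution of the Segre parametrization `z_{(i,j)} = x_i y_j` into polynomials in the
coordinates `z_{(i,j)}`. -/
def segreHom (α β : Type) : MvPolynomial (α × β) ℂ →ₐ[ℂ] MvPolynomial (α ⊕ β) ℂ :=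
  MvPolynomial.aeval fun p => MvPolynomial.X (Sum.inl p.1) * MvPolynomial.X (Sum.inr p.2)

lemma homogeneousComponent_segreHom {α β : Type} (f : MvPolynomial (α × β) ℂ) (n : ℕ) :
    MvPolynomial.homogeneousComponent (2 * n) (segreHom α β f) =
      segreHom α β (MvPolynomial.homogeneousComponent n f) := by
  have hom (m : ℕ) (g : MvPolynomial (α × β) ℂ) (hg : g.IsHomogeneous m) :
      (segreHom α β g).IsHomogeneous (2 * m) :=
    hg.aeval _ fun p => (MvPolynomial.isHomogeneous_X ℂ _).mul (MvPolynomial.isHomogeneous_X ℂ _)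
  induction f using DirectSum.Decomposition.inductionOn (polyGrading (α × β)) with
  | zero => simp
  | @homogeneous m f =>
    have hf : f.1.IsHomogeneous m := (MvPolynomial.mem_homogeneousSubmodule _ _).1 f.2
    rw [MvPolynomial.homogeneousComponent_of_mem (hom m f.1 hf),
      MvPolynomial.homogeneousComponent_of_mem hf]
    by_cases h : n = m <;> simp [h]
  | add f g hf hg => simp only [map_add, hf, hg]

/-- The homogeneous ideal of the Segre variety, the image of the Segre embedding
`([x], [y]) ↦ [x_i y_j]`: all polynomials that vanish identically on it. -/
def segreIdeal (α β : Type) : HomogeneousIdeal (polyGrading (α × β)) where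
  toSubmodule := RingHom.ker (segreHom α β)
  is_homogeneous' := by
    intro n f hf
    have hn : ((DirectSum.decompose (polyGrading (α × β)) f n : polyGrading (α × β) n) :
        MvPolynomial (α × β) ℂ) = MvPolynomial.homogeneousComponent n f :=
      MvPolynomial.decomposition.decompose'_apply f n
    rw [hn]
    change segreHom α β (MvPolynomial.homogeneousComponent n f) = 0
    rw [← homogeneousComponent_segreHom, show segreHom α β f = 0 from hf, map_zero]

/-- A polynomial lies in the ideal of the Segre variety iff it vanishes at all points `x_i y_j`. -/
lemma mem_segreIdeal_iff {α β : Type} (f : MvPolynomial (α × β) ℂ) :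
    f ∈ segreIdeal α β ↔
      ∀ (x : α → ℂ) (y : β → ℂ), MvPolynomial.eval (fun p => x p.1 * y p.2) f = 0 := by
  have key (w : α ⊕ β → ℂ) : MvPolynomial.eval w (segreHom α β f) =
      MvPolynomial.eval (fun p => w (.inl p.1) * w (.inr p.2)) f := by
    have : (MvPolynomial.aeval w).comp (segreHom α β) =
        MvPolynomial.aeval (R := ℂ) (fun p : α × β => w (.inl p.1) * w (.inr p.2)) :=
      MvPolynomial.algHom_ext fun p => by simp [segreHom]
    simpa [MvPolynomial.aeval_eq_eval] using DFunLike.congr_fun this f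
  change segreHom α β f = 0 ↔ _
  refine ⟨fun h x y => ?_, fun h => MvPolynomial.funext fun w => ?_⟩
  · simpa [h] using (key (Sum.elim x y)).symm
  · rw [key, map_zero]
    exact h (fun a => w (.inl a)) (fun b => w (.inr b))

/-- The linear form `∑ a_s X_s`. -/
def linearForm {σ : Type} [Fintype σ] (a : σ → ℂ) : MvPolynomial σ ℂ :=
  ∑ s, MvPolynomial.C (a s) * MvPolynomial.X s

/-- The homogeneous ideal of the linear subspace `ℙ(V)` of projective space, for a linear subspace
`V ⊆ ℂ^σ`: it is generated by the linear forms that vanish on `V`. -/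
def linearIdeal {σ : Type} [Fintype σ] (V : Submodule ℂ (σ → ℂ)) :
    HomogeneousIdeal (polyGrading σ) where
  toSubmodule := Ideal.span {f | ∃ a : σ → ℂ, (∀ v ∈ V, ∑ s, a s * v s = 0) ∧ f = linearForm a}
  is_homogeneous' := by
    refine Ideal.homogeneous_span _ _ ?_
    rintro _ ⟨a, -, rfl⟩
    exact ⟨1, Submodule.sum_mem _ fun s _ =>
      (MvPolynomial.mem_homogeneousSubmodule _ _).2 (MvPolynomial.isHomogeneous_C_mul_X _ _)⟩

/-- The homogeneous ideal of the scheme-theoretic intersection of the Segre variety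
`ℙ³ × ℙ³ ⊆ ℙ¹⁵` with the linear subspace `ℙ(V)`. -/
def segreSectionIdeal (V : Submodule ℂ (Fin 4 × Fin 4 → ℂ)) :
    HomogeneousIdeal (polyGrading (Fin 4 × Fin 4)) :=
  segreIdeal (Fin 4) (Fin 4) ⊔ linearIdeal V

end

end SexticBlowup

open SexticBlowup

/-! The homogeneous ideal I of C is determinantal: it is generated by the maximal minors of a 3 × 4
matrix M of linear forms on ℙ³. The blowup is then the locus M(x)y = 0 in ℙ³ × ℙ³, cut out by three
bilinear forms, that is, by three linear forms in the Segre coordinates.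

Existence of M. No surface of degree at most two contains C, because its intersection with a cubic
through C sharing no component with it would have too small a Hilbert polynomial
(`IsCubicSexticIdeal.eq_zero`). The section of C by a plane has constant Hilbert polynomial 6. Its
saturated ideal imposes at least 6 conditions in each degree from 3 on; summed over the degrees,
this bound must be an equality to agree with the Hilbert polynomial of C
(`IsCubicSexticIdeal.finrank_piece_eq`). A conic in the saturated ideal would lift to a quadric
through C (`IsCubicSexticIdeal.eq_zero_of_mem_saturation`), so there is none and the section ideal
is already saturated. Restricting further to a general line of the plane identifies the cubics in I
with all binary cubics, and the linear relations between neighbouring monomials of degree three lift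
to the three rows of M (`IsCubicSexticIdeal.exists_isDeterminantal`).

Universal property. If the ideal of C pulls back to an invertible ideal (β), the minors divided by β
form a unimodular kernel vector η of M, and (x, η) is a lift (`exists_local_lift`). It is the only
one, because every kernel vector is proportional to the vector of minors (`maxMinor_mul_eq`,
`eq_of_comp_sectionProj_eq`); the local lifts therefore glue.

Invertibility on the section itself. Where y_k = 1 the pulled back ideal is generated by the k-th
minor, which must be shown to be a nonzerodivisor. A function killed by it vanishes at the generic
point (x, minors(x)). A form in y that vanishes there is killed on the section by powers of all 2 ×
2 minors of M (`minorTwo_pow_mul_eval₂_eq_zero`). These have no common zero: at such a point the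
maximal minors vanish to first order, so the whole tangent space of ℙ³ would be tangent to the
smooth curve C (`eq_zero_of_minors_eq_zero`). -/

namespace SexticBlowup

open MvPolynomial

/-! ### Homogeneous polynomials, their factors, and graded pieces of ideals -/

section Homogeneous

variable {K σ : Type} [Field K]

/-- The homomorphism `X_i ↦ X_i t`, which separates the homogeneous components. -/
noncomputable def scaleHom (K σ : Type) [Field K] :
    MvPolynomial σ K →ₐ[K] Polynomial (MvPolynomial σ K) :=
  aeval fun i => Polynomial.C (X i) * Polynomial.X

lemma scaleHom_of_isHomogeneous {p : MvPolynomial σ K} {n : ℕ} (hp : p.IsHomogeneous n) :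
    scaleHom K σ p = Polynomial.C p * Polynomial.X ^ n := by
  have hmon (d : σ →₀ ℕ) (r : K) : scaleHom K σ (monomial d r) =
      Polynomial.C (monomial d r) * Polynomial.X ^ d.degree := by
    rw [scaleHom, aeval_monomial, Finsupp.prod]
    simp_rw [mul_pow, Finset.prod_mul_distrib, Finset.prod_pow_eq_pow_sum, ← map_pow, ← map_prod]
    rw [← mul_assoc, monomial_eq, Finsupp.prod, map_mul]
    rfl
  conv_lhs => rw [p.as_sum]
  conv_rhs => rw [p.as_sum]
  rw [map_sum, map_sum, Finset.sum_mul]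
  refine Finset.sum_congr rfl fun d hd => ?_
  rw [hmon, hp.degree_eq_sum_deg_support hd]
  rfl

lemma coeff_scaleHom (p : MvPolynomial σ K) (n : ℕ) :
    (scaleHom K σ p).coeff n = homogeneousComponent n p := by
  conv_lhs => rw [← sum_homogeneousComponent p]
  rw [map_sum, Polynomial.finsetSum_coeff]
  simp_rw [scaleHom_of_isHomogeneous (homogeneousComponent_isHomogeneous _ p),
    Polynomial.coeff_C_mul, Polynomial.coeff_X_pow]
  simp only [mul_ite, mul_one, mul_zero, Finset.sum_ite_eq, Finset.mem_range]
  split_ifs with h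
  · rfl
  · exact (homogeneousComponent_eq_zero _ _ (by omega)).symm

lemma scaleHom_injective : Function.Injective (scaleHom K σ) := by
  refine (injective_iff_map_eq_zero _).2 fun p hp => ?_
  rw [← sum_homogeneousComponent p]
  exact Finset.sum_eq_zero fun n _ => by rw [← coeff_scaleHom, hp, Polynomial.coeff_zero]

/-- Under `scaleHom` the product becomes a single power of t with coefficient `p * q`. Over a domain
the degree and the trailing degree in t are both additive, so they coincide for each factor, which
leaves it only one component. -/
lemma isHomogeneous_of_mul {p q : MvPolynomial σ K} {n : ℕ} (h : (p * q).IsHomogeneous n)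
    (hpq : p * q ≠ 0) : ∃ a b, a + b = n ∧ p.IsHomogeneous a ∧ q.IsHomogeneous b := by
  have key (r : MvPolynomial σ K)
      (hr : (scaleHom K σ r).natDegree ≤ (scaleHom K σ r).natTrailingDegree) :
      r.IsHomogeneous (scaleHom K σ r).natDegree := by
    have : homogeneousComponent (scaleHom K σ r).natDegree r = r := by
      refine scaleHom_injective (Polynomial.ext fun k => ?_)
      rw [scaleHom_of_isHomogeneous (homogeneousComponent_isHomogeneous _ _),
        Polynomial.coeff_C_mul_X_pow]
      split_ifs with h
      · rw [h, coeff_scaleHom]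
      · rcases lt_or_gt_of_ne h with h | h
        · exact (Polynomial.coeff_eq_zero_of_lt_natTrailingDegree (h.trans_le hr)).symm
        · exact (Polynomial.coeff_eq_zero_of_natDegree_lt h).symm
    have h2 := homogeneousComponent_isHomogeneous (scaleHom K σ r).natDegree r
    rwa [this] at h2
  have hp : scaleHom K σ p ≠ 0 := fun h0 => hpq (by
    rw [scaleHom_injective (h0.trans (map_zero _).symm), zero_mul])
  have hq : scaleHom K σ q ≠ 0 := fun h0 => hpq (by
    rw [scaleHom_injective (h0.trans (map_zero _).symm), mul_zero])
  have e : scaleHom K σ p * scaleHom K σ q = Polynomial.C (p * q) * Polynomial.X ^ n := by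
    rw [← map_mul, scaleHom_of_isHomogeneous h]
  have hd : (scaleHom K σ p).natDegree + (scaleHom K σ q).natDegree = n := by
    rw [← Polynomial.natDegree_mul hp hq, e, Polynomial.natDegree_C_mul_X_pow _ _ hpq]
  have ht : (scaleHom K σ p).natTrailingDegree + (scaleHom K σ q).natTrailingDegree = n := by
    rw [← Polynomial.natTrailingDegree_mul hp hq, e, Polynomial.C_mul_X_pow_eq_monomial,
      Polynomial.natTrailingDegree_monomial hpq]
  have h1 := Polynomial.natTrailingDegree_le_natDegree (scaleHom K σ p)
  have h2 := Polynomial.natTrailingDegree_le_natDegree (scaleHom K σ q)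
  exact ⟨_, _, hd, key p (by omega), key q (by omega)⟩

lemma homogeneousComponent_mul_of_isHomogeneous {p : MvPolynomial σ K} {a : ℕ}
    (hp : p.IsHomogeneous a) (q : MvPolynomial σ K) (n : ℕ) :
    homogeneousComponent (a + n) (p * q) = p * homogeneousComponent n q := by
  rw [← coeff_scaleHom, ← coeff_scaleHom, map_mul, scaleHom_of_isHomogeneous hp, mul_assoc,
    Polynomial.coeff_C_mul, add_comm a n, Polynomial.coeff_X_pow_mul]

lemma exists_isHomogeneous_of_eq_mul {p f q : MvPolynomial σ K} {a n : ℕ}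
    (hp : p.IsHomogeneous a) (hf : f.IsHomogeneous (a + n)) (h : f = p * q) :
    ∃ q' : MvPolynomial σ K, q'.IsHomogeneous n ∧ f = p * q' :=
  ⟨homogeneousComponent n q, homogeneousComponent_isHomogeneous _ _, by
    rw [← homogeneousComponent_mul_of_isHomogeneous hp, ← h, homogeneousComponent_eq_self hf]⟩

lemma isUnit_of_isHomogeneous_zero {p : MvPolynomial σ K} (hp : p.IsHomogeneous 0) (h : p ≠ 0) :
    IsUnit p := by
  obtain ⟨c, rfl⟩ : ∃ c, p = C c := ⟨coeff 0 p, by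
    rw [← homogeneousComponent_zero, homogeneousComponent_eq_self hp]⟩
  exact (IsUnit.mk0 c (by rintro rfl; simp at h)).map C

lemma not_isUnit_of_isHomogeneous {p : MvPolynomial σ K} {n : ℕ} (hp : p.IsHomogeneous n)
    (hn : n ≠ 0) : ¬ IsUnit p := by
  intro hu
  obtain ⟨q, hq⟩ := hu.exists_right_inv
  obtain ⟨a, b, hab, ha, -⟩ := isHomogeneous_of_mul (p := p) (q := q) (n := 0)
    (hq ▸ isHomogeneous_one σ K) (hq ▸ one_ne_zero)
  have := hp.inj_right ha hu.ne_zero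
  omega

/-- The factors are homogeneous with degrees adding up to 1, so one of them is a nonzero constant.
-/
lemma irreducible_of_isHomogeneous_one {p : MvPolynomial σ K} (hp : p.IsHomogeneous 1)
    (h : p ≠ 0) : Irreducible p := by
  refine ⟨not_isUnit_of_isHomogeneous hp one_ne_zero, fun a b hab => ?_⟩
  have h' : a * b ≠ 0 := hab ▸ h
  obtain ⟨m, n, hmn, ha, hb⟩ := isHomogeneous_of_mul (hab ▸ hp) h'
  rcases Nat.eq_zero_or_pos m with rfl | hm
  · exact .inl (isUnit_of_isHomogeneous_zero ha (left_ne_zero_of_mul h'))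
  · obtain rfl : n = 0 := by omega
    exact .inr (isUnit_of_isHomogeneous_zero hb (right_ne_zero_of_mul h'))

instance finiteDimensional_homogeneousSubmodule [Finite σ] (n : ℕ) :
    FiniteDimensional K (homogeneousSubmodule σ K n) :=
  Module.Finite.iff_fg.2 (homogeneousSubmodule_fg σ K n)

/-- The degree `n` part of an ideal. -/
noncomputable def piece (I : Ideal (MvPolynomial σ K)) (n : ℕ) : Submodule K (MvPolynomial σ K) :=
  I.restrictScalars K ⊓ homogeneousSubmodule σ K n

lemma mem_piece {I : Ideal (MvPolynomial σ K)} {n : ℕ} {f : MvPolynomial σ K} :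
    f ∈ piece I n ↔ f ∈ I ∧ f.IsHomogeneous n := Iff.rfl

instance [Finite σ] (I : Ideal (MvPolynomial σ K)) (n : ℕ) :
    FiniteDimensional K (piece I n) :=
  Submodule.finiteDimensional_of_le (inf_le_right : piece I n ≤ homogeneousSubmodule σ K n)

lemma piece_top (n : ℕ) : piece (⊤ : Ideal (MvPolynomial σ K)) n = homogeneousSubmodule σ K n :=
  top_inf_eq _

lemma piece_mono {I J : Ideal (MvPolynomial σ K)} (h : I ≤ J) (n : ℕ) : piece I n ≤ piece J n :=
  inf_le_inf_right _ h

/-- An ideal which contains the homogeneous components of its elements. -/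
def IsHomog (I : Ideal (MvPolynomial σ K)) : Prop :=
  ∀ f ∈ I, ∀ n, homogeneousComponent n f ∈ I

lemma isHomog_top : IsHomog (⊤ : Ideal (MvPolynomial σ K)) := fun _ _ _ => trivial

lemma isHomog_span {s : Set (MvPolynomial σ K)} (hs : ∀ f ∈ s, ∃ n, f.IsHomogeneous n) :
    IsHomog (Ideal.span s) := by
  intro f hf n
  let _ := MvPolynomial.gradedAlgebra (σ := σ) (R := K)
  exact homogeneousComponent_mem_of_mem (Ideal.homogeneous_span (homogeneousSubmodule σ K) s
    fun f hf => hs f hf) hf n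

lemma IsHomog.le_of_piece_le {I J : Ideal (MvPolynomial σ K)} (hI : IsHomog I)
    (h : ∀ n, piece I n ≤ piece J n) : I ≤ J := by
  intro f hf
  rw [← sum_homogeneousComponent f]
  exact sum_mem fun n _ => (h n ⟨hI f hf n, homogeneousComponent_isHomogeneous n f⟩).1

/-- The number of monomials of degree `m` in `n` variables. -/
noncomputable def monCount (K : Type) [Field K] (n m : ℕ) : ℕ :=
  Module.finrank K (homogeneousSubmodule (Fin n) K m)

lemma finrank_piece_top (n m : ℕ) :
    Module.finrank K (piece (⊤ : Ideal (MvPolynomial (Fin n) K)) m) = monCount K n m := by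
  rw [piece_top, monCount]

lemma finrank_piece_le {n : ℕ} (I : Ideal (MvPolynomial (Fin n) K)) (m : ℕ) :
    Module.finrank K (piece I m) ≤ monCount K n m :=
  Submodule.finrank_mono inf_le_right

lemma finrank_piece_mono {n : ℕ} {I J : Ideal (MvPolynomial (Fin n) K)} (h : I ≤ J) (m : ℕ) :
    Module.finrank K (piece I m) ≤ Module.finrank K (piece J m) :=
  Submodule.finrank_mono (piece_mono h m)

end Homogeneous

/-! ### Restriction to a hyperplane and dimension counts -/

section Elimination

variable {K : Type} [Field K] {n : ℕ} (l : Fin n → K)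

/-- The substitution `X_0 ↦ ∑ l_i X_i`, `X_{i+1} ↦ X_i`. -/
noncomputable def elim : MvPolynomial (Fin (n + 1)) K →ₐ[K] MvPolynomial (Fin n) K :=
  aeval (Fin.cons (∑ i, C (l i) * X i) X)

/-- The linear form `X_0 - ∑ l_i X_{i+1}`, which generates the kernel of `elim l`. -/
noncomputable def elimForm : MvPolynomial (Fin (n + 1)) K := X 0 - ∑ i, C (l i) * X i.succ

@[simp] lemma elim_X_zero : elim l (X 0) = ∑ i, C (l i) * X i := by simp [elim]

@[simp] lemma elim_X_succ (i : Fin n) : elim l (X i.succ) = X i := by simp [elim]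

@[simp] lemma elim_C (a : K) : elim l (C a) = C a := by simp [elim]

@[simp] lemma elim_rename_succ (f : MvPolynomial (Fin n) K) :
    elim l (rename Fin.succ f) = f := by
  rw [elim, aeval_rename]
  simp [Function.comp_def]

lemma elim_surjective : Function.Surjective (elim l) :=
  fun f => ⟨rename Fin.succ f, elim_rename_succ l f⟩

@[simp] lemma elim_elimForm : elim l (elimForm l) = 0 := by
  simp [elimForm]

lemma elimForm_isHomogeneous : (elimForm l).IsHomogeneous 1 :=
  (isHomogeneous_X _ _).sub (IsHomogeneous.sum _ _ _ fun _ _ => isHomogeneous_C_mul_X _ _)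

lemma elimForm_ne_zero : elimForm l ≠ 0 := by
  intro h
  have := congrArg (eval (Fin.cons 1 0)) h
  simp [elimForm] at this

lemma elim_isHomogeneous {f : MvPolynomial (Fin (n + 1)) K} {m : ℕ} (hf : f.IsHomogeneous m) :
    (elim l f).IsHomogeneous m := by
  have := hf.aeval (n := 1) (Fin.cons (∑ i, C (l i) * X i) X : Fin (n + 1) → MvPolynomial (Fin n) K)
    (fun i => by
      refine Fin.cases ?_ (fun i => ?_) i
      · exact IsHomogeneous.sum Finset.univ (fun i => C (l i) * X i) 1
          fun i _ => isHomogeneous_C_mul_X _ _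
      · exact isHomogeneous_X K _)
  rwa [one_mul] at this

lemma homogeneousComponent_elim (f : MvPolynomial (Fin (n + 1)) K) (m : ℕ) :
    homogeneousComponent m (elim l f) = elim l (homogeneousComponent m f) := by
  conv_lhs => rw [← sum_homogeneousComponent f]
  rw [map_sum, map_sum]
  simp_rw [homogeneousComponent_of_mem (elim_isHomogeneous l
    (homogeneousComponent_isHomogeneous _ f))]
  simp only [Finset.sum_ite_eq, Finset.mem_range]
  split_ifs with h
  · rfl
  · rw [homogeneousComponent_eq_zero _ _ (by omega), map_zero]

/-- Modulo `elimForm l` the variable X_0 equals its substitute, so the two algebra homomorphisms to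
the quotient agree on the variables. -/
lemma sub_rename_elim_mem (f : MvPolynomial (Fin (n + 1)) K) :
    f - rename Fin.succ (elim l f) ∈ Ideal.span {elimForm l} := by
  rw [← Ideal.Quotient.mk_eq_mk_iff_sub_mem]
  have : (Ideal.Quotient.mkₐ K (Ideal.span {elimForm l})) = ((Ideal.Quotient.mkₐ K
      (Ideal.span {elimForm l})).comp (rename Fin.succ)).comp (elim l) := by
    refine algHom_ext fun i => ?_
    refine Fin.cases ?_ (fun i => ?_) i
    · refine (Ideal.Quotient.mk_eq_mk_iff_sub_mem _ _).2 ?_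
      simp only [RingHom.coe_coe, elim_X_zero, map_sum, map_mul,
        rename_X, rename_C]
      exact Ideal.mem_span_singleton_self _
    · simp
  exact DFunLike.congr_fun this f

lemma elim_eq_zero_iff {f : MvPolynomial (Fin (n + 1)) K} :
    elim l f = 0 ↔ elimForm l ∣ f := by
  refine ⟨fun h => ?_, ?_⟩
  · have := sub_rename_elim_mem l f
    rwa [h, map_zero, sub_zero, Ideal.mem_span_singleton] at this
  · rintro ⟨g, rfl⟩
    rw [map_mul, elim_elimForm, zero_mul]

lemma exists_eq_elimForm_mul {f : MvPolynomial (Fin (n + 1)) K} {m : ℕ}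
    (hf : f.IsHomogeneous (m + 1)) (h : elim l f = 0) :
    ∃ g : MvPolynomial (Fin (n + 1)) K, g.IsHomogeneous m ∧ f = elimForm l * g := by
  obtain ⟨g, hg⟩ := (elim_eq_zero_iff l).1 h
  exact exists_isHomogeneous_of_eq_mul (elimForm_isHomogeneous l) (add_comm m 1 ▸ hf) hg

variable {l} {I : Ideal (MvPolynomial (Fin (n + 1)) K)}

lemma mem_map_elim {f : MvPolynomial (Fin n) K} : f ∈ I.map (elim l) ↔ ∃ g ∈ I, elim l g = f :=
  Ideal.mem_map_iff_of_surjective (elim l) (elim_surjective l)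

lemma IsHomog.map_elim (hI : IsHomog I) : IsHomog (I.map (elim l)) := by
  intro f hf m
  obtain ⟨g, hg, rfl⟩ := mem_map_elim.1 hf
  rw [homogeneousComponent_elim]
  exact Ideal.mem_map_of_mem _ (hI g hg m)

lemma exists_mem_piece_of_mem_piece_map (hI : IsHomog I) {f : MvPolynomial (Fin n) K} {m : ℕ}
    (hf : f ∈ piece (I.map (elim l)) m) : ∃ g ∈ piece I m, elim l g = f := by
  obtain ⟨g, hg, rfl⟩ := mem_map_elim.1 hf.1
  exact ⟨homogeneousComponent m g, ⟨hI g hg m, homogeneousComponent_isHomogeneous m g⟩, by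
    rw [← homogeneousComponent_elim, homogeneousComponent_eq_self hf.2]⟩

lemma elim_mem_piece {f : MvPolynomial (Fin (n + 1)) K} {m : ℕ} (hf : f ∈ piece I m) :
    elim l f ∈ piece (I.map (elim l)) m :=
  ⟨Ideal.mem_map_of_mem _ hf.1, elim_isHomogeneous l hf.2⟩

lemma map_piece (hI : IsHomog I) (m : ℕ) :
    (piece I m).map (elim l).toLinearMap = piece (I.map (elim l)) m := by
  ext f
  constructor
  · rintro ⟨g, hg, rfl⟩
    exact elim_mem_piece hg
  · exact fun hf => exists_mem_piece_of_mem_piece_map hI hf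

/-- Multiplication by `elimForm l` and restriction form a short exact sequence 0 → I_m → I_{m+1} →
(I restricted)_{m+1} → 0. Exactness in the middle is the hypothesis that the linear form is a
nonzerodivisor modulo I. -/
lemma finrank_piece_map_elim (hI : IsHomog I) (hl : ∀ f, elimForm l * f ∈ I → f ∈ I) (m : ℕ) :
    Module.finrank K (piece (I.map (elim l)) (m + 1)) + Module.finrank K (piece I m) =
      Module.finrank K (piece I (m + 1)) := by
  rw [← LinearMap.finrank_range_add_finrank_ker ((elim l).toLinearMap.domRestrict (piece I (m + 1))),
    ← map_piece hI, LinearMap.range_domRestrict]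
  congr 1
  have hinj : Function.Injective (LinearMap.mulLeft K (elimForm l)) := fun a b h =>
    mul_left_cancel₀ (elimForm_ne_zero l) h
  rw [(Submodule.equivMapOfInjective _ hinj (piece I m)).finrank_eq,
    ← Submodule.finrank_map_subtype_eq]
  suffices h : (piece I m).map (LinearMap.mulLeft K (elimForm l)) =
      ((elim l).toLinearMap.domRestrict (piece I (m + 1))).ker.map
        (piece I (m + 1)).subtype by rw [h]
  ext f
  simp only [Submodule.mem_map, LinearMap.mulLeft_apply, LinearMap.mem_ker,
    LinearMap.domRestrict_apply, Submodule.subtype_apply, Subtype.exists]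
  constructor
  · rintro ⟨g, hg, rfl⟩
    exact ⟨_, ⟨I.mul_mem_left _ hg.1, add_comm 1 m ▸ (elimForm_isHomogeneous l).mul hg.2⟩,
      (elim_eq_zero_iff l).2 ⟨g, rfl⟩, rfl⟩
  · rintro ⟨_, hf, hf0, rfl⟩
    obtain ⟨g, hg, rfl⟩ := exists_eq_elimForm_mul l hf.2 hf0
    exact ⟨g, ⟨hl g hf.1, hg⟩, rfl⟩

lemma monCount_succ (m : ℕ) :
    monCount K (n + 1) (m + 1) = monCount K n (m + 1) + monCount K (n + 1) m := by
  have := finrank_piece_map_elim (l := (0 : Fin n → K)) isHomog_top (fun _ _ => trivial) m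
  rw [Ideal.map_top, finrank_piece_top, finrank_piece_top, finrank_piece_top] at this
  exact this.symm

lemma monCount_zero_right : monCount K n 0 = 1 := by
  rw [monCount, homogeneousSubmodule_zero, Submodule.one_eq_range,
    LinearMap.finrank_range_of_inj, Module.finrank_self]
  exact C_injective _ _

lemma monCount_zero_succ (m : ℕ) : monCount K 0 (m + 1) = 0 := by
  have : homogeneousSubmodule (Fin 0) K (m + 1) = ⊥ := by
    refine (Submodule.eq_bot_iff _).2 fun f hf => ?_
    by_contra h
    exact absurd ((isHomogeneous_of_isEmpty _ _ f).inj_right hf h) (by omega)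
  rw [monCount, this, finrank_bot]

lemma monCount_one (m : ℕ) : monCount K 1 m = 1 := by
  induction m with
  | zero => exact monCount_zero_right
  | succ m ih => rw [monCount_succ, monCount_zero_succ, ih]

lemma monCount_two (m : ℕ) : monCount K 2 m = m + 1 := by
  induction m with
  | zero => exact monCount_zero_right
  | succ m ih => rw [monCount_succ, monCount_one, ih, add_comm]

lemma two_mul_monCount_three (m : ℕ) : 2 * monCount K 3 m = (m + 1) * (m + 2) := by
  induction m with
  | zero => rw [monCount_zero_right]
  | succ m ih => rw [monCount_succ, monCount_two, mul_add, ih]; ring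

lemma six_mul_monCount_four (m : ℕ) : 6 * monCount K 4 m = (m + 1) * (m + 2) * (m + 3) := by
  induction m with
  | zero => rw [monCount_zero_right]
  | succ m ih =>
    have := two_mul_monCount_three (K := K) (m + 1)
    rw [monCount_succ, mul_add, ih, show 6 = 3 * 2 from rfl, mul_assoc, this]
    ring

lemma finrank_piece_span_singleton {d : ℕ} {f : MvPolynomial (Fin n) K} (hf : f.IsHomogeneous d)
    (h0 : f ≠ 0) (m : ℕ) :
    Module.finrank K (piece (Ideal.span {f}) (m + d)) = monCount K n m := by
  have hinj : Function.Injective (LinearMap.mulLeft K f) := fun a b h => mul_left_cancel₀ h0 h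
  rw [monCount, (Submodule.equivMapOfInjective _ hinj (homogeneousSubmodule _ K m)).finrank_eq]
  suffices h : piece (Ideal.span {f}) (m + d) =
    (homogeneousSubmodule (Fin n) K m).map (LinearMap.mulLeft K f) by rw [h]
  ext g
  constructor
  · rintro ⟨hg, hg'⟩
    obtain ⟨q, rfl⟩ := Ideal.mem_span_singleton.1 hg
    obtain ⟨q', hq', e⟩ := exists_isHomogeneous_of_eq_mul hf (add_comm m d ▸ hg') rfl
    exact ⟨q', hq', e.symm⟩
  · rintro ⟨q, hq, rfl⟩
    exact ⟨Ideal.mul_mem_right _ _ (Ideal.mem_span_singleton_self f), add_comm d m ▸ hf.mul hq⟩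

/-- The lower bound for the dimension of a homogeneous piece of an ideal containing two coprime
forms. -/
lemma monCount_add_le_finrank_piece {J : Ideal (MvPolynomial (Fin n) K)}
    {f g : MvPolynomial (Fin n) K} {a b : ℕ} (hf : f.IsHomogeneous a) (hg : g.IsHomogeneous b)
    (hfJ : f ∈ J) (hgJ : g ∈ J) (h0 : f ≠ 0) (hcop : IsRelPrime f g) (m : ℕ) :
    monCount K n (m + b) + monCount K n (m + a) ≤
      Module.finrank K (piece J (m + a + b)) + monCount K n m := by
  let A := homogeneousSubmodule (Fin n) K (m + b)
  let B := homogeneousSubmodule (Fin n) K (m + a)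
  let φ : A × B →ₗ[K] MvPolynomial (Fin n) K :=
    ((LinearMap.mulLeft K f).comp A.subtype).coprod ((LinearMap.mulLeft K g).comp B.subtype)
  have hr : φ.range ≤ piece J (m + a + b) := by
    rintro _ ⟨⟨u, v⟩, rfl⟩
    refine ⟨add_mem (J.mul_mem_right _ hfJ) (J.mul_mem_right _ hgJ), ?_⟩
    refine IsHomogeneous.add ?_ ?_
    · exact (show a + (m + b) = m + a + b by omega) ▸ hf.mul u.2
    · exact (show b + (m + a) = m + a + b by omega) ▸ hg.mul v.2
  -- Since f and g are coprime, f u + g v = 0 has only the Koszul solutions (g w, -f w) with w of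
  -- degree m, and ψ parametrizes these.
  have hk : Module.finrank K φ.ker ≤ monCount K n m := by
    let C := homogeneousSubmodule (Fin n) K m
    let ψ : C →ₗ[K] A × B := LinearMap.prod
      (((LinearMap.mulLeft K g).comp C.subtype).codRestrict A
        fun c => by have := hg.mul c.2; rwa [add_comm] at this)
      ((-((LinearMap.mulLeft K f).comp C.subtype)).codRestrict B
        fun c => B.neg_mem (by have := hf.mul c.2; rwa [add_comm] at this))
    have : φ.ker ≤ ψ.range := by
      rintro ⟨u, v⟩ h
      have h : f * u.1 + g * v.1 = 0 := h
      have hdvd : f ∣ v.1 := hcop.dvd_of_dvd_mul_left ⟨-u.1, by linear_combination h⟩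
      obtain ⟨w, hw⟩ := hdvd
      obtain ⟨w, hw', hw⟩ := exists_isHomogeneous_of_eq_mul hf
        (by rw [add_comm]; exact v.2 : (v : MvPolynomial _ K).IsHomogeneous (a + m)) hw
      refine ⟨⟨-w, C.neg_mem hw'⟩, Prod.ext (Subtype.ext ?_) (Subtype.ext ?_)⟩
      · change g * -w = u.1
        refine mul_left_cancel₀ h0 ?_
        rw [hw] at h
        linear_combination -h
      · change -(f * -w) = v.1
        rw [hw]
        ring
    exact (Submodule.finrank_mono this).trans (LinearMap.finrank_range_le ψ)
  have e := LinearMap.finrank_range_add_finrank_ker φ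
  rw [Module.finrank_prod] at e
  have := Submodule.finrank_mono hr
  change Module.finrank K A + Module.finrank K B ≤ _
  omega

end Elimination

end SexticBlowup

namespace SexticBlowup

open MvPolynomial

/-! ### Saturation and linear nonzerodivisors -/

section Saturation

variable {K : Type} [Field K] {n : ℕ}

/-- The ideal generated by the variables. -/
noncomputable def varIdeal (K : Type) [Field K] (n : ℕ) : Ideal (MvPolynomial (Fin n) K) :=
  Ideal.span (Set.range X)

lemma isHomog_varIdeal_pow (k : ℕ) : IsHomog (varIdeal K n ^ k) := by
  let _ := MvPolynomial.gradedAlgebra (σ := Fin n) (R := K)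
  have h : (varIdeal K n ^ k).IsHomogeneous (homogeneousSubmodule (Fin n) K) := by
    induction k with
    | zero => rw [pow_zero, Ideal.one_eq_top]; exact Ideal.IsHomogeneous.top _
    | succ k ih =>
      rw [pow_succ]
      refine ih.mul (Ideal.homogeneous_span _ _ ?_)
      rintro _ ⟨i, rfl⟩
      exact ⟨1, isHomogeneous_X _ _⟩
  exact fun f hf m => homogeneousComponent_mem_of_mem h hf m

lemma mem_varIdeal_pow {f : MvPolynomial (Fin n) K} {m k : ℕ} (hf : f.IsHomogeneous m)
    (h : k ≤ m) : f ∈ varIdeal K n ^ k :=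
  Ideal.pow_le_pow_right h ((Ideal.mem_span_pow_iff_exists_isHomogeneous _ _).2 ⟨map C f, hf.map C, by
    rw [MvPolynomial.eval_map, eval₂_eta]⟩)

/-- The saturation of an ideal with respect to the ideal of the variables. -/
noncomputable def saturation (B : Ideal (MvPolynomial (Fin n) K)) :
    Ideal (MvPolynomial (Fin n) K) where
  carrier := {f | ∃ k, ∀ g ∈ varIdeal K n ^ k, g * f ∈ B}
  zero_mem' := ⟨0, fun g _ => by simp⟩
  add_mem' := by
    rintro a b ⟨k, hk⟩ ⟨m, hm⟩
    refine ⟨k + m, fun g hg => ?_⟩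
    rw [mul_add]
    exact add_mem (hk g (Ideal.pow_le_pow_right (by omega) hg))
      (hm g (Ideal.pow_le_pow_right (by omega) hg))
  smul_mem' := by
    rintro c a ⟨k, hk⟩
    refine ⟨k, fun g hg => ?_⟩
    rw [smul_eq_mul, mul_left_comm]
    exact B.mul_mem_left _ (hk g hg)

variable {B : Ideal (MvPolynomial (Fin n) K)}

lemma le_saturation : B ≤ saturation B := fun _ hf => ⟨0, fun g _ => B.mul_mem_left g hf⟩

lemma IsHomog.saturation (hB : IsHomog B) : IsHomog (saturation B) := by
  rintro f ⟨k, hk⟩ m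
  refine ⟨k, fun g hg => ?_⟩
  rw [← sum_homogeneousComponent g, Finset.sum_mul]
  refine sum_mem fun j _ => ?_
  rw [← homogeneousComponent_mul_of_isHomogeneous (homogeneousComponent_isHomogeneous j g)]
  exact hB _ (hk _ (isHomog_varIdeal_pow k g hg j)) _

/-- A power of the variable ideal that works for all finitely many products `X i * f` works for f
after raising the exponent by one. Consequently no associated prime of the saturation contains all
variables. -/
lemma mem_saturation_of_forall_X_mul {f : MvPolynomial (Fin n) K}
    (h : ∀ i, X i * f ∈ saturation B) : f ∈ saturation B := by
  choose k hk using h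
  refine ⟨Finset.univ.sup k + 1, fun g hg => ?_⟩
  rw [pow_succ] at hg
  induction hg using Submodule.mul_induction_on' with
  | mem_mul_mem a ha b hb =>
    induction hb using Submodule.span_induction with
    | mem b hb =>
      obtain ⟨i, rfl⟩ := hb
      rw [mul_assoc]
      exact hk i a (Ideal.pow_le_pow_right (Finset.le_sup (Finset.mem_univ i)) ha)
    | zero => simp
    | add x y _ _ hx hy => rw [mul_add, add_mul]; exact add_mem hx hy
    | smul c x _ hx =>
      rw [smul_eq_mul, mul_left_comm, mul_assoc]
      exact B.mul_mem_left _ hx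
  | add x _ y _ hx hy => rw [add_mul]; exact add_mem hx hy

/-- The saturation is finitely generated, so one power k of the variable ideal sends all homogeneous
components of the generators into B. In degrees at least k above the generators, every homogeneous
coefficient lies in that power. -/
lemma exists_piece_saturation_le (hB : IsHomog B) :
    ∃ N, ∀ m ≥ N, piece (saturation B) m ≤ piece B m := by
  obtain ⟨s, hs⟩ := (isNoetherianRing_iff_ideal_fg _).1 inferInstance (saturation B)
  have hsJ (a) (ha : a ∈ s) : a ∈ saturation B := hs ▸ Ideal.subset_span ha
  have hk : ∃ k, ∀ a ∈ s, ∀ d, ∀ g ∈ varIdeal K n ^ k, g * homogeneousComponent d a ∈ B := by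
    choose! k hk using fun a ha d => hB.saturation a (hsJ a ha) d
    refine ⟨s.sup fun a => (Finset.range (a.totalDegree + 1)).sup (k a), fun a ha d g hg => ?_⟩
    by_cases hd : d < a.totalDegree + 1
    · refine hk a ha d g (Ideal.pow_le_pow_right ?_ hg)
      exact (Finset.le_sup (f := k a) (Finset.mem_range.2 hd)).trans
        (Finset.le_sup (f := fun a => (Finset.range (a.totalDegree + 1)).sup (k a)) ha)
    · rw [homogeneousComponent_eq_zero _ _ (by omega), mul_zero]
      exact zero_mem _
  obtain ⟨k, hk⟩ := hk
  refine ⟨s.sup totalDegree + k, fun m hm f hf => ⟨(?_ : f ∈ B), hf.2⟩⟩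
  have hfJ : f ∈ saturation B := hf.1
  rw [← hs, Ideal.span, Submodule.mem_span_finset] at hfJ
  obtain ⟨c, -, hc⟩ := hfJ
  rw [← homogeneousComponent_eq_self hf.2, ← hc, map_sum]
  refine sum_mem fun a ha => ?_
  rw [smul_eq_mul, mul_comm, ← sum_homogeneousComponent a, Finset.sum_mul, map_sum]
  refine sum_mem fun d hd => ?_
  have h1 := Finset.le_sup (f := totalDegree) ha
  have h2 : d < a.totalDegree + 1 := Finset.mem_range.1 hd
  obtain ⟨e, rfl⟩ : ∃ e, m = d + e := ⟨m - d, by omega⟩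
  rw [homogeneousComponent_mul_of_isHomogeneous (homogeneousComponent_isHomogeneous d a), mul_comm]
  exact hk a ha d _ (mem_varIdeal_pow (homogeneousComponent_isHomogeneous e _) (by omega))

/-- Prime avoidance for linear forms: each of the finitely many associated primes contains a proper
subspace of linear forms, and a vector space over an infinite field is not a finite union of proper
subspaces. -/
lemma exists_elimForm_mul_mem [Infinite K] (B : Ideal (MvPolynomial (Fin (n + 1)) K)) :
    ∃ l : Fin n → K, ∀ f, elimForm l * f ∈ saturation B → f ∈ saturation B := by
  classical
  let J := saturation B
  let φ : (Fin (n + 1) → K) →ₗ[K] MvPolynomial (Fin (n + 1)) K :=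
    Fintype.linearCombination K X
  have hφ (a) : φ a = ∑ i, C (a i) * X i := by
    simp [φ, Fintype.linearCombination_apply, smul_eq_C_mul]
  have hfin := associatedPrimes.finite (MvPolynomial (Fin (n + 1)) K)
    (MvPolynomial (Fin (n + 1)) K ⧸ J)
  let W (P : Ideal (MvPolynomial (Fin (n + 1)) K)) : Subspace K (Fin (n + 1) → K) :=
    (P.restrictScalars K).comap φ
  -- Avoiding this subspace too makes the coefficient of X_0 nonzero, so that the form can be scaled
  -- to an `elimForm`.
  let W0 : Subspace K (Fin (n + 1) → K) := LinearMap.ker (LinearMap.proj 0)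
  have key := Subspace.biUnion_ne_univ_of_top_notMem (s := insert W0 (hfin.toFinset.image W)) (by
    rw [Finset.mem_insert, not_or, Finset.mem_image]
    constructor
    · intro h
      have : (Pi.single 0 1 : Fin (n + 1) → K) ∈ W0 := h ▸ trivial
      simp [W0] at this
    · rintro ⟨P, hP, hW⟩
      obtain ⟨hp, x, hx⟩ := isAssociatedPrime_iff.1 (hfin.mem_toFinset.1 hP)
      obtain ⟨x, rfl⟩ := Ideal.Quotient.mk_surjective x
      have hm (a) : a ∈ P ↔ a * x ∈ J := by
        rw [hx, Submodule.mem_colon_singleton, Submodule.mem_bot,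
          ← Ideal.Quotient.eq_zero_iff_mem, map_mul]
        rfl
      -- If P contained every linear form, all `X i * x` would lie in the saturation J, hence x as
      -- well, and the annihilator P of x would be the unit ideal.
      refine hp.ne_top ((Ideal.eq_top_iff_one _).2 ((hm 1).2 ?_))
      rw [one_mul]
      refine mem_saturation_of_forall_X_mul fun i => (hm _).1 ?_
      have : Pi.single i 1 ∈ W P := hW ▸ trivial
      have : φ (Pi.single i 1) ∈ P := this
      rw [hφ] at this
      simpa [Pi.single_apply] using this)
  obtain ⟨a, ha⟩ := (Set.ne_univ_iff_exists_notMem _).1 key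
  simp only [Finset.mem_insert, Finset.mem_image, Set.mem_iUnion, not_exists, SetLike.mem_coe] at ha
  have ha0 : a 0 ≠ 0 := fun h => ha W0 (.inl rfl) h
  have haP (P) (hP : P ∈ associatedPrimes (MvPolynomial (Fin (n + 1)) K)
      (MvPolynomial (Fin (n + 1)) K ⧸ J)) : φ a ∉ P :=
    fun h => ha (W P) (.inr ⟨P, hfin.mem_toFinset.2 hP, rfl⟩) h
  refine ⟨fun i => - (a i.succ / a 0), fun f hf => ?_⟩
  by_contra hfJ
  have hne : Ideal.Quotient.mk J f ≠ 0 := fun h => hfJ (Ideal.Quotient.eq_zero_iff_mem.1 h)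
  obtain ⟨P, hP, hle⟩ := exists_le_isAssociatedPrime_of_isNoetherianRing
    (MvPolynomial (Fin (n + 1)) K) _ hne
  refine haP P hP (hle ?_)
  rw [Submodule.mem_colon_singleton, Submodule.mem_bot]
  refine Ideal.Quotient.eq_zero_iff_mem.2 (?_ : φ a * f ∈ J)
  have : φ a = C (a 0) * elimForm fun i => - (a i.succ / a 0) := by
    rw [hφ, Fin.sum_univ_succ, elimForm, mul_sub, Finset.mul_sum, sub_eq_add_neg,
      ← Finset.sum_neg_distrib]
    congr 1
    refine Finset.sum_congr rfl fun i _ => ?_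
    rw [← mul_assoc, ← map_mul, ← neg_mul, ← map_neg]
    congr 2
    field_simp
  rw [this, mul_assoc]
  exact J.mul_mem_left _ hf

end Saturation

end SexticBlowup

namespace SexticBlowup

open MvPolynomial Filter

/-! ### The ideal of the curve in low degrees and its plane sections -/

section CurveIdeal

variable {K : Type} [Field K]

/-- An irreducible h dividing two variables would be associated to both. Thus (h) does not contain
the irrelevant ideal, as `le_of_cubics` requires. -/
lemma exists_X_notMem_span_singleton {n : ℕ} {h : MvPolynomial (Fin (n + 2)) K}
    (hh : Irreducible h) : ∃ i, X i ∉ Ideal.span {h} := by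
  by_contra! H
  simp only [Ideal.mem_span_singleton] at H
  have h0 := (hh.associated_of_dvd (irreducible_of_isHomogeneous_one (isHomogeneous_X K 0)
    (X_ne_zero _)) (H 0)).symm.dvd.trans (H 1)
  rw [X_dvd_X] at h0
  simp at h0

/-- Numerical and scheme-theoretic properties of the homogeneous ideal of a curve of degree 6 and
genus 3 in projective space which is an intersection of cubics. -/
structure IsCubicSexticIdeal (I : Ideal (MvPolynomial (Fin 4) K)) : Prop where
  isPrime : I.IsPrime
  isHomog : IsHomog I
  -- The Hilbert polynomial of the quotient is 6m + 1 - 3 = 6m - 2.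
  finrank_piece : ∀ᶠ m in atTop, Module.finrank K (piece I m) + 6 * m = monCount K 4 m + 2
  -- The primes allowed here are the points of ℙ³; the condition says that a common zero of the
  -- cubics through C lies on C.
  le_of_cubics : ∀ P : Ideal (MvPolynomial (Fin 4) K), P.IsPrime → IsHomog P → (∃ i, X i ∉ P) →
    (∀ f ∈ piece I 3, f ∈ P) → I ≤ P

variable {I : Ideal (MvPolynomial (Fin 4) K)}

/-- If f divided all cubics of I, then I ⊆ (f), although the Hilbert function of a surface grows
quadratically. So some cubic F in I is coprime to f, and I contains the complete intersection (f,
F). For d = 1 its degree is 3; for d = 2 its Hilbert polynomial is 6m - 3. Both are eventually below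
6m - 2. -/
lemma IsCubicSexticIdeal.not_irreducible (hI : IsCubicSexticIdeal I) {d : ℕ} (hd : d = 1 ∨ d = 2)
    {f : MvPolynomial (Fin 4) K} (hf : f.IsHomogeneous d) (hfI : f ∈ I) : ¬ Irreducible f := by
  intro hirr
  obtain ⟨N, hN⟩ := eventually_atTop.1 hI.finrank_piece
  obtain ⟨F, hF, hFf⟩ : ∃ F ∈ piece I 3, ¬ f ∣ F := by
    by_contra! H
    have hle := hI.le_of_cubics (Ideal.span {f})
      ((Ideal.span_singleton_prime hirr.ne_zero).2 hirr.prime)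
      (isHomog_span fun g hg => ⟨d, by rwa [Set.mem_singleton_iff.1 hg]⟩)
      (exists_X_notMem_span_singleton hirr)
      (fun g hg => Ideal.mem_span_singleton.2 (H g hg))
    -- The margin 20 puts the degree where the quadratic growth of the surface already exceeds 6m -
    -- 2.
    have h1 := finrank_piece_mono hle (N + 20 + d)
    have h2 := hN (N + 20 + d) (by omega)
    rw [finrank_piece_span_singleton hf hirr.ne_zero] at h1
    have h3 := six_mul_monCount_four (K := K) (N + 20)
    have h4 := six_mul_monCount_four (K := K) (N + 20 + d)
    rcases hd with rfl | rfl <;> ring_nf at h1 h2 h3 h4 <;> nlinarith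
  have hcop := hirr.isRelPrime_iff_not_dvd.2 hFf
  have h1 := monCount_add_le_finrank_piece hf hF.2 hfI hF.1 hirr.ne_zero hcop N
  have h2 := hN (N + d + 3) (by omega)
  have h3 := six_mul_monCount_four (K := K) N
  have h4 := six_mul_monCount_four (K := K) (N + d)
  have h5 := six_mul_monCount_four (K := K) (N + 3)
  have h6 := six_mul_monCount_four (K := K) (N + d + 3)
  rcases hd with rfl | rfl <;> ring_nf at h1 h2 h3 h4 h5 h6 <;> linarith

/-- Nonzero linear forms are irreducible, and a reducible quadric in the prime ideal I has a linear
factor in I, so every case reduces to `not_irreducible` or to a unit. -/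
lemma IsCubicSexticIdeal.eq_zero (hI : IsCubicSexticIdeal I) {d : ℕ} (hd : d ≤ 2)
    {f : MvPolynomial (Fin 4) K} (hf : f.IsHomogeneous d) (hfI : f ∈ I) : f = 0 := by
  by_contra h0
  have hone {g : MvPolynomial (Fin 4) K} (hg : g.IsHomogeneous 1) (hg0 : g ≠ 0) : g ∉ I :=
    fun hgI => hI.not_irreducible (.inl rfl) hg hgI (irreducible_of_isHomogeneous_one hg hg0)
  interval_cases d
  · exact hI.isPrime.ne_top (Ideal.eq_top_of_isUnit_mem _ hfI (isUnit_of_isHomogeneous_zero hf h0))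
  · exact hone hf h0 hfI
  · have := hI.not_irreducible (.inr rfl) hf hfI
    rw [irreducible_iff] at this
    push Not at this
    obtain ⟨a, b, rfl, ha, hb⟩ := this (not_isUnit_of_isHomogeneous hf (by norm_num))
    obtain ⟨ha0, hb0⟩ := mul_ne_zero_iff.1 h0
    obtain ⟨i, j, hij, hai, hbj⟩ := isHomogeneous_of_mul hf h0
    obtain rfl | rfl | rfl : i = 0 ∨ i = 1 ∨ i = 2 := by omega
    · exact ha (isUnit_of_isHomogeneous_zero hai ha0)
    · obtain rfl : j = 1 := by omega
      exact (hI.isPrime.mem_or_mem hfI).elim (hone hai ha0) (hone hbj hb0)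
    · obtain rfl : j = 0 := by omega
      exact hb (isUnit_of_isHomogeneous_zero hbj hb0)

lemma IsCubicSexticIdeal.elimForm_mul_mem (hI : IsCubicSexticIdeal I) (l : Fin 3 → K)
    (f : MvPolynomial (Fin 4) K) (hf : elimForm l * f ∈ I) : f ∈ I :=
  (hI.isPrime.mem_or_mem hf).resolve_left fun h => elimForm_ne_zero l
    (hI.eq_zero one_le_two (elimForm_isHomogeneous l) h)

/-- The properties of the ideal of a hyperplane section. -/
structure IsSixPointIdeal (B : Ideal (MvPolynomial (Fin 3) K)) : Prop where
  isHomog : IsHomog B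
  finrank_piece : ∀ᶠ m in atTop, Module.finrank K (piece B m) + 6 = monCount K 3 m
  exists_cubic : ∀ h : MvPolynomial (Fin 3) K, Irreducible h → ∀ d ∈ ({1, 2} : Set ℕ),
    h.IsHomogeneous d → ∃ F ∈ piece B 3, ¬ h ∣ F

/-- The constant 6 is the first difference of 6m - 2. If h divided all cubics of the section, the
preimage of (h) would be a homogeneous prime containing the cubics of I, hence I itself; then the
section ideal would lie in (h), whose quotient has unbounded Hilbert function. -/
lemma IsCubicSexticIdeal.isSixPointIdeal (hI : IsCubicSexticIdeal I) (l : Fin 3 → K) :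
    IsSixPointIdeal (I.map (elim l)) := by
  have hB : ∀ᶠ m in atTop, Module.finrank K (piece (I.map (elim l)) m) + 6 = monCount K 3 m := by
    obtain ⟨N, hN⟩ := eventually_atTop.1 hI.finrank_piece
    refine eventually_atTop.2 ⟨N + 1, fun m hm => ?_⟩
    obtain ⟨m, rfl⟩ : ∃ k, m = k + 1 := ⟨m - 1, by omega⟩
    have h1 := hN m (by omega)
    have h2 := hN (m + 1) (by omega)
    have h3 : Module.finrank K (piece (I.map (elim l)) (m + 1)) + Module.finrank K (piece I m) =
      Module.finrank K (piece I (m + 1)) :=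
      finrank_piece_map_elim hI.isHomog (hI.elimForm_mul_mem l) m
    have h4 : monCount K 4 (m + 1) = monCount K 3 (m + 1) + monCount K 4 m := monCount_succ m
    omega
  refine ⟨hI.isHomog.map_elim, hB, fun h hh d hd hhd => ?_⟩
  by_contra! H
  obtain ⟨N, hN⟩ := eventually_atTop.1 hB
  let P : Ideal (MvPolynomial (Fin 4) K) := (Ideal.span {h}).comap (elim l)
  have hp : (Ideal.span {h}).IsPrime := (Ideal.span_singleton_prime hh.ne_zero).2 hh.prime
  have hle : I ≤ P := by
    refine hI.le_of_cubics P (Ideal.comap_isPrime _ _) (fun f hf m => ?_) ?_ fun f hf => ?_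
    · have := isHomog_span (fun g hg => ⟨d, by rwa [Set.mem_singleton_iff.1 hg]⟩) _ hf m
      rwa [homogeneousComponent_elim] at this
    · obtain ⟨i, hi⟩ := exists_X_notMem_span_singleton hh
      exact ⟨i.succ, fun h => hi (by simpa [P] using h)⟩
    · exact Ideal.mem_span_singleton.2 (H _ (elim_mem_piece hf))
  have h1 := finrank_piece_mono (Ideal.map_le_iff_le_comap.2 hle) (N + 20 + d)
  rw [finrank_piece_span_singleton hhd hh.ne_zero] at h1
  have h2 := hN (N + 20 + d) (by omega)
  have h3 := two_mul_monCount_three (K := K) (N + 20)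
  have h4 := two_mul_monCount_three (K := K) (N + 20 + d)
  rcases hd with rfl | rfl <;> ring_nf at h1 h2 h3 h4 <;> nlinarith

end CurveIdeal

/-! ### Six points in the plane: the saturated ideal -/

section HyperplaneSection

variable {K : Type} [Field K] {B J : Ideal (MvPolynomial (Fin 3) K)} {l : Fin 2 → K}

/-- A homogeneous ideal without embedded component at the irrelevant ideal (witnessed by a
linear form), which agrees with the ideal `B` in large degrees. -/
structure IsSaturationOf (B J : Ideal (MvPolynomial (Fin 3) K)) (l : Fin 2 → K) : Prop where
  isHomog : IsHomog J
  le : B ≤ J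
  elimForm_mul_mem : ∀ f, elimForm l * f ∈ J → f ∈ J
  piece_le : ∀ᶠ m in atTop, piece J m ≤ piece B m

lemma exists_isSaturationOf [Infinite K] (hB : IsHomog B) : ∃ J l, IsSaturationOf B J l := by
  obtain ⟨l, hl⟩ := exists_elimForm_mul_mem B
  obtain ⟨N, hN⟩ := exists_piece_saturation_le hB
  exact ⟨_, l, hB.saturation, le_saturation, hl, eventually_atTop.2 ⟨N, hN⟩⟩

lemma IsSaturationOf.finrank_piece (hJ : IsSaturationOf B J l) (hB : IsSixPointIdeal B) :
    ∀ᶠ m in atTop, Module.finrank K (piece J m) + 6 = monCount K 3 m := by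
  filter_upwards [hJ.piece_le, hB.finrank_piece] with m h1 h2
  rw [(piece_mono hJ.le m).antisymm h1] at h2
  exact h2

lemma IsSaturationOf.finrank_piece_succ (hJ : IsSaturationOf B J l) (m : ℕ) :
    Module.finrank K (piece (J.map (elim l)) (m + 1)) + Module.finrank K (piece J m) =
      Module.finrank K (piece J (m + 1)) :=
  finrank_piece_map_elim hJ.isHomog hJ.elimForm_mul_mem m

/-- The Hilbert function of the quotient by J is nondecreasing, since multiplication by a linear
form is injective on it. -/
lemma IsSaturationOf.finrank_piece_add_le (hJ : IsSaturationOf B J l) (m k : ℕ) :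
    Module.finrank K (piece J (m + k)) + monCount K 3 m ≤
      Module.finrank K (piece J m) + monCount K 3 (m + k) := by
  induction k with
  | zero => rfl
  | succ k ih =>
    have h1 := hJ.finrank_piece_succ (m + k)
    have h2 := finrank_piece_le (J.map (elim l)) (m + k + 1)
    have h3 : monCount K 3 (m + k + 1) = monCount K 2 (m + k + 1) + monCount K 3 (m + k) :=
      monCount_succ (m + k)
    rw [← add_assoc]
    omega

/-- A line and a cubic without common component meet in a scheme of length 3, too short for Hilbert
polynomial 6. -/
lemma IsSaturationOf.eq_zero_of_isHomogeneous_one (hJ : IsSaturationOf B J l)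
    (hB : IsSixPointIdeal B) {h : MvPolynomial (Fin 3) K} (hh : h.IsHomogeneous 1) (hhJ : h ∈ J) :
    h = 0 := by
  by_contra h0
  have hirr := irreducible_of_isHomogeneous_one hh h0
  obtain ⟨F, hF, hFh⟩ := hB.exists_cubic h hirr 1 (by simp) hh
  obtain ⟨N, hN⟩ := eventually_atTop.1 (hJ.finrank_piece hB)
  have h1 := monCount_add_le_finrank_piece hh hF.2 hhJ (hJ.le hF.1) h0
    (hirr.isRelPrime_iff_not_dvd.2 hFh) N
  have h2 := hN (N + 1 + 3) (by omega)
  have h3 := two_mul_monCount_three (K := K) N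
  have h4 := two_mul_monCount_three (K := K) (N + 1)
  have h5 := two_mul_monCount_three (K := K) (N + 3)
  have h6 := two_mul_monCount_three (K := K) (N + 1 + 3)
  ring_nf at h1 h2 h3 h4 h5 h6
  linarith

/-- For a product of two lines, take a cubic avoiding the first and one avoiding the second; one of
them or their sum avoids both. -/
lemma IsSixPointIdeal.exists_isRelPrime (hB : IsSixPointIdeal B) {q : MvPolynomial (Fin 3) K}
    (hq : q.IsHomogeneous 2) (hq0 : q ≠ 0) : ∃ F ∈ piece B 3, IsRelPrime q F := by
  by_cases hirr : Irreducible q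
  · obtain ⟨F, hF, h⟩ := hB.exists_cubic q hirr 2 (by simp) hq
    exact ⟨F, hF, hirr.isRelPrime_iff_not_dvd.2 h⟩
  rw [irreducible_iff] at hirr
  push Not at hirr
  obtain ⟨a, b, rfl, ha, hb⟩ := hirr (not_isUnit_of_isHomogeneous hq (by norm_num))
  obtain ⟨ha0, hb0⟩ := mul_ne_zero_iff.1 hq0
  obtain ⟨i, j, hij, hai, hbj⟩ := isHomogeneous_of_mul hq hq0
  have hi : i ≠ 0 := by rintro rfl; exact ha (isUnit_of_isHomogeneous_zero hai ha0)
  have hj : j ≠ 0 := by rintro rfl; exact hb (isUnit_of_isHomogeneous_zero hbj hb0)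
  obtain rfl : i = 1 := by omega
  obtain rfl : j = 1 := by omega
  have ha' := irreducible_of_isHomogeneous_one hai ha0
  have hb' := irreducible_of_isHomogeneous_one hbj hb0
  obtain ⟨F, hF, hFa⟩ := hB.exists_cubic a ha' 1 (by simp) hai
  obtain ⟨G, hG, hGb⟩ := hB.exists_cubic b hb' 1 (by simp) hbj
  obtain ⟨E, hE, hEa, hEb⟩ : ∃ E ∈ piece B 3, ¬ a ∣ E ∧ ¬ b ∣ E := by
    by_cases h1 : b ∣ F
    · by_cases h2 : a ∣ G
      · exact ⟨F + G, add_mem hF hG, fun h => hFa ((dvd_add_left h2).1 h),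
          fun h => hGb ((dvd_add_right h1).1 h)⟩
      · exact ⟨G, hG, h2, hGb⟩
    · exact ⟨F, hF, hFa, h1⟩
  exact ⟨E, hE, (ha'.isRelPrime_iff_not_dvd.2 hEa).mul_left (hb'.isRelPrime_iff_not_dvd.2 hEb)⟩

/-- In large degrees J has constant codimension 6, so its restriction to the line contains all
forms. A common factor of the restrictions of q and F of positive degree would divide all of them.
-/
lemma IsSaturationOf.isRelPrime_elim (hJ : IsSaturationOf B J l) (hB : IsSixPointIdeal B)
    {q F : MvPolynomial (Fin 3) K} (hq : q ∈ piece J 2) (hq0 : q ≠ 0) (hle : ∀ᶠ m in atTop,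
      piece J m ≤ piece (Ideal.span {q, F}) m) :
    IsRelPrime (elim l q) (elim l F) := by
  intro d hdq hdF
  have hq1 : elim l q ≠ 0 := fun h => by
    obtain ⟨g, hg, rfl⟩ := exists_eq_elimForm_mul l hq.2 h
    exact hq0 (by rw [hJ.eq_zero_of_isHomogeneous_one hB hg (hJ.elimForm_mul_mem _ hq.1), mul_zero])
  obtain ⟨c, hc⟩ := hdq
  obtain ⟨e, -, -, hd, -⟩ := isHomogeneous_of_mul (hc ▸ elim_isHomogeneous l hq.2) (hc ▸ hq1)
  have hd0 : d ≠ 0 := fun h => hq1 (by rw [hc, h, zero_mul])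
  rcases Nat.eq_zero_or_pos e with rfl | he
  · exact isUnit_of_isHomogeneous_zero hd hd0
  exfalso
  obtain ⟨N, hN⟩ := eventually_atTop.1 ((hJ.finrank_piece hB).and hle)
  have hle' : piece (J.map (elim l)) (N + 1 + e) ≤ piece (Ideal.span {d}) (N + 1 + e) := by
    intro f hf
    obtain ⟨g, hg, rfl⟩ := exists_mem_piece_of_mem_piece_map hJ.isHomog hf
    refine ⟨Ideal.mem_span_singleton.2 ?_, hf.2⟩
    obtain ⟨a, b, hab⟩ := Ideal.mem_span_pair.1 ((hN _ (by omega)).2 hg).1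
    rw [← hab, map_add, map_mul, map_mul]
    exact dvd_add (Dvd.dvd.mul_left ⟨c, hc⟩ _) (hdF.mul_left _)
  have h1 := Submodule.finrank_mono hle'
  rw [finrank_piece_span_singleton hd hd0] at h1
  have h2 := hJ.finrank_piece_succ (N + e)
  rw [show N + e + 1 = N + 1 + e by omega] at h2
  have h3 := (hN (N + e) (by omega)).1
  have h4 := (hN (N + 1 + e) (by omega)).1
  have h5 : monCount K 3 (N + e + 1) = monCount K 2 (N + e + 1) + monCount K 3 (N + e) :=
    monCount_succ (N + e)
  rw [show N + e + 1 = N + 1 + e by omega] at h5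
  rw [monCount_two] at h1 h5
  omega

/-- The linear form is a nonzerodivisor modulo (q, F): restricted to the line, the relation a q + b
F = 0 is a Koszul relation, and subtracting a lift of it makes both coefficients divisible by
`elimForm l`. -/
lemma mem_span_pair_of_elimForm_mul_mem {q F f : MvPolynomial (Fin 3) K}
    (hcop : IsRelPrime (elim l q) (elim l F)) (hq : elim l q ≠ 0)
    (hf : elimForm l * f ∈ Ideal.span {q, F}) : f ∈ Ideal.span {q, F} := by
  obtain ⟨a, b, hab⟩ := Ideal.mem_span_pair.1 hf
  have h : elim l a * elim l q + elim l b * elim l F = 0 := by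
    rw [← map_mul, ← map_mul, ← map_add, hab, map_mul, elim_elimForm, zero_mul]
  obtain ⟨c, hc⟩ : elim l q ∣ elim l b :=
    hcop.dvd_of_dvd_mul_right ⟨-elim l a, by linear_combination h⟩
  obtain ⟨c, rfl⟩ := elim_surjective l c
  have ha : elim l a = -(elim l F * elim l c) :=
    mul_left_cancel₀ hq (by rw [hc] at h; linear_combination h)
  obtain ⟨a', ha'⟩ := (elim_eq_zero_iff (n := 2) l (f := a + F * c)).1 (by
    rw [map_add, map_mul, ha, neg_add_cancel])
  obtain ⟨b', hb'⟩ := (elim_eq_zero_iff (n := 2) l (f := b - q * c)).1 (by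
    rw [map_sub, map_mul, hc, sub_self])
  refine Ideal.mem_span_pair.2 ⟨a', b', mul_left_cancel₀ (elimForm_ne_zero l) ?_⟩
  linear_combination hab - q * ha' - F * hb'

/-- If the saturation contains a conic `q`, then it is the ideal of a complete intersection of
`q` with a cubic, at least in degree 3. -/
lemma IsSaturationOf.exists_cubic_of_conic (hJ : IsSaturationOf B J l) (hB : IsSixPointIdeal B)
    {q : MvPolynomial (Fin 3) K} (hq : q ∈ piece J 2) (hq0 : q ≠ 0) :
    ∃ F ∈ piece B 3, IsRelPrime q F ∧ ∀ f ∈ piece J 3, ∃ (a : MvPolynomial (Fin 3) K) (b : K),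
      a.IsHomogeneous 1 ∧ f = q * a + C b * F := by
  obtain ⟨F, hF, hcop⟩ := hB.exists_isRelPrime hq.2 hq0
  refine ⟨F, hF, hcop, fun f hf => ?_⟩
  have hDJ : Ideal.span {q, F} ≤ J := by
    rw [Ideal.span_le]
    rintro x (rfl | rfl)
    exacts [hq.1, hJ.le hF.1]
  -- The complete intersection (q, F) has length 2 · 3 = 6, the same as J, so the two ideals agree
  -- in large degrees.
  have hle : ∀ᶠ m in atTop, piece J m ≤ piece (Ideal.span {q, F}) m := by
    obtain ⟨N, hN⟩ := eventually_atTop.1 (hJ.finrank_piece hB)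
    refine eventually_atTop.2 ⟨N + 5, fun m hm => ?_⟩
    obtain ⟨m, rfl⟩ : ∃ k, m = k + 2 + 3 := ⟨m - 5, by omega⟩
    refine (Submodule.eq_of_le_of_finrank_le (piece_mono hDJ _) ?_).ge
    have h1 := monCount_add_le_finrank_piece hq.2 hF.2 (J := Ideal.span {q, F})
      (Ideal.subset_span (by simp)) (Ideal.subset_span (by simp)) hq0 hcop m
    have h2 := hN (m + 2 + 3) (by omega)
    have h3 := two_mul_monCount_three (K := K) m
    have h4 := two_mul_monCount_three (K := K) (m + 2)
    have h5 := two_mul_monCount_three (K := K) (m + 3)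
    have h6 := two_mul_monCount_three (K := K) (m + 2 + 3)
    suffices 2 * monCount K 3 (m + 2 + 3) + 2 * monCount K 3 m =
        2 * monCount K 3 (m + 3) + 2 * monCount K 3 (m + 2) + 12 by omega
    rw [h3, h4, h5, h6]
    ring
  have hcop' := hJ.isRelPrime_elim hB hq hq0 hle
  have hq1 : elim l q ≠ 0 := fun h => by
    obtain ⟨g, hg, rfl⟩ := exists_eq_elimForm_mul l hq.2 h
    exact hq0 (by rw [hJ.eq_zero_of_isHomogeneous_one hB hg (hJ.elimForm_mul_mem _ hq.1), mul_zero])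
  obtain ⟨N, hN⟩ := eventually_atTop.1 hle
  -- Agreement in large degrees descends to degree 3 by cancelling powers of the linear form.
  have hpow (k : ℕ) : elimForm l ^ k * f ∈ Ideal.span {q, F} → f ∈ Ideal.span {q, F} := by
    induction k with
    | zero => simp
    | succ k ih =>
      intro h
      refine ih (mem_span_pair_of_elimForm_mul_mem hcop' hq1 ?_)
      rwa [← mul_assoc, ← pow_succ']
  have hfD := hpow N (hN (1 * N + 3) (by omega)
    ⟨J.mul_mem_left _ hf.1, ((elimForm_isHomogeneous l).pow N).mul hf.2⟩).1
  obtain ⟨a, b, hab⟩ := Ideal.mem_span_pair.1 hfD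
  refine ⟨homogeneousComponent 1 a, coeff 0 b, homogeneousComponent_isHomogeneous _ _, ?_⟩
  rw [← homogeneousComponent_zero, ← homogeneousComponent_eq_self hf.2, ← hab, map_add,
    mul_comm a q, mul_comm b F]
  have h1 : homogeneousComponent 3 (q * a) = _ :=
    homogeneousComponent_mul_of_isHomogeneous hq.2 a 1
  have h2 : homogeneousComponent 3 (F * b) = _ :=
    homogeneousComponent_mul_of_isHomogeneous hF.2 b 0
  rw [h1, h2, mul_comm F]

/-- If J contains a conic q, its cubics are spanned by three multiples of q and one further cubic,
and 10 - 4 = 6. Otherwise the quotient already has dimension 6 in degree 2. Monotonicity gives the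
higher degrees. -/
lemma IsSaturationOf.finrank_piece_le_three (hJ : IsSaturationOf B J l) (hB : IsSixPointIdeal B)
    {m : ℕ} (hm : 3 ≤ m) : Module.finrank K (piece J m) + 6 ≤ monCount K 3 m := by
  have h2 := two_mul_monCount_three (K := K) 2
  have h3 := two_mul_monCount_three (K := K) 3
  obtain ⟨k, rfl⟩ := Nat.exists_eq_add_of_le hm
  by_cases hq : ∃ q ∈ piece J 2, q ≠ 0
  · obtain ⟨q, hq, hq0⟩ := hq
    obtain ⟨F, hF, -, h⟩ := hJ.exists_cubic_of_conic hB hq hq0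
    let φ : homogeneousSubmodule (Fin 3) K 1 × K →ₗ[K] MvPolynomial (Fin 3) K :=
      ((LinearMap.mulLeft K q).comp (Submodule.subtype _)).coprod (LinearMap.toSpanSingleton K _ F)
    have hle : piece J 3 ≤ φ.range := by
      intro f hf
      obtain ⟨a, b, ha, rfl⟩ := h f hf
      exact ⟨⟨⟨a, ha⟩, b⟩, by simp [φ, smul_eq_C_mul]⟩
    have h4 := (Submodule.finrank_mono hle).trans (LinearMap.finrank_range_le φ)
    rw [Module.finrank_prod, Module.finrank_self] at h4
    have h5 := two_mul_monCount_three (K := K) 1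
    rw [monCount] at h5
    have h6 := hJ.finrank_piece_add_le 3 k
    omega
  · have h4 : piece J 2 = ⊥ := by
      refine (Submodule.eq_bot_iff _).2 fun q hq' => ?_
      by_contra h
      exact hq ⟨q, hq', h⟩
    have h5 : Module.finrank K (piece J 2) = 0 := by rw [h4, finrank_bot]
    have h6 := hJ.finrank_piece_add_le 2 (1 + k)
    rw [show 2 + (1 + k) = 3 + k by omega] at h6
    omega

end HyperplaneSection

/-! ### Saturation of the plane section -/

section CurveIdeal

variable {K : Type} [Field K] {I : Ideal (MvPolynomial (Fin 4) K)} {l₀ : Fin 3 → K}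
  {J : Ideal (MvPolynomial (Fin 3) K)} {l : Fin 2 → K}

lemma IsCubicSexticIdeal.finrank_piece_succ (hI : IsCubicSexticIdeal I) (m : ℕ) :
    Module.finrank K (piece (I.map (elim l₀)) (m + 1)) + Module.finrank K (piece I m) =
      Module.finrank K (piece I (m + 1)) :=
  finrank_piece_map_elim hI.isHomog (hI.elimForm_mul_mem l₀) m

lemma IsCubicSexticIdeal.piece_eq_bot (hI : IsCubicSexticIdeal I) {d : ℕ} (hd : d ≤ 2) :
    piece I d = ⊥ :=
  (Submodule.eq_bot_iff _).2 fun _ hf => hI.eq_zero hd hf.2 hf.1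

/-- In degree 2 the Hilbert function of the quotient is 10 = 6 · 2 - 2, and from there it grows by
at least 6 per step. It is eventually 6m - 2, so no step can exceed 6. -/
lemma IsCubicSexticIdeal.finrank_piece_eq (hI : IsCubicSexticIdeal I)
    (hJ : IsSaturationOf (I.map (elim l₀)) J l) {m : ℕ} (hm : 2 ≤ m) :
    Module.finrank K (piece I m) + 6 * m = monCount K 4 m + 2 := by
  have hB := hI.isSixPointIdeal l₀
  have step (m : ℕ) (hm : 2 ≤ m) : Module.finrank K (piece I (m + 1)) + 6 + monCount K 4 m ≤
      monCount K 4 (m + 1) + Module.finrank K (piece I m) := by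
    have h1 := hI.finrank_piece_succ (l₀ := l₀) m
    have h2 := finrank_piece_mono hJ.le (m + 1)
    have h3 := hJ.finrank_piece_le_three hB (m := m + 1) (by omega)
    have h4 : monCount K 4 (m + 1) = monCount K 3 (m + 1) + monCount K 4 m := monCount_succ m
    omega
  have up (k : ℕ) : Module.finrank K (piece I (2 + k)) + 6 * (2 + k) ≤ monCount K 4 (2 + k) + 2 := by
    induction k with
    | zero =>
      have h1 := six_mul_monCount_four (K := K) 2
      have h2 : Module.finrank K (piece I 2) = 0 := by rw [hI.piece_eq_bot le_rfl, finrank_bot]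
      rw [add_zero]
      omega
    | succ k ih =>
      have := step (2 + k) (by omega)
      rw [← add_assoc]
      omega
  have down (k : ℕ) : Module.finrank K (piece I (m + k)) + 6 * k + monCount K 4 m ≤
      monCount K 4 (m + k) + Module.finrank K (piece I m) := by
    induction k with
    | zero => rw [add_zero]; omega
    | succ k ih =>
      have := step (m + k) (by omega)
      rw [← add_assoc]
      omega
  obtain ⟨N, hN⟩ := eventually_atTop.1 hI.finrank_piece
  have h1 := down N
  have h2 := hN (m + N) (by omega)
  have h3 := up (m - 2)
  rw [show 2 + (m - 2) = m by omega] at h3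
  omega

lemma IsCubicSexticIdeal.piece_saturation_le (hI : IsCubicSexticIdeal I)
    (hJ : IsSaturationOf (I.map (elim l₀)) J l) {m : ℕ} (hm : 3 ≤ m) :
    piece J m ≤ piece (I.map (elim l₀)) m := by
  refine (Submodule.eq_of_le_of_finrank_le (piece_mono hJ.le m) ?_).ge
  obtain ⟨m, rfl⟩ : ∃ k, m = k + 1 := ⟨m - 1, by omega⟩
  have h1 := hI.finrank_piece_succ (l₀ := l₀) m
  have h2 := hI.finrank_piece_eq hJ (m := m) (by omega)
  have h3 := hI.finrank_piece_eq hJ (m := m + 1) (by omega)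
  have h4 := hJ.finrank_piece_le_three (hI.isSixPointIdeal l₀) hm
  have h5 : monCount K 4 (m + 1) = monCount K 3 (m + 1) + monCount K 4 m := monCount_succ m
  omega

lemma IsCubicSexticIdeal.exists_eq_elimForm_mul (hI : IsCubicSexticIdeal I) {m : ℕ}
    {f : MvPolynomial (Fin 4) K} (hf : f ∈ piece I (m + 1)) (h : elim l₀ f = 0) :
    ∃ g ∈ piece I m, f = elimForm l₀ * g := by
  obtain ⟨g, hg, rfl⟩ := SexticBlowup.exists_eq_elimForm_mul l₀ hf.2 h
  exact ⟨g, ⟨hI.elimForm_mul_mem l₀ g hf.1, hg⟩, rfl⟩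

lemma IsCubicSexticIdeal.eq_of_elim_eq (hI : IsCubicSexticIdeal I) {F G : MvPolynomial (Fin 4) K}
    (hF : F ∈ piece I 3) (hG : G ∈ piece I 3) (h : elim l₀ F = elim l₀ G) : F = G := by
  obtain ⟨g, hg, e⟩ := hI.exists_eq_elimForm_mul (l₀ := l₀) (sub_mem hF hG)
    (by rw [map_sub, h, sub_self])
  rw [hI.eq_zero le_rfl hg.2 hg.1, mul_zero] at e
  exact sub_eq_zero.1 e

lemma exists_eq_sum_C_mul_X {n : ℕ} {f : MvPolynomial (Fin n) K} (hf : f.IsHomogeneous 1) :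
    ∃ a : Fin n → K, f = ∑ i, C (a i) * X i := by
  have : f ∈ homogeneousSubmodule (Fin n) K 1 := hf
  rw [homogeneousSubmodule_one_eq_span_X, Submodule.mem_span_range_iff_exists_fun] at this
  obtain ⟨a, rfl⟩ := this
  exact ⟨a, by simp_rw [smul_eq_C_mul]⟩

lemma eq_zero_of_mul_isHomogeneous {n a b : ℕ} {p q : MvPolynomial (Fin n) K}
    (hp : p.IsHomogeneous a) (hpq : (p * q).IsHomogeneous b) (hab : b < a) : p * q = 0 := by
  by_contra h
  obtain ⟨c, d, hcd, hc, -⟩ := isHomogeneous_of_mul hpq h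
  have := hp.inj_right hc (left_ne_zero_of_mul h)
  omega

/-- The products of a conic q with the three variables of the plane lift to cubics G_i in I. Their
Koszul relations lift up to multiples `elimForm l₀ * A`. Controlling these A shows that one G_i is a
linear form times a quadric, and a member of the prime ideal I of degree at most two results. -/
lemma IsCubicSexticIdeal.eq_zero_of_mem_saturation (hI : IsCubicSexticIdeal I)
    (hJ : IsSaturationOf (I.map (elim l₀)) J l) {q : MvPolynomial (Fin 3) K}
    (hq : q ∈ piece J 2) : q = 0 := by
  by_contra hq0
  obtain ⟨F, hF, hcop, hJ3⟩ := hJ.exists_cubic_of_conic (hI.isSixPointIdeal l₀) hq hq0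
  have hG (i : Fin 3) : ∃ G ∈ piece I 3, elim l₀ G = X i * q :=
    exists_mem_piece_of_mem_piece_map hI.isHomog (hI.piece_saturation_le hJ le_rfl
      ⟨J.mul_mem_left _ hq.1, (isHomogeneous_X K i).mul hq.2⟩)
  choose G hGI hG using hG
  have hA (i j : Fin 3) : ∃ (A : MvPolynomial (Fin 4) K) (L : MvPolynomial (Fin 3) K) (c : K),
      A ∈ piece I 3 ∧ X i.succ * G j - X j.succ * G i = elimForm l₀ * A ∧ L.IsHomogeneous 1 ∧
      elim l₀ A = q * L + C c * F := by
    obtain ⟨A, hA, e⟩ := hI.exists_eq_elimForm_mul (l₀ := l₀) (m := 3)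
      (f := X i.succ * G j - X j.succ * G i)
      (sub_mem ⟨I.mul_mem_left _ (hGI j).1, (isHomogeneous_X K _).mul (hGI j).2⟩
        ⟨I.mul_mem_left _ (hGI i).1, (isHomogeneous_X K _).mul (hGI i).2⟩)
      (by rw [map_sub, map_mul, map_mul, hG, hG, elim_X_succ, elim_X_succ]; ring)
    obtain ⟨L, c, hL, h⟩ := hJ3 _ (piece_mono hJ.le 3 (elim_mem_piece hA))
    exact ⟨A, L, c, hA, e, hL, h⟩
  obtain ⟨A₀, L₀, c₀, hA₀, e₀, hL₀, h₀⟩ := hA 1 2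
  obtain ⟨A₁, L₁, c₁, hA₁, e₁, hL₁, h₁⟩ := hA 2 0
  obtain ⟨A₂, L₂, c₂, hA₂, e₂, hL₂, h₂⟩ := hA 0 1
  -- The Jacobi-type identity among the Koszul relations, after cancelling the linear form.
  have hsum : X (Fin.succ 0) * A₀ + X (Fin.succ 1) * A₁ + X (Fin.succ 2) * A₂ = 0 :=
    mul_left_cancel₀ (elimForm_ne_zero l₀) (by
      linear_combination -X (Fin.succ 0) * e₀ - X (Fin.succ 1) * e₁ - X (Fin.succ 2) * e₂)
  have hsum' := congrArg (elim l₀) hsum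
  rw [map_add, map_add, map_mul, map_mul, map_mul, elim_X_succ, elim_X_succ, elim_X_succ, map_zero,
    h₀, h₁, h₂] at hsum'
  -- Since q is coprime to F, the conic q divides the linear form with coefficients c_i, which must
  -- vanish.
  obtain ⟨w, hw⟩ : q ∣ C c₀ * X 0 + C c₁ * X 1 + C c₂ * X 2 :=
    hcop.dvd_of_dvd_mul_left ⟨-(X 0 * L₀ + X 1 * L₁ + X 2 * L₂), by linear_combination hsum'⟩
  have hc := eq_zero_of_mul_isHomogeneous (q := w) hq.2 (hw ▸ ((isHomogeneous_C_mul_X _ _).add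
    (isHomogeneous_C_mul_X _ _)).add (isHomogeneous_C_mul_X _ _)) one_lt_two
  rw [← hw] at hc
  have hc₀ : c₀ = 0 := by
    have := congrArg (eval (Pi.single 0 1)) hc
    simpa using this
  have hL : X 0 * L₀ + X 1 * L₁ + X 2 * L₂ = 0 :=
    mul_left_cancel₀ hq0 (by linear_combination hsum' - F * hc)
  obtain ⟨a, rfl⟩ := exists_eq_sum_C_mul_X hL₀
  obtain ⟨b, rfl⟩ := exists_eq_sum_C_mul_X hL₁
  obtain ⟨c, rfl⟩ := exists_eq_sum_C_mul_X hL₂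
  -- At the first coordinate vector the linear syzygy of the variables shows that L₀ has no X_0
  -- term. Hence A₀ is a constant combination of G_1 and G_2, by uniqueness of lifts.
  have ha : a 0 = 0 := by
    have := congrArg (eval (Pi.single 0 1)) hL
    simpa [Fin.sum_univ_three] using this
  have hA₀' : A₀ = C (a 1) * G 1 + C (a 2) * G 2 := by
    refine hI.eq_of_elim_eq (l₀ := l₀) hA₀ (add_mem
      ⟨I.mul_mem_left _ (hGI 1).1, (hGI 1).2.C_mul _⟩
      ⟨I.mul_mem_left _ (hGI 2).1, (hGI 2).2.C_mul _⟩) ?_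
    rw [h₀, hc₀, map_add, map_mul, map_mul, hG, hG, Fin.sum_univ_three, ha, elim_C, elim_C]
    simp only [map_zero]
    ring
  -- Moving the multiples of `elimForm l₀` to the left turns the Koszul relation into `p * G 2 = r *
  -- G 1`, where p and r restrict to different variables. So the prime p divides `G 1`.
  let p : MvPolynomial (Fin 4) K := X (Fin.succ 1) - C (a 2) * elimForm l₀
  let r : MvPolynomial (Fin 4) K := X (Fin.succ 2) + C (a 1) * elimForm l₀
  have hpr : p * G 2 = r * G 1 := by
    rw [hA₀'] at e₀
    linear_combination e₀
  have hp1 : elim l₀ p = X 1 := by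
    rw [map_sub, map_mul, elim_elimForm, elim_X_succ, mul_zero, sub_zero]
  have hr1 : elim l₀ r = X 2 := by
    rw [map_add, map_mul, elim_elimForm, elim_X_succ, mul_zero, add_zero]
  have hp : p.IsHomogeneous 1 := (isHomogeneous_X _ _).sub ((elimForm_isHomogeneous l₀).C_mul _)
  have hp0 : p ≠ 0 := fun h => X_ne_zero (R := K) (1 : Fin 3) (by rw [← hp1, h, map_zero])
  have hirr := irreducible_of_isHomogeneous_one hp hp0
  obtain ⟨Q, hQ⟩ : p ∣ G 1 := by
    refine (hirr.prime.dvd_or_dvd ⟨G 2, hpr.symm⟩).resolve_left fun h => ?_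
    have := map_dvd (elim l₀) h
    rw [hp1, hr1, X_dvd_X] at this
    simp at this
  obtain ⟨Q, hQ', e⟩ := exists_isHomogeneous_of_eq_mul (n := 2) hp (hGI 1).2 hQ
  have hG1 : G 1 ≠ 0 := fun h => by
    have := hG 1
    rw [h, map_zero] at this
    exact mul_ne_zero (X_ne_zero _) hq0 this.symm
  rcases hI.isPrime.mem_or_mem (e ▸ (hGI 1).1 : p * Q ∈ I) with h | h
  · exact hp0 (hI.eq_zero one_le_two hp h)
  · exact hG1 (by rw [e, hI.eq_zero le_rfl hQ' h, mul_zero])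

/-- Below degree 3 the saturation is zero: a power of the linear form moves any such element
injectively to degree 2. From degree 3 on the dimensions agree. -/
lemma IsCubicSexticIdeal.piece_le (hI : IsCubicSexticIdeal I)
    (hJ : IsSaturationOf (I.map (elim l₀)) J l) (m : ℕ) :
    piece J m ≤ piece (I.map (elim l₀)) m := by
  rcases lt_or_ge m 3 with hm | hm
  · intro f hf
    suffices f = 0 by rw [this]; exact zero_mem _
    obtain ⟨k, hk⟩ : ∃ k, m + k = 2 := ⟨2 - m, by omega⟩
    have h := hI.eq_zero_of_mem_saturation hJ (q := elimForm l ^ k * f)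
      ⟨J.mul_mem_left _ hf.1, by
        have := ((elimForm_isHomogeneous l).pow k).mul hf.2
        rwa [show 1 * k + m = 2 by omega] at this⟩
    exact (mul_eq_zero.1 h).resolve_left (pow_ne_zero _ (elimForm_ne_zero l))
  · exact hI.piece_saturation_le hJ hm

end CurveIdeal

end SexticBlowup

namespace SexticBlowup

open MvPolynomial Filter

/-! ### Maximal minors and kernel vectors -/

section Minors

variable {R : Type*} [CommRing R] (M : Matrix (Fin 3) (Fin 4) R)

/-- The signed maximal minors of a `3 × 4` matrix. -/
def maxMinor (j : Fin 4) : R := (-1) ^ (j : ℕ) * (M.submatrix id j.succAbove).det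

lemma det_vecCons (w : Fin 4 → R) :
    Matrix.det (Matrix.of (Matrix.vecCons w M)) = ∑ j, w j * maxMinor M j := by
  rw [Matrix.det_succ_row_zero]
  refine Finset.sum_congr rfl fun j _ => ?_
  rw [maxMinor, ← mul_assoc, mul_comm (w j)]
  rfl

lemma sum_mul_maxMinor (i : Fin 3) : ∑ j, M i j * maxMinor M j = 0 := by
  rw [← det_vecCons]
  exact Matrix.det_zero_of_row_eq (Fin.succ_ne_zero i).symm rfl

variable {M}

/-- Put the unit row e_j on top of M to obtain A. Then A d has the single entry d_j, det A is the
j-th minor, and the first column of the adjugate consists of the minors; apply the adjugate to A d.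
-/
lemma maxMinor_mul_eq {d : Fin 4 → R} (hd : ∀ i, ∑ j, M i j * d j = 0) (j k : Fin 4) :
    maxMinor M j * d k = maxMinor M k * d j := by
  let A : Matrix (Fin 4) (Fin 4) R := Matrix.of (Matrix.vecCons (Pi.single j 1) M)
  have hA : A.mulVec d = Pi.single 0 (d j) := by
    ext i
    refine Fin.cases ?_ (fun i => ?_) i
    · simp [A, Matrix.mulVec, dotProduct, Pi.single_apply]
    · rw [Pi.single_eq_of_ne (Fin.succ_ne_zero i)]
      exact hd i
  have h := congrFun (congrArg A.adjugate.mulVec hA) k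
  rw [Matrix.mulVec_mulVec, Matrix.adjugate_mul, Matrix.smul_mulVec, Matrix.one_mulVec,
    Pi.smul_apply, smul_eq_mul, det_vecCons] at h
  simp only [Pi.single_apply, ite_mul, one_mul, zero_mul, Finset.sum_ite_eq', Finset.mem_univ,
    if_true] at h
  rw [h]
  have h2 : A.adjugate k 0 = maxMinor M k := by
    rw [Matrix.adjugate_fin_succ_eq_det_submatrix, maxMinor]
    simp only [Fin.val_zero, zero_add]
    rfl
  rw [← h2]
  simp [Matrix.mulVec, dotProduct, Pi.single_apply]

lemma map_maxMinor {S : Type*} [CommRing S] (f : R →+* S) (j : Fin 4) :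
    f (maxMinor M j) = maxMinor (M.map f) j := by
  rw [maxMinor, maxMinor, map_mul, map_pow, map_neg, map_one, RingHom.map_det]
  rfl

end Minors

/-! ### The Hilbert–Burch matrix -/

section HilbertBurch

variable {K : Type} [Field K] {I : Ideal (MvPolynomial (Fin 4) K)} {l₀ : Fin 3 → K}
  {J : Ideal (MvPolynomial (Fin 3) K)} {l : Fin 2 → K}

lemma maxMinor_isHomogeneous {M : Matrix (Fin 3) (Fin 4) (MvPolynomial (Fin 4) K)}
    (hM : ∀ i j, (M i j).IsHomogeneous 1) (j : Fin 4) : (maxMinor M j).IsHomogeneous 3 := by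
  have h (i k) : ((M.submatrix id j.succAbove) i k).IsHomogeneous 1 := hM _ _
  have h2 : ((M.submatrix id j.succAbove).det).IsHomogeneous 3 := by
    rw [Matrix.det_fin_three]
    exact ((((((((h _ _).mul (h _ _)).mul (h _ _)).sub (((h _ _).mul (h _ _)).mul (h _ _))).sub
      (((h _ _).mul (h _ _)).mul (h _ _))).add (((h _ _).mul (h _ _)).mul (h _ _))).add
      (((h _ _).mul (h _ _)).mul (h _ _))).sub (((h _ _).mul (h _ _)).mul (h _ _)))
  rw [maxMinor]
  rcases neg_one_pow_eq_or (MvPolynomial (Fin 4) K) (j : ℕ) with e | e <;> rw [e]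
  · rwa [one_mul]
  · rw [neg_one_mul]; exact h2.neg

/-- Nonzero cubics in I have no proper factors, since I is prime and contains no nonzero form of
lower degree. A nonconstant common factor would make F and G proportional. -/
lemma IsCubicSexticIdeal.isRelPrime (hI : IsCubicSexticIdeal I) {F G : MvPolynomial (Fin 4) K}
    (hF : F ∈ piece I 3) (hF0 : F ≠ 0) (hG : G ∈ piece I 3) (h : ∀ c : K, G ≠ C c * F) :
    IsRelPrime F G := by
  rintro d ⟨a, rfl⟩ ⟨b, rfl⟩
  obtain ⟨hd0, ha0⟩ := mul_ne_zero_iff.1 hF0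
  obtain ⟨e, k, hek, hd, ha⟩ := isHomogeneous_of_mul hF.2 hF0
  rcases Nat.eq_zero_or_pos e with rfl | he
  · exact isUnit_of_isHomogeneous_zero hd hd0
  exfalso
  rcases Nat.eq_zero_or_pos k with rfl | hk
  · obtain rfl : e = 3 := by omega
    obtain ⟨b', hb', e⟩ := exists_isHomogeneous_of_eq_mul (n := 0) hd hG.2 rfl
    obtain ⟨α, rfl⟩ : ∃ c, a = C c := ⟨coeff 0 a, by
      rw [← homogeneousComponent_zero, homogeneousComponent_eq_self ha]⟩
    obtain ⟨β, rfl⟩ : ∃ c, b' = C c := ⟨coeff 0 b', by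
      rw [← homogeneousComponent_zero, homogeneousComponent_eq_self hb']⟩
    have hα : α ≠ 0 := by rintro rfl; simp at ha0
    refine h (β / α) ?_
    rw [e, mul_left_comm, ← map_mul, div_mul_cancel₀ _ hα]
  · rcases hI.isPrime.mem_or_mem hF.1 with h | h
    · exact hd0 (hI.eq_zero (by omega) hd h)
    · exact ha0 (hI.eq_zero (by omega) ha h)

lemma mem_of_forall_monomial_mem {N : Ideal (MvPolynomial (Fin 2) K)} {m : ℕ}
    (hN : ∀ a b, a + b = m → X 0 ^ a * X 1 ^ b ∈ N) {f : MvPolynomial (Fin 2) K}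
    (hf : f.IsHomogeneous m) : f ∈ N := by
  rw [f.as_sum]
  refine sum_mem fun d hd => ?_
  have h1 : d.degree = m := (hf.degree_eq_sum_deg_support hd).symm
  rw [Finsupp.degree_eq_sum, Fin.sum_univ_two] at h1
  rw [monomial_eq, Finsupp.prod_fintype _ _ (by simp), Fin.prod_univ_two]
  exact N.mul_mem_left _ (hN _ _ h1)

lemma exists_eq_sum_of_isHomogeneous_three {f : MvPolynomial (Fin 2) K} (hf : f.IsHomogeneous 3) :
    ∃ c : Fin 4 → K, f = ∑ j, C (c j) * (X 0 ^ (3 - (j : ℕ)) * X 1 ^ (j : ℕ)) := by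
  have : f ∈ Submodule.span K (Set.range fun j : Fin 4 =>
      (X 0 ^ (3 - (j : ℕ)) * X 1 ^ (j : ℕ) : MvPolynomial (Fin 2) K)) := by
    rw [f.as_sum]
    refine sum_mem fun d hd => ?_
    have h1 : d.degree = 3 := (hf.degree_eq_sum_deg_support hd).symm
    rw [Finsupp.degree_eq_sum, Fin.sum_univ_two] at h1
    rw [monomial_eq, Finsupp.prod_fintype _ _ (by simp), Fin.prod_univ_two, ← smul_eq_C_mul]
    refine Submodule.smul_mem _ _ (Submodule.subset_span ⟨⟨d 1, by omega⟩, ?_⟩)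
    rw [show d 0 = 3 - d 1 by omega]
  obtain ⟨c, rfl⟩ := (Submodule.mem_span_range_iff_exists_fun K).1 this
  exact ⟨c, by simp_rw [smul_eq_C_mul]⟩

/-- The two linear forms are a regular sequence modulo I, because the plane section is saturated.
Thus a form of I vanishing on the line is a combination of them with coefficients again in I. -/
lemma IsCubicSexticIdeal.exists_of_elim_elim_eq_zero (hI : IsCubicSexticIdeal I)
    (hJ : IsSaturationOf (I.map (elim l₀)) J l) {m : ℕ} {f : MvPolynomial (Fin 4) K}
    (hf : f ∈ piece I (m + 1)) (h : elim l (elim l₀ f) = 0) : ∃ g ∈ piece I m, ∃ g' ∈ piece I m,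
      f = rename Fin.succ (elimForm l) * g + elimForm l₀ * g' := by
  obtain ⟨q, hq, e⟩ := SexticBlowup.exists_eq_elimForm_mul l (elim_isHomogeneous l₀ hf.2) h
  have hqJ : q ∈ piece J m :=
    ⟨hJ.elimForm_mul_mem q (e ▸ hJ.le (Ideal.mem_map_of_mem _ hf.1)), hq⟩
  obtain ⟨g, hg, rfl⟩ := exists_mem_piece_of_mem_piece_map hI.isHomog (hI.piece_le hJ m hqJ)
  obtain ⟨g', hg', e'⟩ := hI.exists_eq_elimForm_mul (l₀ := l₀) (m := m)
    (f := f - rename Fin.succ (elimForm l) * g)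
    (sub_mem hf ⟨I.mul_mem_left _ hg.1, by
      have := ((elimForm_isHomogeneous l).rename_isHomogeneous (f := Fin.succ)).mul hg.2
      rwa [show 1 + m = m + 1 by omega] at this⟩) (by
      rw [map_sub, map_mul, elim_rename_succ, e, sub_self])
  exact ⟨g, hg, g', hg', by rw [← e']; ring⟩

/-- Without conics in J and quadrics in I, the cubics of I inject into binary cubics, and both
spaces have dimension 4. -/
lemma IsCubicSexticIdeal.exists_elim_elim_eq (hI : IsCubicSexticIdeal I)
    (hJ : IsSaturationOf (I.map (elim l₀)) J l) {f : MvPolynomial (Fin 2) K}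
    (hf : f.IsHomogeneous 3) : ∃ g ∈ piece I 3, elim l (elim l₀ g) = f := by
  have h1 : Module.finrank K (piece (J.map (elim l)) 3) + Module.finrank K (piece J 2) =
    Module.finrank K (piece J 3) := hJ.finrank_piece_succ 2
  have h2 : Module.finrank K (piece (I.map (elim l₀)) 3) + Module.finrank K (piece I 2) =
    Module.finrank K (piece I 3) := hI.finrank_piece_succ 2
  have h3 := hI.finrank_piece_eq hJ (m := 3) (by omega)
  have h4 : piece J 2 = ⊥ := (Submodule.eq_bot_iff _).2 fun _ => hI.eq_zero_of_mem_saturation hJ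
  have h5 := six_mul_monCount_four (K := K) 3
  have h6 := monCount_two (K := K) 3
  have h7 := finrank_piece_mono hJ.le 3
  rw [h4, finrank_bot] at h1
  rw [hI.piece_eq_bot le_rfl, finrank_bot] at h2
  have h8 : piece (J.map (elim l)) 3 = homogeneousSubmodule (Fin 2) K 3 := by
    refine Submodule.eq_of_le_of_finrank_le inf_le_right ?_
    change monCount K 2 3 ≤ _
    omega
  have h9 : f ∈ piece (J.map (elim l)) 3 := by rw [h8]; exact hf
  obtain ⟨g, hg, rfl⟩ := exists_mem_piece_of_mem_piece_map hJ.isHomog h9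
  obtain ⟨g', hg', rfl⟩ := exists_mem_piece_of_mem_piece_map hI.isHomog (hI.piece_le hJ 3 hg)
  exact ⟨g', hg', rfl⟩

/-- Graded Nakayama: the restrictions of the G_j generate all binary forms of degree at least 3, and
what is left after subtracting is a combination of elements of I of lower degree. -/
lemma IsCubicSexticIdeal.span_eq (hI : IsCubicSexticIdeal I)
    (hJ : IsSaturationOf (I.map (elim l₀)) J l) {G : Fin 4 → MvPolynomial (Fin 4) K}
    (hG : ∀ j, G j ∈ piece I 3)
    (hGe : ∀ j, elim l (elim l₀ (G j)) = X 0 ^ (3 - (j : ℕ)) * X 1 ^ (j : ℕ)) :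
    Ideal.span (Set.range G) = I := by
  have hD : IsHomog (Ideal.span (Set.range G)) := isHomog_span (by
    rintro _ ⟨j, rfl⟩
    exact ⟨3, (hG j).2⟩)
  refine le_antisymm (Ideal.span_le.2 (by rintro _ ⟨j, rfl⟩; exact (hG j).1))
    (hI.isHomog.le_of_piece_le fun n => ?_)
  induction n with
  | zero => rw [hI.piece_eq_bot (by omega)]; exact bot_le
  | succ n ih =>
  rcases lt_or_ge n 2 with hn | hn
  · rw [hI.piece_eq_bot (by omega)]; exact bot_le
  intro f hf
  have hmem : elim l (elim l₀ f) ∈ ((Ideal.span (Set.range G)).map (elim l₀)).map (elim l) := by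
    refine mem_of_forall_monomial_mem (m := n + 1) (fun a b hab => ?_)
      (elim_isHomogeneous l (elim_isHomogeneous l₀ hf.2))
    have hj (j : Fin 4) (hja : 3 - (j : ℕ) ≤ a) (hjb : (j : ℕ) ≤ b) : X 0 ^ a * X 1 ^ b ∈
        ((Ideal.span (Set.range G)).map (elim l₀)).map (elim l) := by
      have : (X 0 ^ a * X 1 ^ b : MvPolynomial (Fin 2) K) =
          X 0 ^ (a - (3 - (j : ℕ))) * X 1 ^ (b - j) * elim l (elim l₀ (G j)) := by
        rw [hGe, ← Nat.sub_add_cancel hja, ← Nat.sub_add_cancel hjb, pow_add, pow_add]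
        simp only [Nat.add_sub_cancel]
        ring
      rw [this]
      exact Ideal.mul_mem_left _ _ (Ideal.mem_map_of_mem _ (Ideal.mem_map_of_mem _
        (Ideal.subset_span ⟨j, rfl⟩)))
    -- The monomial X_0^a X_1^b is a multiple of the restricted G_j with j = min(b, 3).
    rcases le_or_gt 3 b with hb | hb
    · exact hj 3 (by simp) (by simpa using hb)
    · exact hj ⟨b, by omega⟩ (by simp; omega) le_rfl
  obtain ⟨q, hq, e⟩ := exists_mem_piece_of_mem_piece_map hD.map_elim
    ⟨hmem, elim_isHomogeneous l (elim_isHomogeneous l₀ hf.2)⟩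
  obtain ⟨g, hg, rfl⟩ := exists_mem_piece_of_mem_piece_map hD hq
  have hgI : g ∈ piece I (n + 1) :=
    ⟨Ideal.span_le.2 (by rintro _ ⟨j, rfl⟩; exact (hG j).1) hg.1, hg.2⟩
  obtain ⟨a, ha, b, hb, e'⟩ := hI.exists_of_elim_elim_eq_zero hJ (sub_mem hf hgI)
    (by rw [map_sub, map_sub, e, sub_self])
  refine ⟨?_, hf.2⟩
  rw [sub_eq_iff_eq_add.1 e']
  exact add_mem (add_mem (Ideal.mul_mem_left _ _ (ih ha).1) (Ideal.mul_mem_left _ _ (ih hb).1)) hg.1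

/-- Hilbert-Burch: the ideal is generated by the maximal minors of a matrix of linear forms. -/
structure IsDeterminantal (I : Ideal (MvPolynomial (Fin 4) K))
    (M : Matrix (Fin 3) (Fin 4) (MvPolynomial (Fin 4) K)) : Prop where
  isHomogeneous : ∀ i j, (M i j).IsHomogeneous 1
  span_eq : Ideal.span (Set.range (maxMinor M)) = I
  ne_zero : ∀ j, maxMinor M j ≠ 0
  isRelPrime : ∀ j k, j ≠ k → IsRelPrime (maxMinor M j) (maxMinor M k)

lemma eq_of_X_pow_mul_X_pow {a b a' b' : ℕ} {c : K}
    (h : (X 0 ^ a * X 1 ^ b : MvPolynomial (Fin 2) K) = C c * (X 0 ^ a' * X 1 ^ b')) : b = b' := by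
  have h' : monomial (Finsupp.single (0 : Fin 2) a + Finsupp.single 1 b) (1 : K) =
      monomial (Finsupp.single 0 a' + Finsupp.single 1 b') c := by
    simpa [X_pow_eq_monomial, monomial_mul, C_mul_monomial] using h
  rcases (monomial_eq_monomial_iff _ _ _ _).1 h' with ⟨h, -⟩ | ⟨h, -⟩
  · simpa using DFunLike.congr_fun h 1
  · exact absurd h one_ne_zero

/-- Cubics G_j in I lift the monomials X_0^(3-j) X_1^j. The three relations between consecutive
monomials lift to linear syzygies, the rows of M. The G_j are a kernel vector of M, so by
coprimality and degree they are the maximal minors up to one constant. -/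
theorem IsCubicSexticIdeal.exists_isDeterminantal [Infinite K] (hI : IsCubicSexticIdeal I) :
    ∃ M, IsDeterminantal I M := by
  -- Any plane will do, as every nonzero linear form is a nonzerodivisor modulo the prime I; only
  -- the line in it is chosen by prime avoidance.
  let l₀ : Fin 3 → K := 0
  obtain ⟨J, l, hJ⟩ := exists_isSaturationOf (hI.isSixPointIdeal l₀).isHomog
  have hG (j : Fin 4) : ∃ g ∈ piece I 3,
      elim l (elim l₀ g) = X 0 ^ (3 - (j : ℕ)) * X 1 ^ (j : ℕ) :=
    hI.exists_elim_elim_eq hJ (by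
      have := (isHomogeneous_X_pow (R := K) (0 : Fin 2) (3 - (j : ℕ))).mul
        (isHomogeneous_X_pow (R := K) (1 : Fin 2) (j : ℕ))
      rwa [show 3 - (j : ℕ) + j = 3 by omega] at this)
  choose G hG hGe using hG
  have hspan {g} (hg : g ∈ piece I 3) : ∃ c : Fin 4 → K, g = ∑ k, C (c k) * G k := by
    obtain ⟨c, hc⟩ := exists_eq_sum_of_isHomogeneous_three
      (elim_isHomogeneous l (elim_isHomogeneous l₀ hg.2))
    refine ⟨c, ?_⟩
    obtain ⟨a, ha, b, hb, e⟩ := hI.exists_of_elim_elim_eq_zero hJ (m := 2)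
      (f := g - ∑ k, C (c k) * G k)
      (sub_mem hg (sum_mem fun k _ => ⟨I.mul_mem_left _ (hG k).1, (hG k).2.C_mul _⟩)) (by
        simp only [map_sub, map_sum, map_mul, elim_C, hGe, hc, sub_self])
    rw [hI.eq_zero le_rfl ha.2 ha.1, hI.eq_zero le_rfl hb.2 hb.1, mul_zero, mul_zero, add_zero] at e
    exact sub_eq_zero.1 e
  have hsyz (i : Fin 3) : ∃ a b : Fin 4 → K,
      X 3 * G i.castSucc - X 2 * G i.succ = rename Fin.succ (elimForm l) * ∑ k, C (a k) * G k +
        elimForm l₀ * ∑ k, C (b k) * G k := by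
    have e3 : elim l (elim l₀ (X 3)) = X 1 := by
      rw [show (3 : Fin 4) = Fin.succ (Fin.succ 1) from rfl, elim_X_succ, elim_X_succ]
    have e2 : elim l (elim l₀ (X 2)) = X 0 := by
      rw [show (2 : Fin 4) = Fin.succ (Fin.succ 0) from rfl, elim_X_succ, elim_X_succ]
    obtain ⟨a, ha, b, hb, e⟩ := hI.exists_of_elim_elim_eq_zero hJ (m := 3)
      (f := X 3 * G i.castSucc - X 2 * G i.succ)
      (sub_mem ⟨I.mul_mem_left _ (hG _).1, (isHomogeneous_X K _).mul (hG _).2⟩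
        ⟨I.mul_mem_left _ (hG _).1, (isHomogeneous_X K _).mul (hG _).2⟩) (by
        rw [map_sub, map_sub, map_mul, map_mul, map_mul, map_mul, hGe, hGe, e2, e3]
        fin_cases i <;> simp <;> ring)
    obtain ⟨a, rfl⟩ := hspan ha
    obtain ⟨b, rfl⟩ := hspan hb
    exact ⟨a, b, e⟩
  choose a b hab using hsyz
  let T : MvPolynomial (Fin 4) K := rename Fin.succ (elimForm l)
  let M : Matrix (Fin 3) (Fin 4) (MvPolynomial (Fin 4) K) := fun i k =>
    (if k = i.castSucc then X 3 else 0) - (if k = i.succ then X 2 else 0) - C (a i k) * T -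
      C (b i k) * elimForm l₀
  have hM (i j) : (M i j).IsHomogeneous 1 := by
    refine ((IsHomogeneous.sub ?_ ?_).sub (IsHomogeneous.C_mul ?_ _)).sub
      ((elimForm_isHomogeneous l₀).C_mul _)
    · split_ifs
      exacts [isHomogeneous_X K _, isHomogeneous_zero _ _ _]
    · split_ifs
      exacts [isHomogeneous_X K _, isHomogeneous_zero _ _ _]
    · exact (elimForm_isHomogeneous l).rename_isHomogeneous
  have hMG (i) : ∑ k, M i k * G k = 0 := by
    have := hab i
    simp only [M, sub_mul, Finset.sum_sub_distrib, ite_mul, zero_mul, Finset.sum_ite_eq',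
      Finset.mem_univ, if_true]
    rw [this, Finset.mul_sum, Finset.mul_sum]
    simp only [T]
    rw [sub_sub, ← Finset.sum_add_distrib, ← Finset.sum_add_distrib, sub_eq_zero]
    exact Finset.sum_congr rfl fun k _ => by ring
  have hprop (j k : Fin 4) (hjk : j ≠ k) (c : K) : G k ≠ C c * G j := by
    intro h
    have := congrArg (fun f => elim l (elim l₀ f)) h
    simp only [map_mul, hGe, elim_C] at this
    exact hjk (Fin.ext (eq_of_X_pow_mul_X_pow this).symm)
  have hG0 (j) : G j ≠ 0 := fun h => by
    have := hGe j
    rw [h, map_zero, map_zero] at this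
    exact mul_ne_zero (pow_ne_zero _ (X_ne_zero _)) (pow_ne_zero _ (X_ne_zero _)) this.symm
  have hcop (j k : Fin 4) (hjk : j ≠ k) : IsRelPrime (G j) (G k) :=
    hI.isRelPrime (hG j) (hG0 j) (hG k) (hprop j k hjk)
  obtain ⟨c, hc⟩ : ∃ c : K, ∀ j, maxMinor M j = C c * G j := by
    -- Proportionality and coprimality of `G 0` and `G 1` give divisibility; both sides have degree
    -- 3, so the quotient is a constant.
    obtain ⟨w, hw⟩ : G 0 ∣ maxMinor M 0 := (hcop 0 1 (by simp)).dvd_of_dvd_mul_right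
      ⟨maxMinor M 1, by rw [maxMinor_mul_eq hMG 0 1, mul_comm]⟩
    obtain ⟨w, hw', e⟩ := exists_isHomogeneous_of_eq_mul (n := 0) (hG 0).2
      (maxMinor_isHomogeneous hM 0) hw
    obtain ⟨c, rfl⟩ : ∃ c, w = C c := ⟨coeff 0 w, by
      rw [← homogeneousComponent_zero, homogeneousComponent_eq_self hw']⟩
    refine ⟨c, fun j => mul_right_cancel₀ (hG0 0) ?_⟩
    rw [← maxMinor_mul_eq hMG 0 j, e]
    ring
  -- Restricted to the line, M is bidiagonal with entries X_1 and -X_0, so its last minor is X_1^3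
  -- up to sign.
  have hc0 : c ≠ 0 := by
    rintro rfl
    have h := hc 3
    rw [map_zero, zero_mul] at h
    have h2 := congrArg ((elim l).toRingHom.comp (elim l₀).toRingHom) h
    rw [map_maxMinor, map_zero] at h2
    have hM' (i k) : ((elim l).toRingHom.comp (elim l₀).toRingHom) (M i k) =
        (if k = i.castSucc then X 1 else 0) - (if k = i.succ then X 0 else 0) := by
      have e3 : elim l (elim l₀ (X 3)) = X 1 := by
        rw [show (3 : Fin 4) = Fin.succ (Fin.succ 1) from rfl, elim_X_succ, elim_X_succ]
      have e2 : elim l (elim l₀ (X 2)) = X 0 := by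
        rw [show (2 : Fin 4) = Fin.succ (Fin.succ 0) from rfl, elim_X_succ, elim_X_succ]
      change elim l (elim l₀ (M i k)) = _
      simp only [M, T, map_sub, map_mul, elim_elimForm, elim_rename_succ, map_zero, mul_zero,
        sub_zero, apply_ite (elim l₀), apply_ite (elim l), e2, e3]
    rw [maxMinor, Matrix.det_fin_three] at h2
    simp only [Matrix.submatrix_apply, Matrix.map_apply, hM'] at h2
    simp [Fin.ext_iff, Fin.succAbove] at h2
  have hu : IsUnit (C c : MvPolynomial (Fin 4) K) := (IsUnit.mk0 c hc0).map C
  refine ⟨M, hM, ?_, fun j => ?_, fun j k hjk => ?_⟩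
  · rw [← hI.span_eq hJ hG hGe]
    refine le_antisymm (Ideal.span_le.2 ?_) (Ideal.span_le.2 ?_)
    · rintro _ ⟨j, rfl⟩
      rw [hc]
      exact Ideal.mul_mem_left _ _ (Ideal.subset_span ⟨j, rfl⟩)
    · rintro _ ⟨j, rfl⟩
      refine (Ideal.unit_mul_mem_iff_mem _ hu).1 ?_
      rw [← hc]
      exact Ideal.subset_span ⟨j, rfl⟩
  · rw [hc]
    exact mul_ne_zero hu.ne_zero (hG0 j)
  · rw [hc, hc]
    exact (isRelPrime_mul_unit_left hu).2 (hcop j k hjk)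

end HilbertBurch

end SexticBlowup

namespace SexticBlowup

open MvPolynomial Filter

/-! ### Forms vanishing at the maximal minors -/

section Kernel

variable {S : Type} [CommRing S]

lemma eval₂_mul_of_isHomogeneous {σ E : Type} [CommRing E] {F : MvPolynomial σ S} {n : ℕ}
    (hF : F.IsHomogeneous n) (f : S →+* E) (c : E) (η : σ → E) :
    F.eval₂ f (fun j => c * η j) = c ^ n * F.eval₂ f η := by
  rw [eval₂_eq, eval₂_eq, Finset.mul_sum]
  refine Finset.sum_congr rfl fun d hd => ?_
  have : ∑ i ∈ d.support, d i = n := by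
    have := hF (mem_support_iff.1 hd)
    rwa [Finsupp.weight_apply, Finsupp.sum, Finset.sum_congr rfl fun i _ => by
      rw [Pi.one_apply, smul_eq_mul, mul_one]] at this
  rw [Finset.prod_congr rfl fun i _ => mul_pow c (η i) (d i), Finset.prod_mul_distrib,
    Finset.prod_pow_eq_pow_sum, this]
  ring

/-- A binary form vanishing at a coprime pair (a, b) vanishes wherever b x = a y. By coprimality a
divides the coefficient of y^n; replacing a y by b x there makes the form divisible by x, and the
degree drops. -/
lemma sum_eq_zero_of_isRelPrime [IsDomain S] [DecompositionMonoid S] {E : Type} [CommRing E]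
    (f : S →+* E) {a b : S} (ha : a ≠ 0) (hab : IsRelPrime a b) {x y : E}
    (hxy : f b * x = f a * y) (n : ℕ) (c : ℕ → S)
    (hc : ∑ i ∈ Finset.range (n + 1), c i * (a ^ i * b ^ (n - i)) = 0) :
    ∑ i ∈ Finset.range (n + 1), f (c i) * (x ^ i * y ^ (n - i)) = 0 := by
  induction n generalizing c with
  | zero =>
    have : c 0 = 0 := by simpa using hc
    simp [this]
  | succ n ih =>
    rw [Finset.sum_range_succ'] at hc ⊢
    simp only [Nat.add_sub_add_right, pow_zero, one_mul, Nat.sub_zero, pow_succ' _ n,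
      pow_succ' a, pow_succ' x, mul_assoc a, mul_assoc x, mul_left_comm _ a, mul_left_comm _ x,
      ← Finset.mul_sum] at hc ⊢
    have hdvd : a ∣ c 0 := by
      refine (hab.pow_right (n := n + 1)).dvd_of_dvd_mul_right ?_
      rw [pow_succ', ← dvd_add_right (dvd_mul_right a _), hc]
      exact dvd_zero a
    obtain ⟨c', hc'⟩ := hdvd
    let d : ℕ → S := fun i => c (i + 1) + if i = 0 then c' * b else 0
    have key (T : Type) [CommRing T] (g : S →+* T) (z w : T) :
        ∑ i ∈ Finset.range (n + 1), g (d i) * (z ^ i * w ^ (n - i)) =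
          ∑ i ∈ Finset.range (n + 1), g (c (i + 1)) * (z ^ i * w ^ (n - i)) +
            g c' * g b * w ^ n := by
      simp only [d, map_add, add_mul, Finset.sum_add_distrib]
      congr 1
      rw [Finset.sum_eq_single 0]
      · simp
      · intro i _ hi
        simp [hi]
      · simp
    have h1 := ih d (by
      have := key S (RingHom.id S) a b
      simp only [RingHom.id_apply] at this
      rw [this]
      refine (mul_eq_zero.1 ?_).resolve_left ha
      rw [← hc, hc']
      ring)
    rw [key] at h1
    rw [hc', map_mul]
    linear_combination x * h1 - f c' * y ^ n * hxy

lemma eq_sum_monomial_of_isHomogeneous {F : MvPolynomial (Fin 2) S} {n : ℕ}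
    (hF : F.IsHomogeneous n) :
    ∃ c : ℕ → S, F = ∑ i ∈ Finset.range (n + 1), C (c i) * (X 0 ^ i * X 1 ^ (n - i)) := by
  refine ⟨fun i => F.coeff (Finsupp.single 0 i + Finsupp.single 1 (n - i)), ?_⟩
  have hm (i j : ℕ) (c : S) : (C c * (X 0 ^ i * X 1 ^ j) : MvPolynomial (Fin 2) S) =
      monomial (Finsupp.single 0 i + Finsupp.single 1 j) c := by
    rw [X_pow_eq_monomial, X_pow_eq_monomial, monomial_mul, C_mul_monomial]
    simp
  ext d
  simp only [hm, coeff_sum, coeff_monomial]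
  have hd0 (i j : ℕ) : Finsupp.single 0 i + Finsupp.single 1 j = d ↔ i = d 0 ∧ j = d 1 := by
    constructor
    · rintro rfl
      simp
    · rintro ⟨rfl, rfl⟩
      ext k
      fin_cases k <;> simp
  by_cases hd : d 0 + d 1 = n
  · rw [Finset.sum_eq_single (d 0)]
    · rw [if_pos ((hd0 _ _).2 ⟨rfl, by omega⟩), (hd0 (d 0) (n - d 0)).2 ⟨rfl, by omega⟩]
    · intro i _ hi
      rw [if_neg fun h => hi ((hd0 _ _).1 h).1]
    · intro h
      exact absurd (Finset.mem_range.2 (by omega)) h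
  · rw [hF.coeff_eq_zero, Finset.sum_eq_zero]
    · intro i hi
      rw [if_neg]
      intro h
      have := (hd0 _ _).1 h
      have := Finset.mem_range.1 hi
      omega
    · intro h
      exact hd (by rw [← h, Finsupp.degree_eq_sum, Fin.sum_univ_two])

variable {M : Matrix (Fin 3) (Fin 4) S} {E : Type} [CommRing E] {f : S →+* E} {η : Fin 4 → E}

/-- The `2 × 2` minor with rows `r, s` and columns `p, q`. -/
def minorTwo {R : Type} [CommRing R] (M : Matrix (Fin 3) (Fin 4) R) (r s : Fin 3) (p q : Fin 4) :
    R :=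
  M r p * M s q - M r q * M s p

lemma map_minorTwo {T : Type} [CommRing T] (g : S →+* T) (r s : Fin 3) (p q : Fin 4) :
    g (minorTwo M r s p q) = minorTwo (M.map g) r s p q := by
  simp [minorTwo]

/-- Forms in four variables that vanish at the maximal minors are killed, after substitution of any
kernel vector, by powers of the `2 × 2` minors. -/
lemma minorTwo_pow_mul_eval₂_eq_zero [IsDomain S] [DecompositionMonoid S]
    (hne : ∀ j, maxMinor M j ≠ 0) (hcop : ∀ j k, j ≠ k → IsRelPrime (maxMinor M j) (maxMinor M k))
    {F : MvPolynomial (Fin 4) S} {n : ℕ}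
    (hF : F.IsHomogeneous n) (h0 : F.eval₂ (RingHom.id S) (maxMinor M) = 0)
    (hη : ∀ i, ∑ j, f (M i j) * η j = 0) (r s : Fin 3) (p q : Fin 4) :
    f (minorTwo M r s p q) ^ n * F.eval₂ f η = 0 := by
  -- The minor is then zero, so only n = 0 matters, where F is a constant that vanishes by `h0`.
  by_cases hpq : p = q
  · subst hpq
    rw [minorTwo, sub_self]
    rcases n.eq_zero_or_pos with rfl | hn
    · obtain ⟨c, rfl⟩ : ∃ c, F = C c := ⟨_, totalDegree_eq_zero_iff_eq_C.1
        (hF.totalDegree_le.antisymm (Nat.zero_le _) |>.trans rfl)⟩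
      rw [eval₂_C, RingHom.id_apply] at h0
      simp [h0]
    · simp [hn.ne']
  have hexc : ∀ p q : Fin 4, p ≠ q → ∃ u v : Fin 4, u ≠ v ∧
      Finset.univ = ({p, q, u, v} : Finset (Fin 4)) ∧ p ∉ ({q, u, v} : Finset (Fin 4)) ∧
      q ∉ ({u, v} : Finset (Fin 4)) := by decide
  obtain ⟨u, v, huv, huniv, hp, hq⟩ := hexc p q hpq
  have hsum {T : Type} [CommRing T] (w : Fin 4 → T) : ∑ j, w j = w p + w q + w u + w v := by
    rw [huniv, Finset.sum_insert hp, Finset.sum_insert hq, Finset.sum_pair huv]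
    ring
  let δ := minorTwo M r s p q
  -- Cramer's rule for rows r, s: on every kernel vector w, δ times w_j is the combination of w_u
  -- and w_v with coefficients α_j and β_j.
  let α : Fin 4 → S := fun j => if j = p then -minorTwo M r s u q else
    if j = q then -minorTwo M r s p u else if j = u then δ else 0
  let β : Fin 4 → S := fun j => if j = p then -minorTwo M r s v q else
    if j = q then -minorTwo M r s p v else if j = u then 0 else δ
  have hker {T : Type} [CommRing T] (g : S →+* T) (w : Fin 4 → T)
      (hw : ∀ i, ∑ j, g (M i j) * w j = 0) (j : Fin 4) :
      g δ * w j = g (α j) * w u + g (β j) * w v := by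
    have hr := hw r
    have hs := hw s
    rw [hsum] at hr hs
    have hj : j ∈ ({p, q, u, v} : Finset (Fin 4)) := huniv ▸ Finset.mem_univ j
    simp only [Finset.mem_insert, Finset.mem_singleton, not_or] at hj hp hq
    rcases hj with hj | hj | hj | hj
    · simp only [α, β, δ, hj, if_true, minorTwo, map_sub, map_mul, map_neg]
      linear_combination g (M s q) * hr - g (M r q) * hs
    · simp only [α, β, δ, hj, if_true, minorTwo, map_sub, map_mul, map_neg, Ne.symm hp.1, if_false]
      linear_combination g (M r p) * hs - g (M s p) * hr
    · simp only [α, β, δ, hj, if_true, Ne.symm hp.2.1, Ne.symm hq.1, if_false, map_zero]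
      ring
    · simp only [α, β, δ, hj, Ne.symm hp.2.2, Ne.symm hq.2, huv.symm, if_false, map_zero]
      ring
  -- This binary form satisfies δ^n F(w) = B(w_u, w_v) for kernel vectors w over any S-algebra. It
  -- vanishes at the coprime pair of minors u, v, hence at (η_u, η_v).
  let B : MvPolynomial (Fin 2) S := F.eval₂ C fun j => C (α j) * X 0 + C (β j) * X 1
  have hB : B.IsHomogeneous n := by
    have := hF.eval₂ (C : S →+* MvPolynomial (Fin 2) S) (fun j => C (α j) * X 0 + C (β j) * X 1)
      (fun r => isHomogeneous_C _ r)
      (fun j => (isHomogeneous_C_mul_X _ _).add (isHomogeneous_C_mul_X _ _))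
    rwa [one_mul] at this
  have hBe {T : Type} [CommRing T] (g : S →+* T) (w : Fin 4 → T)
      (hw : ∀ i, ∑ j, g (M i j) * w j = 0) :
      g δ ^ n * F.eval₂ g w = B.eval₂ g ![w u, w v] := by
    rw [← eval₂_mul_of_isHomogeneous hF]
    have : B.eval₂ g ![w u, w v] = eval₂Hom g ![w u, w v] B := rfl
    rw [this, hom_eval₂]
    congr 1
    · ext c
      simp
    · ext j
      simpa using hker g w hw j
  obtain ⟨c, hc⟩ := eq_sum_monomial_of_isHomogeneous hB
  have hBs {T : Type} [CommRing T] (g : S →+* T) (x y : T) :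
      B.eval₂ g ![x, y] = ∑ i ∈ Finset.range (n + 1), g (c i) * (x ^ i * y ^ (n - i)) := by
    have : B.eval₂ g ![x, y] = eval₂Hom g ![x, y] B := rfl
    rw [this, hc, map_sum]
    simp
  rw [hBe f η hη, hBs]
  refine sum_eq_zero_of_isRelPrime f (hne u) (hcop u v huv) ?_ n c ?_
  · have := maxMinor_mul_eq (M := M.map f) hη v u
    rwa [← map_maxMinor, ← map_maxMinor] at this
  · have := hBs (RingHom.id S) (maxMinor M u) (maxMinor M v)
    rw [← hBe (RingHom.id S) (maxMinor M) (fun i => by simpa using sum_mul_maxMinor M i), h0,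
      mul_zero] at this
    simpa using this.symm

end Kernel

end SexticBlowup

namespace SexticBlowup

open AlgebraicGeometry CategoryTheory HomogeneousLocalization

/-! ### Ring-valued points of Proj in homogeneous coordinates -/

noncomputable section Points

variable {k A B : Type} [CommRing k] [CommRing A] [CommRing B] [Algebra k A]
variable (𝒜 : ℕ → Submodule k A) [GradedAlgebra 𝒜]

/-- The value at homogeneous fractions of a ring homomorphism that inverts the denominator. -/
def awayLift (φ : A →+* B) {f : A} (hu : IsUnit (φ f)) : Away 𝒜 f →+* B :=
  (IsLocalization.Away.lift (S := Localization.Away f) f hu).comp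
    (algebraMap (Away 𝒜 f) (Localization.Away f))

lemma awayLift_mk_mul (φ : A →+* B) {f : A} (hu : IsUnit (φ f)) {m : ℕ} (hf : f ∈ 𝒜 m) (n : ℕ)
    (a : A) (ha : a ∈ 𝒜 (n • m)) :
    awayLift 𝒜 φ hu (Away.mk 𝒜 hf n a ha) * φ f ^ n = φ a := by
  have h : algebraMap A (Localization.Away f) a =
      algebraMap (Away 𝒜 f) (Localization.Away f) (Away.mk 𝒜 hf n a ha) *
        algebraMap A (Localization.Away f) f ^ n := by
    change _ = Localization.mk a ⟨f ^ n, _⟩ * _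
    rw [Localization.mk_eq_mk', ← map_pow]
    exact (IsLocalization.mk'_spec _ _ (⟨f ^ n, _⟩ : Submonoid.powers f)).symm
  rw [awayLift, RingHom.comp_apply]
  rw [← IsLocalization.Away.lift_eq (S := Localization.Away f) f hu a, h, map_mul, map_pow,
    IsLocalization.Away.lift_eq]

variable {𝒜}

lemma awayLift_eq_iff {φ : A →+* B} {f : A} (hu : IsUnit (φ f)) {m : ℕ} (hf : f ∈ 𝒜 m)
    (ψ : Away 𝒜 f →+* B) :
    awayLift 𝒜 φ hu = ψ ↔ ∀ n a ha, ψ (Away.mk 𝒜 hf n a ha) * φ f ^ n = φ a := by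
  constructor
  · rintro rfl n a ha
    exact awayLift_mk_mul 𝒜 φ hu hf n a ha
  · intro h
    ext x
    obtain ⟨n, a, ha, rfl⟩ := Away.mk_surjective 𝒜 hf x
    exact (hu.pow n).mul_right_cancel ((awayLift_mk_mul 𝒜 φ hu hf n a ha).trans (h n a ha).symm)

/-- The `B`-valued point of `Proj 𝒜` with homogeneous coordinates given by `φ`, one of which is
invertible. -/
def point (φ : A →+* B) {f : A} {m : ℕ} (hf : f ∈ 𝒜 m) (hm : 0 < m) (hu : IsUnit (φ f)) :
    Spec (.of B) ⟶ Proj 𝒜 :=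
  Spec.map (CommRingCat.ofHom (awayLift 𝒜 φ hu)) ≫ Proj.awayι 𝒜 f hf hm

lemma point_mul (φ : A →+* B) {f g : A} {m m' : ℕ} (hf : f ∈ 𝒜 m) (hm : 0 < m) (hg : g ∈ 𝒜 m')
    (hu : IsUnit (φ f)) (hfg : f * g ∈ 𝒜 (m + m')) (hm' : 0 < m + m')
    (hfu : IsUnit (φ (f * g))) :
    point φ hf hm hu = point φ hfg hm' hfu := by
  rw [point, point, ← Proj.SpecMap_awayMap_awayι 𝒜 hf hm hg rfl, ← Category.assoc, ← Spec.map_comp,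
    ← CommRingCat.ofHom_comp]
  congr 3
  rw [awayLift_eq_iff hu hf]
  intro n a ha
  rw [RingHom.comp_apply, awayMap_mk]
  have := awayLift_mk_mul 𝒜 φ hfu hfg n (a * g ^ n)
    (by rw [smul_add]; exact SetLike.mul_mem_graded ha (SetLike.pow_mem_graded n hg))
  rw [map_mul, map_mul, mul_pow, map_pow, ← mul_assoc] at this
  rw [map_mul] at hfu
  exact ((isUnit_of_mul_isUnit_right hfu).pow n).mul_right_cancel this

lemma point_congr (φ : A →+* B) {f g : A} {m m' : ℕ} (hf : f ∈ 𝒜 m) (hm : 0 < m) (hg : g ∈ 𝒜 m')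
    (hm' : 0 < m') (hu : IsUnit (φ f)) (hu' : IsUnit (φ g)) (h : f = g) :
    point φ hf hm hu = point φ hg hm' hu' := by
  subst h
  rfl

/-- Both charts are compared with the chart of the product f g. -/
lemma point_change (φ : A →+* B) {f g : A} {m m' : ℕ} (hf : f ∈ 𝒜 m) (hm : 0 < m) (hg : g ∈ 𝒜 m')
    (hm' : 0 < m') (hu : IsUnit (φ f)) (hu' : IsUnit (φ g)) :
    point φ hf hm hu = point φ hg hm' hu' := by
  have hfg := SetLike.mul_mem_graded hf hg
  have hgf := SetLike.mul_mem_graded hg hf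
  rw [point_mul φ hf hm hg hu hfg (by omega) (by rw [map_mul]; exact hu.mul hu'),
    point_mul φ hg hm' hf hu' hgf (by omega) (by rw [map_mul]; exact hu'.mul hu)]
  exact point_congr _ _ _ _ _ _ _ (mul_comm f g)

/-- Homogeneous coordinates that differ by a unit define the same point. -/
lemma point_eq {φ φ' : A →+* B} {f g : A} {m m' : ℕ} (hf : f ∈ 𝒜 m) (hm : 0 < m) (hg : g ∈ 𝒜 m')
    (hm' : 0 < m') (hu : IsUnit (φ f)) (hu' : IsUnit (φ' g)) {u : B} (huu : IsUnit u)
    (h : ∀ n, ∀ a ∈ 𝒜 n, φ' a = u ^ n * φ a) :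
    point φ hf hm hu = point φ' hg hm' hu' := by
  have hu2 : IsUnit (φ' f) := by rw [h m f hf]; exact (huu.pow m).mul hu
  rw [point_change φ' hg hm' hf hm hu' hu2, point, point]
  congr 3
  rw [awayLift_eq_iff hu hf]
  intro n a ha
  have := awayLift_mk_mul 𝒜 φ' hu2 hf n a ha
  rw [h m f hf, h _ a ha, mul_pow, ← pow_mul, mul_left_comm, smul_eq_mul, mul_comm n] at this
  exact (huu.pow (m * n)).mul_left_cancel this

lemma SpecMap_point {B' : Type} [CommRing B'] (ψ : B →+* B') (φ : A →+* B) {f : A} {m : ℕ}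
    (hf : f ∈ 𝒜 m) (hm : 0 < m) (hu : IsUnit (φ f)) :
    Spec.map (CommRingCat.ofHom ψ) ≫ point φ hf hm hu = point (ψ.comp φ) hf hm (hu.map ψ) := by
  rw [point, point, ← Category.assoc, ← Spec.map_comp, ← CommRingCat.ofHom_comp]
  congr 3
  refine ((awayLift_eq_iff (φ := ψ.comp φ) (hu.map ψ) hf _).2 fun n a ha => ?_).symm
  rw [RingHom.comp_apply, RingHom.comp_apply, RingHom.comp_apply, ← map_pow, ← map_mul,
    awayLift_mk_mul 𝒜 φ hu hf n a ha]

lemma basicOpen_eq_top_iff {b : B} : PrimeSpectrum.basicOpen b = ⊤ ↔ IsUnit b := by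
  have := PrimeSpectrum.iSup_basicOpen_eq_top_iff (f := fun _ : Unit => b)
  rwa [iSup_const, Set.range_const, Ideal.span_singleton_eq_top] at this

lemma point_preimage_basicOpen (φ : A →+* B) {f g : A} {m m' : ℕ} (hf : f ∈ 𝒜 m) (hm : 0 < m)
    (hg : g ∈ 𝒜 m') (hm' : 0 < m') (hu : IsUnit (φ f)) :
    point φ hf hm hu ⁻¹ᵁ Proj.basicOpen 𝒜 g = PrimeSpectrum.basicOpen (φ g) := by
  rw [point, Scheme.Hom.comp_preimage, Proj.awayι_preimage_basicOpen 𝒜 hf hm hg hm']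
  change PrimeSpectrum.basicOpen (awayLift 𝒜 φ hu _) = _
  have h := awayLift_mk_mul 𝒜 φ hu hf m' (g ^ m)
    (by convert! SetLike.pow_mem_graded m hg using 2; exact mul_comm _ _)
  rw [map_pow] at h
  rw [← PrimeSpectrum.basicOpen_pow (φ g) m hm, ← h, PrimeSpectrum.basicOpen_mul,
    basicOpen_eq_top_iff.2 (hu.pow m'), inf_top_eq]

/-- Invertibility of a coordinate means that the point lies entirely in its basic open, a condition
on the morphism alone. -/
lemma isUnit_of_point_eq {φ φ' : A →+* B} {f g : A} {m m' : ℕ} {hf : f ∈ 𝒜 m} {hm : 0 < m}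
    {hg : g ∈ 𝒜 m'} {hm' : 0 < m'} {hu : IsUnit (φ f)} {hu' : IsUnit (φ' g)}
    (h : point φ hf hm hu = point φ' hg hm' hu') : IsUnit (φ' f) := by
  have h1 := point_preimage_basicOpen φ hf hm hf hm hu
  rw [h, point_preimage_basicOpen φ' hg hm' hf hm hu',
    basicOpen_eq_top_iff.2 hu] at h1
  exact basicOpen_eq_top_iff.1 h1

/-- The homogeneous coordinates of a point are proportional. -/
lemma mul_pow_eq_of_point_eq {φ φ' : A →+* B} {f g : A} {m m' : ℕ} {hf : f ∈ 𝒜 m} {hm : 0 < m}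
    {hg : g ∈ 𝒜 m'} {hm' : 0 < m'} {hu : IsUnit (φ f)} {hu' : IsUnit (φ' g)}
    (h : point φ hf hm hu = point φ' hg hm' hu') (n : ℕ) {a : A} (ha : a ∈ 𝒜 (n • m)) :
    φ a * φ' f ^ n = φ' a * φ f ^ n := by
  have hu2 := isUnit_of_point_eq h
  rw [point_change φ' hg hm' hf hm hu' hu2, point, point, cancel_mono] at h
  have h1 := congrArg CommRingCat.Hom.hom (Spec.map_injective h)
  simp only [CommRingCat.hom_ofHom] at h1
  rw [← awayLift_mk_mul 𝒜 φ hu hf n a ha, ← awayLift_mk_mul 𝒜 φ' hu2 hf n a ha, h1]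
  ring

section Dehomogenize

variable (𝒜) in
/-- Setting a form of degree one equal to `1`. -/
def dehom {f : A} (hf : f ∈ 𝒜 1) : A →+* Away 𝒜 f :=
  (DirectSum.toSemiring (A := fun n => 𝒜 n)
    (fun n => AddMonoidHom.mk' (fun a => Away.mk 𝒜 hf n a.1 (by simp)) fun a b => by
      apply val_injective
      simp [Localization.add_mk_self])
    (by apply val_injective; simp)
    (fun {i j} a b => by
      apply val_injective
      simp only [AddMonoidHom.mk'_apply, Away.val_mk, val_mul, Localization.mk_mul]
      congr 1
      exact Subtype.ext (pow_add f i j))).comp (DirectSum.decomposeRingEquiv 𝒜).toRingHom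

lemma dehom_of_mem {f : A} (hf : f ∈ 𝒜 1) {n : ℕ} {a : A} (ha : a ∈ 𝒜 n) :
    dehom 𝒜 hf a = Away.mk 𝒜 hf n a (by simpa using ha) := by
  rw [dehom, RingHom.comp_apply]
  change DirectSum.toSemiring _ _ _ (DirectSum.decompose 𝒜 a) = _
  rw [DirectSum.decompose_of_mem 𝒜 ha, DirectSum.toSemiring_of]
  rfl

lemma dehom_self {f : A} (hf : f ∈ 𝒜 1) : dehom 𝒜 hf f = 1 := by
  rw [dehom_of_mem hf hf]
  apply val_injective
  simp

lemma awayι_eq_point {f : A} (hf : f ∈ 𝒜 1) :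
    Proj.awayι 𝒜 f hf one_pos = point (dehom 𝒜 hf) hf one_pos (by rw [dehom_self]; exact isUnit_one) := by
  rw [point, (awayLift_eq_iff _ hf (RingHom.id _)).2, CommRingCat.ofHom_id, Spec.map_id,
    Category.id_comp]
  intro n a ha
  rw [dehom_self, one_pow, mul_one, dehom_of_mem hf (by simpa using ha)]
  rfl

/-- The morphism factors through the affine chart of f; composing the resulting ring map with
dehomogenization gives the coordinates. -/
lemma exists_eq_point {f : A} (hf : f ∈ 𝒜 1) (g : Spec (.of B) ⟶ Proj 𝒜)
    (hg : g ⁻¹ᵁ Proj.basicOpen 𝒜 f = ⊤) :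
    ∃ (φ : A →+* B) (hφ : φ f = 1), g = point φ hf one_pos (by rw [hφ]; exact isUnit_one) := by
  have hr : Set.range g ⊆ Set.range (Proj.awayι 𝒜 f hf one_pos) := by
    rw [← Scheme.Hom.coe_opensRange (Proj.awayι 𝒜 f hf one_pos), Proj.opensRange_awayι]
    rintro _ ⟨x, rfl⟩
    have : x ∈ g ⁻¹ᵁ Proj.basicOpen 𝒜 f := hg ▸ trivial
    exact this
  let l := IsOpenImmersion.lift (Proj.awayι 𝒜 f hf one_pos) g hr
  obtain ⟨ψ, hψ⟩ := Spec.map_surjective l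
  refine ⟨ψ.hom.comp (dehom 𝒜 hf), by rw [RingHom.comp_apply, dehom_self, map_one], ?_⟩
  rw [← SpecMap_point ψ.hom (dehom 𝒜 hf) hf one_pos (by rw [dehom_self]; exact isUnit_one),
    ← awayι_eq_point, CommRingCat.ofHom_hom, hψ]
  exact (IsOpenImmersion.lift_fac _ _ hr).symm

end Dehomogenize

lemma point_structureMap (φ : A →+* B) {f : A} {m : ℕ} (hf : f ∈ 𝒜 m) (hm : 0 < m)
    (hu : IsUnit (φ f)) :
    point φ hf hm hu ≫ structureMap 𝒜 =
      Spec.map (CommRingCat.ofHom (φ.comp (algebraMap k A))) := by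
  rw [point, structureMap, Category.assoc, Proj.awayι_toSpecZero_assoc, ← Spec.map_comp,
    ← Spec.map_comp, ← CommRingCat.ofHom_comp, ← CommRingCat.ofHom_comp]
  congr 2
  ext r
  have := awayLift_mk_mul 𝒜 φ hu hf 0 (algebraMap k A r)
    (by rw [zero_smul]; exact (algebraMap k (𝒜 0) r).2)
  rw [pow_zero, mul_one] at this
  rw [RingHom.comp_apply φ, ← this]
  rw [RingHom.comp_apply, RingHom.comp_apply]
  congr 1
  apply val_injective
  rw [Away.val_mk]
  change Localization.mk _ _ = _
  congr 1
  exact Subtype.ext (pow_zero f).symm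

end Points

end SexticBlowup

namespace SexticBlowup

open AlgebraicGeometry CategoryTheory HomogeneousLocalization

/-! ### Ideal sheaves on affine charts and invertibility -/

noncomputable section SpecIdeal

variable {B B' : Type} [CommRing B] [CommRing B']

/-- The ideal of `B` that corresponds to an ideal sheaf on `Spec B`. -/
def specIdeal (K : (Spec (.of B)).IdealSheafData) : Ideal B :=
  (K.ideal ⟨⊤, isAffineOpen_top _⟩).comap (Scheme.ΓSpecIso (.of B)).inv.hom

lemma specIdeal_mono {K K' : (Spec (.of B)).IdealSheafData} (h : K ≤ K') :
    specIdeal K ≤ specIdeal K' :=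
  Ideal.comap_mono (h _)

lemma ΓSpecIso_inv_bijective :
    Function.Bijective (Scheme.ΓSpecIso (.of B)).inv.hom :=
  ConcreteCategory.bijective_of_isIso (Scheme.ΓSpecIso (.of B)).inv

lemma le_of_specIdeal_le {K K' : (Spec (.of B)).IdealSheafData}
    (h : specIdeal K ≤ specIdeal K') : K ≤ K' := by
  refine Scheme.IdealSheafData.le_of_isAffine ?_
  intro x hx
  obtain ⟨b, rfl⟩ := ΓSpecIso_inv_bijective.2 x
  exact h hx

lemma exists_specIdeal_eq (J : Ideal B) : ∃ K : (Spec (.of B)).IdealSheafData, specIdeal K = J := by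
  refine ⟨.ofIdealTop (J.map (Scheme.ΓSpecIso (.of B)).inv.hom), ?_⟩
  have h := Scheme.IdealSheafData.equivOfIsAffine.apply_symm_apply
    (J.map (Scheme.ΓSpecIso (.of B)).inv.hom)
  rw [Scheme.IdealSheafData.equivOfIsAffine_apply,
    Scheme.IdealSheafData.equivOfIsAffine_symm_apply] at h
  rw [specIdeal, h, Ideal.comap_map_of_bijective _ ΓSpecIso_inv_bijective]

lemma specIdeal_map (ψ : B →+* B') (K : (Spec (.of B')).IdealSheafData) :
    specIdeal (K.map (Spec.map (CommRingCat.ofHom ψ))) = (specIdeal K).comap ψ := by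
  rw [specIdeal, Scheme.IdealSheafData.ideal_map_of_isAffineHom, specIdeal, Ideal.comap_comap,
    Ideal.comap_comap]
  have := congrArg CommRingCat.Hom.hom (Scheme.ΓSpecIso_inv_naturality (CommRingCat.ofHom ψ))
  rw [CommRingCat.hom_comp, CommRingCat.hom_comp, CommRingCat.hom_ofHom] at this
  rw [this]
  rfl

/-- Pullback of ideal sheaves is left adjoint to pushforward, which is computed by the preimage of
ideals. -/
lemma specIdeal_comap (ψ : B →+* B') (K : (Spec (.of B)).IdealSheafData) :
    specIdeal (K.comap (Spec.map (CommRingCat.ofHom ψ))) = (specIdeal K).map ψ := by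
  refine le_antisymm ?_ ?_
  · obtain ⟨L, hL⟩ := exists_specIdeal_eq ((specIdeal K).map ψ)
    rw [← hL]
    refine specIdeal_mono (Scheme.IdealSheafData.le_map_iff_comap_le.1 (le_of_specIdeal_le ?_))
    rw [specIdeal_map, hL]
    exact Ideal.le_comap_map
  · rw [Ideal.map_le_iff_le_comap, ← specIdeal_map]
    exact specIdeal_mono (Scheme.IdealSheafData.le_map_comap _ _)

/-- Lets invertibility be tested on any open immersion from a spectrum, by transport along B ≅ Γ(T,
U). -/
lemma ideal_eq_span_iff {T : Scheme.{0}} (K : T.IdealSheafData) (j : Spec (.of B) ⟶ T)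
    [IsOpenImmersion j] (U : T.affineOpens) (h : j.opensRange = U.1) :
    (∃ a ∈ nonZeroDivisors Γ(T, U.1), K.ideal U = Ideal.span {a}) ↔
      ∃ β ∈ nonZeroDivisors B, specIdeal (K.comap j) = Ideal.span {β} := by
  obtain rfl : U = ⟨j ''ᵁ ⊤, (isAffineOpen_top _).image_of_isOpenImmersion j⟩ :=
    Subtype.ext (h.symm.trans (Scheme.Hom.image_top_eq_opensRange j).symm)
  let e : B ≃+* Γ(T, j ''ᵁ ⊤) :=
    ((Scheme.ΓSpecIso (.of B)).symm ≪≫ (j.appIso ⊤).symm).commRingCatIsoToRingEquiv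
  have he : specIdeal (K.comap j) =
      (K.ideal ⟨j ''ᵁ ⊤, (isAffineOpen_top _).image_of_isOpenImmersion j⟩).comap
        (e : B →+* Γ(T, j ''ᵁ ⊤)) := by
    rw [specIdeal, Scheme.IdealSheafData.ideal_comap_of_isOpenImmersion, Ideal.comap_comap]
    rfl
  have hspan (b : B) : (Ideal.span {e b}).comap (e : B →+* Γ(T, j ''ᵁ ⊤)) = Ideal.span {b} := by
    have := Ideal.comap_map_of_bijective (e : B →+* Γ(T, j ''ᵁ ⊤)) e.bijective (I := Ideal.span {b})
    rwa [Ideal.map_span, Set.image_singleton] at this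
  have hnzd (b : B) : e b ∈ nonZeroDivisors Γ(T, j ''ᵁ ⊤) ↔ b ∈ nonZeroDivisors B := by
    rw [mem_nonZeroDivisors_iff_right, mem_nonZeroDivisors_iff_right, e.surjective.forall]
    simp only [← map_mul, map_eq_zero_iff e e.injective]
  rw [he]
  constructor
  · rintro ⟨a, ha, hK⟩
    obtain ⟨b, rfl⟩ := e.surjective a
    exact ⟨b, (hnzd b).1 ha, by rw [hK, hspan]⟩
  · rintro ⟨b, hb, hK⟩
    refine ⟨e b, (hnzd b).2 hb, ?_⟩
    rw [← hspan] at hK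
    exact Ideal.comap_injective_of_surjective _ e.surjective hK

/-- An ideal sheaf that is invertible has principal charts in every neighbourhood of a point. -/
lemma IsInvertibleIdeal.exists_chart {T : Scheme.{0}} {K : T.IdealSheafData}
    (hK : IsInvertibleIdeal K) (x : T) (W : T.Opens) (hx : x ∈ W) :
    ∃ (B : CommRingCat.{0}) (j : Spec (.of B) ⟶ T) (_ : IsOpenImmersion j), x ∈ j.opensRange ∧
      j.opensRange ≤ W ∧ ∃ β ∈ nonZeroDivisors B, specIdeal (K.comap j) = Ideal.span {β} := by
  obtain ⟨U, hxU, ha⟩ := hK x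
  let j : Spec (.of Γ(T, U.1)) ⟶ T := U.2.fromSpec
  have hj : IsOpenImmersion j := IsAffineOpen.isOpenImmersion_fromSpec U.2
  obtain ⟨β, hβ, hs⟩ := (ideal_eq_span_iff K j U U.2.opensRange_fromSpec).1 ha
  obtain ⟨y, hy⟩ : ∃ y, j y = x := by
    have : x ∈ j.opensRange := by rwa [U.2.opensRange_fromSpec]
    exact this
  obtain ⟨_, ⟨b, rfl⟩, hyb, hb⟩ := PrimeSpectrum.isTopologicalBasis_basic_opens.exists_subset_of_mem_open
    (show y ∈ (j ⁻¹ᵁ W : (Spec (.of Γ(T, U.1))).Opens).1 by change j y ∈ W; rwa [hy])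
    (j ⁻¹ᵁ W).2
  let l := Spec.map (CommRingCat.ofHom (algebraMap Γ(T, U.1) (Localization.Away b)))
  have hl : IsOpenImmersion l := inferInstance
  have hr : Set.range l = (PrimeSpectrum.basicOpen b).1 :=
    PrimeSpectrum.localization_away_comap_range (Localization.Away b) b
  refine ⟨.of (Localization.Away b), l ≫ j, inferInstance, ?_, ?_,
    algebraMap _ _ β, ?_, ?_⟩
  · obtain ⟨z, hz⟩ : y ∈ Set.range l := by rw [hr]; exact hyb
    exact ⟨z, by rw [Scheme.Hom.comp_apply, hz, hy]⟩
  · rintro _ ⟨z, rfl⟩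
    have : l z ∈ (PrimeSpectrum.basicOpen b).1 := by rw [← hr]; exact ⟨z, rfl⟩
    exact hb this
  · exact IsLocalization.map_nonZeroDivisors_le (Submonoid.powers b) _ ⟨β, hβ, rfl⟩
  · rw [Scheme.IdealSheafData.comap_comp, specIdeal_comap]
    rw [hs, Ideal.map_span, Set.image_singleton]

lemma isInvertibleIdeal_of_charts {T : Scheme.{0}} {K : T.IdealSheafData}
    (hK : ∀ x : T, ∃ (B : CommRingCat.{0}) (j : Spec (.of B) ⟶ T) (_ : IsOpenImmersion j),
      x ∈ j.opensRange ∧ ∃ β ∈ nonZeroDivisors B, specIdeal (K.comap j) = Ideal.span {β}) :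
    IsInvertibleIdeal K := by
  intro x
  obtain ⟨B, j, hj, hx, hβ⟩ := hK x
  exact ⟨⟨j.opensRange, isAffineOpen_opensRange j⟩, hx, (ideal_eq_span_iff (B := B) K j _ rfl).2 hβ⟩

lemma IsInvertibleIdeal.comap {T T' : Scheme.{0}} {K : T.IdealSheafData}
    (hK : IsInvertibleIdeal K) (f : T' ⟶ T) [IsOpenImmersion f] :
    IsInvertibleIdeal (K.comap f) := by
  refine isInvertibleIdeal_of_charts fun x => ?_
  obtain ⟨B, j, hj, hx, hjf, hβ⟩ := hK.exists_chart (f x) f.opensRange ⟨x, rfl⟩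
  have hr : Set.range j ⊆ Set.range f := hjf
  refine ⟨B, IsOpenImmersion.lift f j hr, ?_, ?_, ?_⟩
  · have : IsOpenImmersion (IsOpenImmersion.lift f j hr ≫ f) := by rwa [IsOpenImmersion.lift_fac]
    exact IsOpenImmersion.of_comp _ f
  · obtain ⟨y, hy⟩ := hx
    refine ⟨y, f.isOpenEmbedding.injective ?_⟩
    rw [← Scheme.Hom.comp_apply, IsOpenImmersion.lift_fac, hy]
  · rwa [← Scheme.IdealSheafData.comap_comp, IsOpenImmersion.lift_fac]

end SpecIdeal

end SexticBlowup

namespace SexticBlowup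

open AlgebraicGeometry CategoryTheory HomogeneousLocalization MvPolynomial

/-! ### The curve: homogeneous ideal versus ideal sheaf -/

noncomputable section Curve

variable {C : Scheme.{0}} {i : C ⟶ projSpace (Fin 4)}

lemma mem_idealOf {f : MvPolynomial (Fin 4) ℂ} :
    f ∈ (idealOf i).toIdeal ↔
      ∀ x : C, f ∈ (show ProjectiveSpectrum (polyGrading (Fin 4)) from i x).asHomogeneousIdeal := by
  change f ∈ ProjectiveSpectrum.vanishingIdeal _ ↔ _
  rw [ProjectiveSpectrum.mem_vanishingIdeal]
  exact ⟨fun h x => h _ ⟨x, rfl⟩, fun h _ ⟨x, hx⟩ => hx ▸ h x⟩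

lemma isHomog_homogeneousIdeal {σ : Type} (I : HomogeneousIdeal (polyGrading σ)) :
    IsHomog I.toIdeal := by
  intro f hf n
  rw [← decomposition.decompose'_apply]
  exact I.isHomogeneous n hf

/-- A form vanishing at the image of the generic point vanishes on all its specializations, so the
ideal is the prime of one point. -/
lemma isPrime_idealOf [IsIntegral C] : (idealOf i).toIdeal.IsPrime := by
  let y : ProjectiveSpectrum (polyGrading (Fin 4)) := i (genericPoint C)
  have : (idealOf i).toIdeal = y.asHomogeneousIdeal.toIdeal := by
    ext f
    rw [mem_idealOf]
    refine ⟨fun h => h _, fun h x => ?_⟩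
    have hs : (genericPoint C) ⤳ x := genericPoint_specializes x
    have := hs.map i.continuous
    rw [specializes_iff_mem_closure] at this
    exact (ProjectiveSpectrum.le_iff_mem_closure _ _ _).2 this h
  rw [this]
  exact y.isPrime

lemma finrank_piece_add_hilbertFunction (I : HomogeneousIdeal (polyGrading (Fin 4))) (n : ℕ) :
    Module.finrank ℂ (piece I.toIdeal n) + hilbertFunction I n = monCount ℂ 4 n := by
  have := LinearMap.finrank_range_add_finrank_ker
    ((Ideal.Quotient.mkₐ ℂ I.toIdeal).toLinearMap.domRestrict (polyGrading (Fin 4) n))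
  rw [monCount, ← this, add_comm, LinearMap.range_domRestrict]
  congr 1
  have hk : LinearMap.ker ((Ideal.Quotient.mkₐ ℂ I.toIdeal).toLinearMap.domRestrict
      (polyGrading (Fin 4) n)) = (piece I.toIdeal n).comap (polyGrading (Fin 4) n).subtype := by
    ext f
    rw [LinearMap.mem_ker, Submodule.mem_comap, mem_piece]
    change Ideal.Quotient.mk I.toIdeal f.1 = 0 ↔ _
    rw [Ideal.Quotient.eq_zero_iff_mem]
    exact ⟨fun h => ⟨h, f.2⟩, fun h => h.1⟩
  rw [hk]
  exact (Submodule.comapSubtypeEquivOfLe (p := piece I.toIdeal n)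
    (q := polyGrading (Fin 4) n) fun f hf => (mem_piece.1 hf).2).finrank_eq.symm

/-- For `le_of_cubics`, the prime P is a point of ℙ³. The equations in T are cubics in the ideal of
C, so P contains them, lies on C, and therefore contains the whole ideal. -/
lemma isCubicSexticIdeal_idealOf [IsIntegral C] (hdg : HasDegreeGenus (idealOf i) 6 3)
    (hcubics : IsIntersectionOfDegree 3 (Set.range i)) :
    IsCubicSexticIdeal (idealOf i).toIdeal where
  isPrime := isPrime_idealOf
  isHomog := isHomog_homogeneousIdeal _
  finrank_piece := by
    filter_upwards [hdg] with n hn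
    have := finrank_piece_add_hilbertFunction (idealOf i) n
    omega
  le_of_cubics P hP hPh hX hP3 := by
    obtain ⟨T, hT3, hT⟩ := hcubics
    obtain ⟨a, ha⟩ := hX
    let p : ProjectiveSpectrum (polyGrading (Fin 4)) :=
      { asHomogeneousIdeal := ⟨P, fun n f hf => by
          have := hPh f hf n
          rwa [← decomposition.decompose'_apply] at this⟩
        isPrime := hP
        not_irrelevant_le := fun h => ha (h (by
          rw [HomogeneousIdeal.mem_irrelevant_iff]
          exact DirectSum.decompose_of_mem_ne (polyGrading (Fin 4)) (isHomogeneous_X ℂ a)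
            one_ne_zero)) }
    have hp : p ∈ ProjectiveSpectrum.zeroLocus (polyGrading (Fin 4)) T := by
      intro f hf
      refine hP3 f (mem_piece.2 ⟨mem_idealOf.2 fun x => ?_, hT3 hf⟩)
      have : i x ∈ Set.range i := ⟨x, rfl⟩
      rw [hT] at this
      exact this hf
    rw [← hT] at hp
    obtain ⟨x, hx⟩ := hp
    intro f hf
    have := mem_idealOf.1 hf x
    rw [hx] at this
    exact this

section Support

variable {B : Type} [CommRing B]

lemma mem_support_iff_specIdeal_le (K : (Spec (.of B)).IdealSheafData) (q : Spec (.of B)) :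
    q ∈ K.support ↔ specIdeal K ≤ q.asIdeal := by
  rw [Scheme.IdealSheafData.mem_support_iff_of_mem (U := ⟨⊤, isAffineOpen_top _⟩) trivial,
    Scheme.mem_zeroLocus_iff]
  have h (b : B) : q ∉ (Spec (.of B)).basicOpen ((Scheme.ΓSpecIso (.of B)).inv.hom b) ↔
      b ∈ q.asIdeal := by
    rw [basicOpen_eq_of_affine]
    exact not_not
  constructor
  · intro hK b hb
    exact (h b).1 (hK _ hb)
  · intro hK x hx
    obtain ⟨b, rfl⟩ := ΓSpecIso_inv_bijective.2 x
    exact (h b).2 (hK hx)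

lemma specIdeal_ker {Z : Scheme.{0}} (f : Z ⟶ Spec (.of B)) :
    specIdeal f.ker = RingHom.ker ((Scheme.ΓSpecIso (.of B)).inv ≫ f.appTop).hom := by
  have h := Scheme.IdealSheafData.equivOfIsAffine.apply_symm_apply (RingHom.ker f.appTop.hom)
  rw [Scheme.IdealSheafData.equivOfIsAffine_apply,
    Scheme.IdealSheafData.equivOfIsAffine_symm_apply, ← Scheme.ker_of_isAffine] at h
  rw [specIdeal, h]
  rfl

/-- The ideal is the kernel of the map to the global sections of an open subscheme of C, which is
reduced. -/
lemma isRadical_specIdeal_comap_ker [IsReduced C] [IsClosedImmersion i]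
    (j : Spec (.of B) ⟶ projSpace (Fin 4)) [IsOpenImmersion j] :
    (specIdeal (i.ker.comap j)).IsRadical := by
  rw [← Scheme.IdealSheafData.ker_fst_of_isClosedImmersion, specIdeal_ker]
  have : IsReduced (Limits.pullback j i) := isReduced_of_isOpenImmersion (Limits.pullback.snd j i)
  intro b ⟨n, hb⟩
  rw [RingHom.mem_ker, map_pow] at hb
  exact eq_zero_of_pow_eq_zero hb

lemma mem_specIdeal_comap_ker_iff [IsReduced C] [IsClosedImmersion i]
    (j : Spec (.of B) ⟶ projSpace (Fin 4)) [IsOpenImmersion j] (b : B) :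
    b ∈ specIdeal (i.ker.comap j) ↔ ∀ q : Spec (.of B), j q ∈ Set.range i → b ∈ q.asIdeal := by
  rw [← (isRadical_specIdeal_comap_ker j).radical, Ideal.radical_eq_sInf, Submodule.mem_sInf]
  have key (q : Spec (.of B)) : specIdeal (i.ker.comap j) ≤ q.asIdeal ↔ j q ∈ Set.range i := by
    rw [← mem_support_iff_specIdeal_le, Scheme.IdealSheafData.support_comap]
    change j q ∈ (i.ker.support : Set (projSpace (Fin 4))) ↔ _
    rw [Scheme.Hom.support_ker, i.isClosedEmbedding.isClosed_range.closure_eq]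
  exact ⟨fun h q hq => h _ ⟨(key q).2 hq, q.isPrime⟩,
    fun h P hP => h ⟨P, hP.2⟩ ((key ⟨P, hP.2⟩).1 hP.1)⟩

end Support

/-- Both ideals are radical or prime enough to be tested at points: a form vanishing on the part of
C in the chart, times X_a, vanishes on all of C, and X_a can be cancelled because it is not in the
prime ideal. -/
lemma specIdeal_comap_awayι [IsIntegral C] [IsClosedImmersion i] {a : Fin 4}
    (ha : X a ∈ polyGrading (Fin 4) 1) (haI : X a ∉ (idealOf i).toIdeal) :
    specIdeal (i.ker.comap (Proj.awayι (polyGrading (Fin 4)) (X a) ha one_pos)) =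
      (idealOf i).toIdeal.map (dehom (polyGrading (Fin 4)) ha) := by
  have key {n : ℕ} (hn : 0 < n) {f : MvPolynomial (Fin 4) ℂ} (hf : f ∈ polyGrading (Fin 4) n) :
      dehom (polyGrading (Fin 4)) ha f ∈
        specIdeal (i.ker.comap (Proj.awayι (polyGrading (Fin 4)) (X a) ha one_pos)) ↔
      f ∈ (idealOf i).toIdeal := by
    have hq (q : Spec (.of (Away (polyGrading (Fin 4)) (X a)))) :
        dehom (polyGrading (Fin 4)) ha f ∈ q.asIdeal ↔
          f ∈ (show ProjectiveSpectrum (polyGrading (Fin 4)) from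
            Proj.awayι (polyGrading (Fin 4)) (X a) ha one_pos q).asHomogeneousIdeal := by
      have h := point_preimage_basicOpen (dehom (polyGrading (Fin 4)) ha) ha one_pos hf hn
        (by rw [dehom_self]; exact isUnit_one)
      rw [← awayι_eq_point] at h
      have h1 : q ∈ PrimeSpectrum.basicOpen (dehom (polyGrading (Fin 4)) ha f) ↔
          Proj.awayι (polyGrading (Fin 4)) (X a) ha one_pos q ∈
            Proj.basicOpen (polyGrading (Fin 4)) f := by
        rw [← h]
        rfl
      exact not_iff_not.1 h1
    have := isPrime_idealOf (i := i)
    rw [mem_specIdeal_comap_ker_iff]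
    constructor
    · intro h
      refine (this.mem_or_mem (mem_idealOf.2 fun x => ?_)).resolve_right haI
      by_cases hx : X a ∈ (show ProjectiveSpectrum (polyGrading (Fin 4)) from
          i x).asHomogeneousIdeal
      · exact Ideal.mul_mem_left _ _ hx
      · have hx' : i x ∈ (Proj.awayι (polyGrading (Fin 4)) (X a) ha one_pos).opensRange := by
          rw [Proj.opensRange_awayι]
          exact hx
        obtain ⟨q, hqx⟩ := hx'
        have := (hq q).1 (h q ⟨x, hqx.symm⟩)
        rw [hqx] at this
        exact Ideal.mul_mem_right _ _ this
    · rintro h q ⟨x, hx⟩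
      rw [hq, ← hx]
      exact mem_idealOf.1 h x
  -- Multiplying by X_a does not change the dehomogenization and makes the degree positive, as `key`
  -- requires.
  have hmul {n : ℕ} {f : MvPolynomial (Fin 4) ℂ} (hf : f ∈ polyGrading (Fin 4) n) :
      f * X a ∈ polyGrading (Fin 4) (n + 1) := SetLike.mul_mem_graded hf ha
  have hde (f : MvPolynomial (Fin 4) ℂ) : dehom (polyGrading (Fin 4)) ha (f * X a) =
      dehom (polyGrading (Fin 4)) ha f := by rw [map_mul, dehom_self, mul_one]
  refine le_antisymm (fun b hb => ?_) (Ideal.map_le_iff_le_comap.2 fun f hf => ?_)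
  · obtain ⟨n, f, hf, rfl⟩ := Away.mk_surjective _ ha b
    have hf' : f ∈ polyGrading (Fin 4) n := by simpa using hf
    rw [← dehom_of_mem ha hf', ← hde] at hb ⊢
    exact Ideal.mem_map_of_mem _ ((key n.succ_pos (hmul hf')).1 hb)
  · rw [Ideal.mem_comap, ← sum_homogeneousComponent f, map_sum]
    refine sum_mem fun n _ => ?_
    have hn : homogeneousComponent n f ∈ polyGrading (Fin 4) n := homogeneousComponent_mem n f
    rw [← hde]
    exact (key n.succ_pos (hmul hn)).2
      (Ideal.mul_mem_right _ _ (isHomog_homogeneousIdeal _ f hf n))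

end Curve

end SexticBlowup

namespace SexticBlowup

open AlgebraicGeometry CategoryTheory HomogeneousLocalization MvPolynomial

/-! ### Smoothness and the 2 × 2 minors -/

noncomputable section Smooth

section Derivations

open TrivSqZeroExt in
/-- The two derivations of a one-dimensional smooth algebra at a point are proportional. -/
lemma snd_mul_snd_eq_of_locally {R B κ : Type} [CommRing R] [CommRing B] [Field κ] {f : R →+* B}
    (hf : RingHom.Locally (RingHom.IsStandardSmoothOfRelativeDimension 1) f)
    {ρ : B →+* κ} (τ : Fin 2 → B →+* DualNumber κ) (hρ : ∀ i b, (τ i b).fst = ρ b)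
    (hτ : ∀ i r, (τ i (f r)).snd = 0) (b b' : B) :
    (τ 0 b).snd * (τ 1 b').snd = (τ 0 b').snd * (τ 1 b).snd := by
  obtain ⟨s, hs, ht⟩ := hf
  -- One of the standard smooth localizations contains the point ρ.
  obtain ⟨t, hts, hρt⟩ : ∃ t ∈ s, ρ t ≠ 0 := by
    by_contra! h
    have : Ideal.span s ≤ RingHom.ker ρ := Ideal.span_le.2 h
    rw [hs] at this
    exact one_ne_zero ((map_one ρ).symm.trans (this (Submodule.mem_top (x := (1 : B)))))
  have hu (i : Fin 2) : IsUnit (τ i t) := by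
    rw [TrivSqZeroExt.isUnit_iff_isUnit_fst, hρ]
    exact hρt.isUnit
  let L := Localization.Away t
  let τ' (i : Fin 2) : L →+* DualNumber κ := IsLocalization.Away.lift t (hu i)
  have hτ' (i : Fin 2) (b : B) : τ' i (algebraMap B L b) = τ i b :=
    IsLocalization.Away.lift_eq t (hu i) b
  let ρ' : L →+* κ := IsLocalization.Away.lift t (g := ρ) hρt.isUnit
  have hρ' (i : Fin 2) (x : L) : (τ' i x).fst = ρ' x := by
    have : (TrivSqZeroExt.fstHom κ κ κ).toRingHom.comp (τ' i) = ρ' := by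
      refine IsLocalization.ringHom_ext (Submonoid.powers t) (RingHom.ext fun b => ?_)
      change (τ' i (algebraMap B L b)).fst = ρ' (algebraMap B L b)
      rw [hτ', hρ]
      exact (IsLocalization.Away.lift_eq t _ b).symm
    exact RingHom.congr_fun this x
  let _ : Algebra R L := ((algebraMap B L).comp f).toAlgebra
  have hsm : Algebra.IsStandardSmoothOfRelativeDimension 1 R L := ht t hts
  let _ : Algebra L κ := ρ'.toAlgebra
  let _ : Algebra R κ := (ρ'.comp (algebraMap R L)).toAlgebra
  have : IsScalarTower R L κ := IsScalarTower.of_algebraMap_eq' rfl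
  let D (i : Fin 2) : Derivation R L κ := Derivation.mk'
    { toFun x := (τ' i x).snd
      map_add' x y := by simp
      map_smul' r x := by
        rw [Algebra.smul_def, map_mul, TrivSqZeroExt.snd_mul, hρ', Algebra.smul_def]
        have : (τ' i (algebraMap R L r)).snd = 0 := by
          change (τ' i (algebraMap B L (f r))).snd = 0
          rw [hτ', hτ]
        rw [this, smul_zero, add_zero]
        rfl } fun x y => by
    change (τ' i (x * y)).snd = ρ' x * (τ' i y).snd + ρ' y * (τ' i x).snd
    rw [map_mul, TrivSqZeroExt.snd_mul, hρ', hρ', op_smul_eq_smul]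
    rfl
  have hD (i : Fin 2) (b : B) : D i (algebraMap B L b) = (τ i b).snd := by
    rw [← hτ']
    rfl
  have : Nontrivial L := RingHom.domain_nontrivial ρ'
  have : Algebra.IsStandardSmooth R L := hsm.isStandardSmooth
  have hrank := Algebra.IsStandardSmoothOfRelativeDimension.rank_kaehlerDifferential
    (R := R) (S := L) 1
  have hfin : Module.finrank L (Ω[L⁄R]) = 1 := Module.finrank_eq_of_rank_eq hrank
  let e := Module.basisUnique Unit hfin
  -- The differentials are free of rank one, so each derivation is determined by its value on the
  -- same basis element.
  have key (i : Fin 2) (x : L) : D i x =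
      ρ' (e.repr (KaehlerDifferential.D R L x) ()) * (D i).liftKaehlerDifferential (e ()) := by
    rw [← (D i).liftKaehlerDifferential_comp_D x]
    conv_lhs => rw [← e.sum_repr (KaehlerDifferential.D R L x)]
    simp only [Finset.univ_unique, Finset.sum_singleton, map_smul]
    rfl
  rw [← hD, ← hD, ← hD, ← hD, key 0, key 1, key 0 (algebraMap B L b'), key 1 (algebraMap B L b)]
  ring

end Derivations

/-- Every term of the determinant, constant or first order, carries a 2 × 2 minor of the constant
part. -/
lemma det_dualNumber_eq_zero {κ : Type} [Field κ] {N : Matrix (Fin 3) (Fin 3) (DualNumber κ)}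
    (h : ∀ r s p q, (N r p).fst * (N s q).fst - (N r q).fst * (N s p).fst = 0) : N.det = 0 := by
  have h3 (r s p q t u) : (N r p).fst * (N s q).fst * (N t u).fst =
    (N r q).fst * (N s p).fst * (N t u).fst := by rw [sub_eq_zero.1 (h r s p q)]
  rw [Matrix.det_fin_three]
  ext
  · simp only [TrivSqZeroExt.fst_add, TrivSqZeroExt.fst_sub, TrivSqZeroExt.fst_mul,
      TrivSqZeroExt.fst_zero]
    linear_combination (N 0 0).fst * h 1 2 1 2 - (N 0 1).fst * h 1 2 0 2 + (N 0 2).fst * h 1 2 0 1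
  · simp only [TrivSqZeroExt.snd_add, TrivSqZeroExt.snd_sub, TrivSqZeroExt.snd_mul,
      TrivSqZeroExt.fst_mul, TrivSqZeroExt.snd_zero, smul_eq_mul, MulOpposite.smul_eq_mul_unop,
      MulOpposite.unop_op]
    linear_combination (N 0 0).snd * h 1 2 1 2 - (N 0 1).snd * h 1 2 0 2 + (N 0 2).snd * h 1 2 0 1 -
      (N 1 0).snd * h 0 2 1 2 + (N 1 1).snd * h 0 2 0 2 - (N 1 2).snd * h 0 2 0 1 +
      (N 2 0).snd * h 0 1 1 2 - (N 2 1).snd * h 0 1 0 2 + (N 2 2).snd * h 0 1 0 1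

lemma maxMinor_dualNumber_eq_zero {κ : Type} [Field κ]
    {N : Matrix (Fin 3) (Fin 4) (DualNumber κ)}
    (h : ∀ r s p q, (minorTwo N r s p q).fst = 0) (j : Fin 4) : maxMinor N j = 0 := by
  rw [maxMinor, det_dualNumber_eq_zero, mul_zero]
  intro r s p q
  have := h r s (j.succAbove p) (j.succAbove q)
  rwa [minorTwo, TrivSqZeroExt.fst_sub, TrivSqZeroExt.fst_mul, TrivSqZeroExt.fst_mul] at this

lemma specIdeal_ker_SpecMap {B B' : Type} [CommRing B] [CommRing B'] (ψ : B →+* B') :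
    specIdeal (Spec.map (CommRingCat.ofHom ψ)).ker = RingHom.ker ψ := by
  rw [← Scheme.IdealSheafData.map_bot, specIdeal_map, RingHom.ker_eq_comap_bot]
  congr 1
  rw [specIdeal, Scheme.IdealSheafData.ideal_bot]
  exact (RingHom.injective_iff_ker_eq_bot _).1 ΓSpecIso_inv_bijective.1

variable {C : Scheme.{0}} {i : C ⟶ projSpace (Fin 4)}

lemma locally_isStandardSmooth [IsIntegral C] [IsClosedImmersion i]
    [SmoothOfRelativeDimension 1 (i ≫ structureMap (polyGrading (Fin 4)))] {a : Fin 4}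
    (ha : X a ∈ polyGrading (Fin 4) 1) (haI : X a ∉ (idealOf i).toIdeal) :
    RingHom.Locally (RingHom.IsStandardSmoothOfRelativeDimension 1)
      ((Ideal.Quotient.mk ((idealOf i).toIdeal.map (dehom (polyGrading (Fin 4)) ha))).comp
        ((dehom (polyGrading (Fin 4)) ha).comp MvPolynomial.C)) := by
  let j := Proj.awayι (polyGrading (Fin 4)) (X a) ha one_pos
  obtain ⟨J, e, he⟩ := IsClosedImmersion.Spec_iff.1
    (inferInstance : IsClosedImmersion (Limits.pullback.fst j i))
  have hJ : J = (idealOf i).toIdeal.map (dehom (polyGrading (Fin 4)) ha) := by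
    rw [← specIdeal_comap_awayι ha haI, ← Scheme.IdealSheafData.ker_fst_of_isClosedImmersion, he,
      Scheme.Hom.ker_comp_of_isIso]
    exact ((specIdeal_ker_SpecMap _).trans Ideal.mk_ker).symm
  subst hJ
  have hcomp : (e.inv ≫ Limits.pullback.snd j i) ≫ (i ≫ structureMap (polyGrading (Fin 4))) =
      Spec.map (CommRingCat.ofHom ((Ideal.Quotient.mk ((idealOf i).toIdeal.map
        (dehom (polyGrading (Fin 4)) ha))).comp ((dehom (polyGrading (Fin 4)) ha).comp MvPolynomial.C))) := by
    rw [Category.assoc, ← Limits.pullback.condition_assoc, he, Category.assoc,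
      Iso.inv_hom_id_assoc]
    simp only [j]
    rw [awayι_eq_point, point_structureMap, ← Spec.map_comp]
    rfl
  -- The chart is an open subscheme of C, which contributes relative dimension 0.
  have h : SmoothOfRelativeDimension (0 + 1)
    ((e.inv ≫ Limits.pullback.snd j i) ≫ (i ≫ structureMap (polyGrading (Fin 4)))) := inferInstance
  rw [hcomp, zero_add, HasRingHomProperty.Spec_iff (P := @SmoothOfRelativeDimension 1)] at h
  exact h

/-- The `2 × 2` minors and the maximal minors of `M` have no common zero, because the curve is
smooth. -/
lemma eq_zero_of_minors_eq_zero [IsIntegral C] [IsClosedImmersion i]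
    [SmoothOfRelativeDimension 1 (i ≫ structureMap (polyGrading (Fin 4)))]
    {M : Matrix (Fin 3) (Fin 4) (MvPolynomial (Fin 4) ℂ)}
    (hM : IsDeterminantal (idealOf i).toIdeal M) {κ : Type} [Field κ]
    (φ : MvPolynomial (Fin 4) ℂ →+* κ) (h2 : ∀ r s p q, φ (minorTwo M r s p q) = 0)
    {a : Fin 4} (haI : X a ∉ (idealOf i).toIdeal) : φ (X a) = 0 := by
  by_contra hφ
  have ha : X a ∈ polyGrading (Fin 4) 1 := isHomogeneous_X ℂ a
  -- The tangent vector at the point φ in the direction d.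
  let τ (d : Fin 4 → κ) : MvPolynomial (Fin 4) ℂ →+* DualNumber κ :=
    eval₂Hom ((TrivSqZeroExt.inlHom κ κ).comp (φ.comp MvPolynomial.C))
      fun j => TrivSqZeroExt.inl (φ (X j)) + TrivSqZeroExt.inr (d j)
  have hτX (d) (j) : τ d (X j) = TrivSqZeroExt.inl (φ (X j)) + TrivSqZeroExt.inr (d j) :=
    eval₂Hom_X' _ _ _
  have hτC (d) (c) : τ d (MvPolynomial.C c) = TrivSqZeroExt.inl (φ (MvPolynomial.C c)) := eval₂Hom_C _ _ _
  have hfst (d) (p) : (τ d p).fst = φ p := by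
    have : (TrivSqZeroExt.fstHom κ κ κ).toRingHom.comp (τ d) = φ := by
      ext c
      · change (τ d (MvPolynomial.C c)).fst = φ (MvPolynomial.C c)
        rw [hτC, TrivSqZeroExt.fst_inl]
      · change (τ d (X c)).fst = _
        simp [hτX]
    exact RingHom.congr_fun this p
  have hu (d) : IsUnit (τ d (X a)) := by
    rw [TrivSqZeroExt.isUnit_iff_isUnit_fst, hfst]
    exact (Ne.isUnit hφ)
  let ψ (d) : Away (polyGrading (Fin 4)) (X a) →+* DualNumber κ := awayLift _ (τ d) (hu d)
  have hψ (d) {n : ℕ} {p : MvPolynomial (Fin 4) ℂ} (hp : p ∈ polyGrading (Fin 4) n) :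
      ψ d (dehom _ ha p) * τ d (X a) ^ n = τ d p := by
    rw [dehom_of_mem ha hp]
    exact awayLift_mk_mul _ _ _ ha n p _
  -- The maximal minors vanish to first order, so every direction d is tangent to C.
  have hker (d) : (idealOf i).toIdeal.map (dehom (polyGrading (Fin 4)) ha) ≤ RingHom.ker (ψ d) := by
    rw [← hM.span_eq, Ideal.map_span, Ideal.span_le]
    rintro _ ⟨_, ⟨j, rfl⟩, rfl⟩
    refine ((hu d).pow 3).mul_left_injective ?_
    have : maxMinor M j ∈ polyGrading (Fin 4) 3 := maxMinor_isHomogeneous hM.isHomogeneous j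
    dsimp only
    rw [hψ d this, zero_mul, map_maxMinor]
    refine maxMinor_dualNumber_eq_zero (fun r s p q => ?_) j
    rw [← map_minorTwo, hfst, h2]
  let θ (d) := Ideal.Quotient.lift _ (ψ d) (hker d)
  have hθ (d) {n : ℕ} {p : MvPolynomial (Fin 4) ℂ} (hp : p ∈ polyGrading (Fin 4) n) :
      θ d (Ideal.Quotient.mk _ (dehom _ ha p)) * τ d (X a) ^ n = τ d p := hψ d hp
  have hp : ∀ a : Fin 4, ∃ p q, p ≠ a ∧ q ≠ a ∧ p ≠ q := by decide
  -- Two coordinate directions keeping x_a fixed are independent in the affine chart, contradicting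
  -- relative dimension 1.
  obtain ⟨p, q, hpa, hqa, hpq⟩ := hp a
  have hsnd (d : Fin 4 → κ) (hd : d a = 0) (j : Fin 4) :
      (θ d (Ideal.Quotient.mk _ (dehom _ ha (X j)))).snd * φ (X a) = d j := by
    have h1 := congrArg TrivSqZeroExt.snd (hθ d (p := X j) (isHomogeneous_X ℂ j))
    rw [pow_one, hτX, hτX, hd] at h1
    simpa using h1
  have := snd_mul_snd_eq_of_locally (locally_isStandardSmooth (i := i) ha haI)
    (ρ := (TrivSqZeroExt.fstHom κ κ κ).toRingHom.comp (θ 0))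
    (fun k => θ (Pi.single (![p, q] k) 1)) (fun k b => ?_) (fun k c => ?_)
    (Ideal.Quotient.mk _ (dehom _ ha (X p))) (Ideal.Quotient.mk _ (dehom _ ha (X q)))
  · have hp1 := hsnd (Pi.single p 1) (by simp [hpa.symm])
    have hq1 := hsnd (Pi.single q 1) (by simp [hqa.symm])
    have hpp := hp1 p
    have hpq' := hp1 q
    have hqq := hq1 q
    rw [Pi.single_eq_same] at hpp hqq
    rw [Pi.single_eq_of_ne hpq.symm] at hpq'
    simp only [Matrix.cons_val_zero, Matrix.cons_val_one] at this
    have h0 := (mul_eq_zero.1 hpq').resolve_right hφ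
    rw [h0, zero_mul] at this
    rcases mul_eq_zero.1 this with h | h
    · rw [h, zero_mul] at hpp
      exact zero_ne_one hpp
    · rw [h, zero_mul] at hqq
      exact zero_ne_one hqq
  · obtain ⟨b, rfl⟩ := Ideal.Quotient.mk_surjective b
    obtain ⟨n, f, hf, rfl⟩ := Away.mk_surjective _ ha b
    have hf' : f ∈ polyGrading (Fin 4) n := by simpa using hf
    rw [← dehom_of_mem ha hf']
    have h1 := congrArg TrivSqZeroExt.fst (hθ (Pi.single (![p, q] k) 1) hf')
    have h2 := congrArg TrivSqZeroExt.fst (hθ 0 hf')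
    rw [TrivSqZeroExt.fst_mul, hfst, TrivSqZeroExt.fst_pow, hfst, ] at h1 h2
    exact mul_right_cancel₀ (pow_ne_zero n hφ) (h1.trans h2.symm)
  · have hc : (MvPolynomial.C c : MvPolynomial (Fin 4) ℂ) ∈ polyGrading (Fin 4) 0 := isHomogeneous_C _ c
    have := hθ (Pi.single (![p, q] k) 1) hc
    rw [pow_zero, mul_one, hτC] at this
    exact (congrArg TrivSqZeroExt.snd this).trans (TrivSqZeroExt.snd_inl _ _)

end Smooth

end SexticBlowup

namespace SexticBlowup

open AlgebraicGeometry CategoryTheory HomogeneousLocalization MvPolynomial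

/-! ### The section of the Segre variety by bilinear forms -/

noncomputable section Section

variable {B : Type} [CommRing B]

lemma map_eq_pow_mul {σ : Type} {φ φ' : MvPolynomial σ ℂ →+* B} {u : B}
    (hC : ∀ c, φ' (C c) = φ (C c)) (hX : ∀ i, φ' (X i) = u * φ (X i)) (n : ℕ)
    {f : MvPolynomial σ ℂ} (hf : f.IsHomogeneous n) : φ' f = u ^ n * φ f := by
  have h (ψ : MvPolynomial σ ℂ →+* B) : ψ f = f.eval₂ (ψ.comp C) fun i => ψ (X i) := by
    have : ψ = eval₂Hom (ψ.comp C) fun i => ψ (X i) := by ext <;> simp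
    exact RingHom.congr_fun this f
  rw [h φ', h φ, ← eval₂_mul_of_isHomogeneous hf]
  congr 1
  · exact RingHom.ext hC
  · exact funext hX

lemma sub_homogeneousComponent_zero_mem {σ : Type} (f : MvPolynomial σ ℂ) :
    f - homogeneousComponent 0 f ∈ Ideal.span (Set.range X) := by
  rw [← Set.image_univ, mem_ideal_span_X_image]
  intro m hm
  by_contra! h
  have hm0 : m = 0 := Finsupp.ext fun s => h s trivial
  rw [hm0, mem_support_iff, coeff_sub, homogeneousComponent_zero, coeff_zero_C, sub_self] at hm
  exact hm rfl

lemma exists_mem_basicOpen_X {σ : Type} (x : projSpace σ) :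
    ∃ a, x ∈ Proj.basicOpen (polyGrading σ) (X a) := by
  have := Proj.iSup_basicOpen_eq_top (polyGrading σ) X fun f hf => by
    have h := sub_homogeneousComponent_zero_mem f
    replace hf := (HomogeneousIdeal.mem_irrelevant_iff _ _).1 hf
    rw [GradedRing.proj_apply] at hf
    rw [← decomposition.decompose'_apply] at h
    rwa [show (decomposition.decompose' f 0 : MvPolynomial σ ℂ) = 0 from hf, sub_zero] at h
  exact TopologicalSpace.Opens.mem_iSup.1 (this.ge (TopologicalSpace.Opens.mem_top x))

/-- The minors generate the ideal of C, and dehomogenizing them only divides by the unit `σ (X a) ^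
3`. -/
lemma specIdeal_comap_point {C : Scheme.{0}} {i : C ⟶ projSpace (Fin 4)} [IsIntegral C]
    [IsClosedImmersion i] {M : Matrix (Fin 3) (Fin 4) (MvPolynomial (Fin 4) ℂ)}
    (hM : IsDeterminantal (idealOf i).toIdeal M) {a : Fin 4} (haI : X a ∉ (idealOf i).toIdeal)
    (σ : MvPolynomial (Fin 4) ℂ →+* B) (ha : X a ∈ polyGrading (Fin 4) 1) (hu : IsUnit (σ (X a))) :
    specIdeal (i.ker.comap (point σ ha one_pos hu)) =
      Ideal.span (Set.range fun j => σ (maxMinor M j)) := by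
  rw [point, Scheme.IdealSheafData.comap_comp, specIdeal_comap, specIdeal_comap_awayι ha haI,
    ← hM.span_eq, Ideal.map_span, Ideal.map_span, ← Set.range_comp, ← Set.range_comp]
  have h (j : Fin 4) : awayLift _ σ hu (dehom _ ha (maxMinor M j)) * σ (X a) ^ 3 =
      σ (maxMinor M j) := by
    have : maxMinor M j ∈ polyGrading (Fin 4) 3 := maxMinor_isHomogeneous hM.isHomogeneous j
    rw [dehom_of_mem ha this]
    exact awayLift_mk_mul _ _ _ ha 3 _ _
  refine le_antisymm (Ideal.span_le.2 ?_) (Ideal.span_le.2 ?_)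
  · rintro _ ⟨j, rfl⟩
    refine (Ideal.mul_unit_mem_iff_mem _ (hu.pow 3)).1 ?_
    rw [Function.comp_apply, Function.comp_apply, h]
    exact Ideal.subset_span ⟨j, rfl⟩
  · rintro _ ⟨j, rfl⟩
    dsimp only
    rw [← h]
    exact Ideal.mul_mem_right _ _ (Ideal.subset_span ⟨j, rfl⟩)

variable (c : Fin 3 → Fin 4 × Fin 4 → ℂ)

/-- The matrix of linear forms with coefficients `c`. -/
def linMatrix : Matrix (Fin 3) (Fin 4) (MvPolynomial (Fin 4) ℂ) :=
  Matrix.of fun r j => ∑ i, C (c r (i, j)) * X i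

lemma linMatrix_apply (r : Fin 3) (j : Fin 4) : linMatrix c r j = ∑ i, C (c r (i, j)) * X i := rfl

/-- The common zeros of the bilinear forms with coefficients `c`. -/
def sectionSpace : Submodule ℂ (Fin 4 × Fin 4 → ℂ) := LinearMap.ker (Matrix.of c).mulVecLin

lemma mem_sectionSpace {v : Fin 4 × Fin 4 → ℂ} : v ∈ sectionSpace c ↔ ∀ r, ∑ s, c r s * v s = 0 := by
  rw [sectionSpace, LinearMap.mem_ker, funext_iff]
  rfl

lemma finrank_sectionSpace (hc : LinearIndependent ℂ c) :
    Module.finrank ℂ (sectionSpace c) = 13 := by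
  have h := LinearMap.finrank_range_add_finrank_ker (Matrix.of c).mulVecLin
  have h2 : (Matrix.of c).rank = Fintype.card (Fin 3) :=
    LinearIndependent.rank_matrix (M := Matrix.of c) hc
  rw [Matrix.rank] at h2
  rw [h2] at h
  simp at h
  rw [sectionSpace]
  omega

/-- A linear relation between the coefficient vectors is a constant relation between the rows of the
matrix, which kills every maximal minor. -/
lemma linearIndependent_of_maxMinor_ne_zero {j : Fin 4} (hj : maxMinor (linMatrix c) j ≠ 0) :
    LinearIndependent ℂ c := by
  rw [Fintype.linearIndependent_iff]
  intro g hg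
  by_contra! h
  obtain ⟨r, hr⟩ := h
  refine hj ?_
  have hdet : ((linMatrix c).submatrix id j.succAbove).det = 0 := by
    rw [← Matrix.exists_vecMul_eq_zero_iff]
    refine ⟨fun r => C (g r), fun h => hr (by simpa using congrFun h r), ?_⟩
    ext1 k
    change ∑ r, C (g r) * linMatrix c r (j.succAbove k) = 0
    simp only [linMatrix_apply, Finset.mul_sum]
    rw [Finset.sum_comm]
    refine Finset.sum_eq_zero fun i _ => ?_
    have := congrFun hg (i, j.succAbove k)
    simp only [Finset.sum_apply, Pi.smul_apply, smul_eq_mul, Pi.zero_apply] at this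
    simp only [← mul_assoc, ← C_mul, ← Finset.sum_mul, ← map_sum, this, C_0, zero_mul]
  rw [maxMinor, hdet, mul_zero]

/-- The homogeneous coordinate ring of the section of the Segre variety by the bilinear forms with
coefficients `c`. -/
abbrev SectionRing : Type :=
  MvPolynomial (Fin 4 × Fin 4) ℂ ⧸ (segreSectionIdeal (sectionSpace c)).toIdeal

/-- The grading of the coordinate ring. -/
abbrev sectionGrading : ℕ → Submodule ℂ (SectionRing c) :=
  quotientGrading (polyGrading (Fin 4 × Fin 4)) (segreSectionIdeal (sectionSpace c))

/-- The coordinates on the section of the Segre variety. -/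
def coord (p : Fin 4 × Fin 4) : SectionRing c := Ideal.Quotient.mk _ (X p)

lemma coord_mem (p : Fin 4 × Fin 4) : coord c p ∈ sectionGrading c 1 :=
  mk_mem_quotientGrading _ (isHomogeneous_X ℂ p)

lemma coord_mul_coord (i j k l : Fin 4) :
    coord c (i, j) * coord c (k, l) = coord c (i, l) * coord c (k, j) := by
  rw [coord, coord, coord, coord, ← map_mul, ← map_mul, Ideal.Quotient.eq]
  refine (le_sup_left : segreIdeal (Fin 4) (Fin 4) ≤ segreSectionIdeal (sectionSpace c)) ?_
  change segreHom _ _ _ = 0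
  simp only [segreHom, map_sub, map_mul, aeval_X]
  ring

lemma sum_mul_coord (r : Fin 3) (φ : SectionRing c →+* B) :
    ∑ s, φ (Ideal.Quotient.mk _ (C (c r s))) * φ (coord c s) = 0 := by
  have : linearForm (c r) ∈ (segreSectionIdeal (sectionSpace c)).toIdeal :=
    (le_sup_right : linearIdeal _ ≤ segreSectionIdeal (sectionSpace c))
      (Ideal.subset_span ⟨c r, fun v hv => (mem_sectionSpace c).1 hv r, rfl⟩)
  rw [← Ideal.Quotient.eq_zero_iff_mem] at this
  simpa [linearForm, coord] using congrArg φ this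

variable {c} in
lemma map_eq_pow_mul' {φ φ' : SectionRing c →+* B} {u : B}
    (hC : ∀ z, φ' (Ideal.Quotient.mk _ (C z)) = φ (Ideal.Quotient.mk _ (C z)))
    (hX : ∀ p, φ' (coord c p) = u * φ (coord c p)) (n : ℕ) :
    ∀ a ∈ sectionGrading c n, φ' a = u ^ n * φ a := by
  rintro _ ⟨f, hf, rfl⟩
  exact map_eq_pow_mul (φ := φ.comp (Ideal.Quotient.mk _)) (φ' := φ'.comp (Ideal.Quotient.mk _))
    hC hX n hf

lemma irrelevant_le_span_coord :
    (HomogeneousIdeal.irrelevant (sectionGrading c)).toIdeal ≤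
      Ideal.span (Set.range (coord c)) := by
  intro x hx
  obtain ⟨f, rfl⟩ := Ideal.Quotient.mk_surjective x
  replace hx := (HomogeneousIdeal.mem_irrelevant_iff _ _).1 hx
  have hx0 : Ideal.Quotient.mk (segreSectionIdeal (sectionSpace c)).toIdeal
      (homogeneousComponent 0 f) = 0 := by
    rw [← decomposition.decompose'_apply]
    exact hx
  rw [← sub_zero (Ideal.Quotient.mk _ f), ← hx0, ← map_sub]
  have h2 := Ideal.mem_map_of_mem
    (Ideal.Quotient.mk (segreSectionIdeal (sectionSpace c)).toIdeal)
    (sub_homogeneousComponent_zero_mem f)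
  rwa [Ideal.map_span, ← Set.range_comp] at h2

-- Double annihilator: a functional vanishing on the common kernel of finitely many functionals is
-- in their span.
variable {c} in
lemma mem_span_of_forall_mem_sectionSpace {a : Fin 4 × Fin 4 → ℂ}
    (ha : ∀ v ∈ sectionSpace c, ∑ s, a s * v s = 0) : a ∈ Submodule.span ℂ (Set.range c) := by
  let F := dotProductEquiv ℂ (Fin 4 × Fin 4)
  have h : F a ∈ Submodule.span ℂ (Set.range fun r => F (c r)) := by
    refine mem_span_of_iInf_ker_le_ker fun v hv => ?_
    rw [Submodule.mem_iInf] at hv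
    exact ha v ((mem_sectionSpace c).2 hv)
  rw [show (fun r => F (c r)) = F ∘ c from rfl, Set.range_comp, ← LinearEquiv.coe_coe,
    ← Submodule.map_span] at h
  obtain ⟨b, hb, hba⟩ := h
  rwa [← F.injective hba]

/-- The homogeneous coordinates `(σ(xᵢ)ηⱼ)` of a point on the section. -/
def pointHom (σ : MvPolynomial (Fin 4) ℂ →+* B) (η : Fin 4 → B)
    (hη : ∀ r, ∑ j, σ (linMatrix c r j) * η j = 0) : SectionRing c →+* B :=
  Ideal.Quotient.lift _ (eval₂Hom (σ.comp C) fun p => σ (X p.1) * η p.2) <| by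
    change (segreIdeal _ _ ⊔ linearIdeal (sectionSpace c)).toIdeal ≤ RingHom.ker _
    rw [HomogeneousIdeal.toIdeal_sup]
    refine sup_le ?_ (Ideal.span_le.2 ?_)
    · intro f hf
      have h : eval₂Hom (σ.comp C) (fun p : Fin 4 × Fin 4 => σ (X p.1) * η p.2) =
          (eval₂Hom (σ.comp C) (Sum.elim (fun i => σ (X i)) η)).comp
            (segreHom (Fin 4) (Fin 4)).toRingHom := by
        ext <;> simp [segreHom]
      rw [RingHom.mem_ker, h, RingHom.comp_apply]
      exact (congrArg _ (show segreHom _ _ f = 0 from hf)).trans (map_zero _)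
    · rintro _ ⟨a, ha, rfl⟩
      refine Submodule.span_induction (p := fun a _ => linearForm a ∈ RingHom.ker _) ?_ ?_ ?_ ?_
        (mem_span_of_forall_mem_sectionSpace ha)
      · rintro _ ⟨r, rfl⟩
        rw [RingHom.mem_ker, ← hη r, linearForm, map_sum, Fintype.sum_prod_type_right]
        refine Finset.sum_congr rfl fun j _ => ?_
        rw [linMatrix_apply, map_sum, Finset.sum_mul]
        refine Finset.sum_congr rfl fun i _ => ?_
        simp [mul_assoc]
      · simp [linearForm]
      · intro a b _ _ h1 h2
        have : linearForm (a + b) = linearForm a + linearForm b := by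
          simp [linearForm, add_mul, Finset.sum_add_distrib]
        rw [this]
        exact add_mem h1 h2
      · intro z a _ h
        have : linearForm (z • a) = C z * linearForm a := by
          simp [linearForm, Finset.mul_sum, mul_assoc]
        rw [this]
        exact Ideal.mul_mem_left _ _ h

end Section

end SexticBlowup

namespace SexticBlowup

open AlgebraicGeometry CategoryTheory HomogeneousLocalization MvPolynomial

/-! ### Projection to ℙ³ and coordinates of points -/

noncomputable section Projection

variable {B : Type} [CommRing B] (c : Fin 3 → Fin 4 × Fin 4 → ℂ)

lemma X_mem (a : Fin 4) : X a ∈ polyGrading (Fin 4) 1 := isHomogeneous_X ℂ a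

/-- Restriction of the coordinate ring of `ℙ³` to a column of the coordinate matrix. -/
def slice (k : Fin 4) : MvPolynomial (Fin 4) ℂ →+* SectionRing c :=
  eval₂Hom ((Ideal.Quotient.mk _).comp C) fun i => coord c (i, k)

@[simp] lemma slice_X (k i : Fin 4) : slice c k (X i) = coord c (i, k) := eval₂Hom_X' _ _ _

@[simp] lemma slice_C (k : Fin 4) (z : ℂ) : slice c k (C z) = Ideal.Quotient.mk _ (C z) :=
  eval₂Hom_C _ _ _

variable {c}

/-- Different columns of the coordinate matrix define the same point of `ℙ³`. -/
lemma point_slice_eq {φ φ' : SectionRing c →+* B} {a b k l : Fin 4} {u : B} (hu : IsUnit u)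
    (hC : ∀ z, φ' (Ideal.Quotient.mk _ (C z)) = φ (Ideal.Quotient.mk _ (C z)))
    (hX : ∀ p, φ' (coord c p) = u * φ (coord c p)) (h : IsUnit (φ (coord c (a, k))))
    (h' : IsUnit (φ' (coord c (b, l)))) :
    point (φ.comp (slice c k)) (X_mem a) one_pos (by simpa using h) =
      point (φ'.comp (slice c l)) (X_mem b) one_pos (by simpa using h') := by
  have hb : IsUnit (φ (coord c (b, l))) := by
    rw [hX] at h'
    exact isUnit_of_mul_isUnit_right h'
  have hal : IsUnit (φ (coord c (a, l))) := by
    have := h.mul hb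
    rw [← map_mul, coord_mul_coord, map_mul] at this
    exact isUnit_of_mul_isUnit_left this
  obtain ⟨w, hw⟩ := h
  refine point_eq (u := u * (φ (coord c (a, l)) * ↑w⁻¹)) _ _ _ _ _ _
    (hu.mul (hal.mul (Units.isUnit _))) fun n f hf => ?_
  refine map_eq_pow_mul (fun z => by simp [hC]) (fun i => ?_) n hf
  simp only [RingHom.comp_apply, slice_X, hX]
  have := congrArg φ (coord_mul_coord c a k i l)
  rw [map_mul, map_mul, ← hw] at this
  have h1 : φ (coord c (i, l)) = ↑w⁻¹ * (φ (coord c (a, l)) * φ (coord c (i, k))) := by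
    rw [← this, Units.inv_mul_cancel_left]
  rw [h1]
  ring

lemma isUnit_dehom_coord (p : Fin 4 × Fin 4) :
    IsUnit (dehom (sectionGrading c) (coord_mem c p) (coord c p)) := by
  rw [dehom_self]
  exact isUnit_one

variable (c)

/-- The affine charts of the section of the Segre variety. -/
def sectionCover : (projSubscheme (segreSectionIdeal (sectionSpace c))).AffineOpenCover :=
  Proj.affineOpenCoverOfIrrelevantLESpan (sectionGrading c) (coord c) (coord_mem c)
    (fun _ => one_pos) (irrelevant_le_span_coord c)

/-- The projection to `ℙ³` on an affine chart. -/
def projChart (p : Fin 4 × Fin 4) :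
    Spec (.of (Away (sectionGrading c) (coord c p))) ⟶ projSpace (Fin 4) :=
  point ((dehom (sectionGrading c) (coord_mem c p)).comp (slice c p.2)) (X_mem p.1) one_pos
    (by simpa using isUnit_dehom_coord p)

/-- On the overlap the two normalized coordinate systems describe the same point of the section, so
they differ by the unit `φ' (coord c p)`; columns of a rank one matrix are proportional. -/
lemma projChart_compat (p q : Fin 4 × Fin 4) :
    Limits.pullback.fst (Proj.awayι (sectionGrading c) (coord c p) (coord_mem c p) one_pos)
        (Proj.awayι (sectionGrading c) (coord c q) (coord_mem c q) one_pos) ≫ projChart c p =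
      Limits.pullback.snd _ _ ≫ projChart c q := by
  rw [← cancel_epi (Proj.pullbackAwayιIso (sectionGrading c) (coord_mem c p) one_pos
    (coord_mem c q) one_pos rfl).inv, Proj.pullbackAwayιIso_inv_fst_assoc,
    Proj.pullbackAwayιIso_inv_snd_assoc, projChart, projChart, SpecMap_point, SpecMap_point]
  let φ := (awayMap (sectionGrading c) (coord_mem c q) rfl).comp
    (dehom (sectionGrading c) (coord_mem c p))
  let φ' := (awayMap (sectionGrading c) (coord_mem c p) (mul_comm _ _)).comp
    (dehom (sectionGrading c) (coord_mem c q))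
  have hφ : φ (coord c p) = 1 := by simp [φ, dehom_self]
  have hφ' : φ' (coord c q) = 1 := by simp [φ', dehom_self]
  have h : point φ (coord_mem c p) one_pos (by rw [hφ]; exact isUnit_one) =
      point φ' (coord_mem c q) one_pos (by rw [hφ']; exact isUnit_one) := by
    rw [← SpecMap_point _ _ _ _ (isUnit_dehom_coord p), ← awayι_eq_point,
      ← SpecMap_point _ _ _ _ (isUnit_dehom_coord q), ← awayι_eq_point,
      Proj.SpecMap_awayMap_awayι, Proj.SpecMap_awayMap_awayι]
  have hu := isUnit_of_point_eq h
  have hm (n : ℕ) {x} (hx : x ∈ sectionGrading c n) : φ' x = φ' (coord c p) ^ n * φ x := by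
    have := mul_pow_eq_of_point_eq h n (a := x) (by simpa using hx)
    rw [hφ, one_pow, mul_one] at this
    rw [← this]
    exact mul_comm _ _
  refine point_slice_eq (φ := φ) (φ' := φ') hu (fun z => ?_) (fun r => ?_) ?_ ?_
  · simpa using hm 0 (x := Ideal.Quotient.mk _ (C z))
      (mk_mem_quotientGrading _ (isHomogeneous_C _ z))
  · simpa using hm 1 (coord_mem c r)
  · change IsUnit (φ (coord c p))
    rw [hφ]
    exact isUnit_one
  · change IsUnit (φ' (coord c q))
    rw [hφ']
    exact isUnit_one

/-- The first projection of the section of the Segre variety. -/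
def sectionProj : projSubscheme (segreSectionIdeal (sectionSpace c)) ⟶ projSpace (Fin 4) :=
  (sectionCover c).openCover.glueMorphisms (projChart c) (projChart_compat c)

variable {c}

lemma awayι_sectionProj (p : Fin 4 × Fin 4) :
    Proj.awayι (sectionGrading c) (coord c p) (coord_mem c p) one_pos ≫ sectionProj c =
      projChart c p :=
  (sectionCover c).openCover.ι_glueMorphisms (projChart c) (projChart_compat c) p

lemma point_sectionProj (φ : SectionRing c →+* B) {a k : Fin 4} (hu : IsUnit (φ (coord c (a, k)))) :
    point φ (coord_mem c (a, k)) one_pos hu ≫ sectionProj c =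
      point (φ.comp (slice c k)) (X_mem a) one_pos (by simpa using hu) := by
  rw [point, Category.assoc, awayι_sectionProj, projChart, SpecMap_point]
  have h (n : ℕ) {x} (hx : x ∈ sectionGrading c n) :
      φ x = φ (coord c (a, k)) ^ n * awayLift _ φ hu (dehom _ (coord_mem c (a, k)) x) := by
    rw [mul_comm, dehom_of_mem (coord_mem c (a, k)) hx]
    exact (awayLift_mk_mul _ _ _ _ n x _).symm
  refine point_slice_eq (φ := (awayLift _ φ hu).comp (dehom _ (coord_mem c (a, k)))) hu
    (fun z => ?_) (fun r => ?_) ?_ hu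
  · simpa using h 0 (x := Ideal.Quotient.mk _ (C z))
      (mk_mem_quotientGrading _ (isHomogeneous_C _ z))
  · simpa using h 1 (coord_mem c r)
  · exact (isUnit_dehom_coord (a, k)).map (awayLift _ φ hu)

lemma sectionProj_structureMap :
    sectionProj c ≫ structureMap (polyGrading (Fin 4)) = structureMap (sectionGrading c) := by
  refine (sectionCover c).openCover.hom_ext _ _ fun (p : Fin 4 × Fin 4) => ?_
  change Proj.awayι (sectionGrading c) (coord c p) (coord_mem c p) one_pos ≫ _ =
    Proj.awayι (sectionGrading c) (coord c p) (coord_mem c p) one_pos ≫ _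
  rw [← Category.assoc, awayι_sectionProj, projChart, point_structureMap, awayι_eq_point,
    point_structureMap]
  congr 2
  refine RingHom.ext fun z => ?_
  exact congrArg (dehom (sectionGrading c) (coord_mem c p)) (slice_C c p.2 z)

@[simp] lemma pointHom_coord (σ : MvPolynomial (Fin 4) ℂ →+* B) (η : Fin 4 → B)
    (hη : ∀ r, ∑ j, σ (linMatrix c r j) * η j = 0) (p : Fin 4 × Fin 4) :
    pointHom c σ η hη (coord c p) = σ (X p.1) * η p.2 :=
  eval₂Hom_X' _ _ _

@[simp] lemma pointHom_C (σ : MvPolynomial (Fin 4) ℂ →+* B) (η : Fin 4 → B)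
    (hη : ∀ r, ∑ j, σ (linMatrix c r j) * η j = 0) (z : ℂ) :
    pointHom c σ η hη (Ideal.Quotient.mk _ (C z)) = σ (C z) :=
  eval₂Hom_C _ _ _

/-- A point of the section of the Segre variety with first coordinate `σ` and second coordinate
`η`. -/
lemma point_pointHom_sectionProj (σ : MvPolynomial (Fin 4) ℂ →+* B) (η : Fin 4 → B)
    (hη : ∀ r, ∑ j, σ (linMatrix c r j) * η j = 0) {a k : Fin 4} (ha : IsUnit (σ (X a)))
    (hk : IsUnit (η k)) :
    point (pointHom c σ η hη) (coord_mem c (a, k)) one_pos (by simpa using ha.mul hk) ≫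
      sectionProj c = point σ (X_mem a) one_pos ha := by
  rw [point_sectionProj]
  refine (point_eq _ _ _ _ _ _ hk fun n f hf => ?_).symm
  refine map_eq_pow_mul (fun z => by simp) (fun i => ?_) n hf
  simp [mul_comm]

/-- A coordinate matrix of rank one with entry (a, k) equal to 1 is the product of its k-th column
and its a-th row. -/
lemma map_coord {φ : SectionRing c →+* B} {a k : Fin 4} (hφ : φ (coord c (a, k)) = 1)
    (i j : Fin 4) : φ (coord c (i, j)) = φ (coord c (i, k)) * φ (coord c (a, j)) := by
  have := congrArg φ (coord_mul_coord c i j a k)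
  rwa [map_mul, map_mul, hφ, mul_one] at this

/-- With column k as x and row a as y, the linear equations of the section say that y is in the
kernel of the matrix at x. -/
lemma sum_slice_mul_coord {φ : SectionRing c →+* B} {a k : Fin 4} (hφ : φ (coord c (a, k)) = 1)
    (r : Fin 3) : ∑ j, φ (slice c k (linMatrix c r j)) * φ (coord c (a, j)) = 0 := by
  rw [← sum_mul_coord c r φ, Fintype.sum_prod_type_right]
  refine Finset.sum_congr rfl fun j _ => ?_
  rw [linMatrix_apply, map_sum, map_sum, Finset.sum_mul]
  refine Finset.sum_congr rfl fun i _ => ?_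
  rw [map_coord hφ i j, map_mul, map_mul, slice_C, slice_X, mul_assoc]

lemma linMatrix_isHomogeneous (r : Fin 3) (j : Fin 4) : (linMatrix c r j).IsHomogeneous 1 := by
  rw [linMatrix_apply]
  exact IsHomogeneous.sum _ _ _ fun _ _ => isHomogeneous_C_mul_X _ _

/-- Points of the section over a given point of `ℙ³`. -/
lemma exists_eq_point_pointHom {σ : MvPolynomial (Fin 4) ℂ →+* B} {a : Fin 4}
    {ha : IsUnit (σ (X a))}
    {h : Spec (.of B) ⟶ projSubscheme (segreSectionIdeal (sectionSpace c))}
    (hh : h ≫ sectionProj c = point σ (X_mem a) one_pos ha) {b k : Fin 4}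
    (hbk : h ⁻¹ᵁ Proj.basicOpen (sectionGrading c) (coord c (b, k)) = ⊤) :
    ∃ (η : Fin 4 → B) (hη : ∀ r, ∑ j, σ (linMatrix c r j) * η j = 0) (hk : IsUnit (η k)),
      h = point (pointHom c σ η hη) (coord_mem c (a, k)) one_pos
        (by simpa using ha.mul hk) := by
  obtain ⟨φ, hφ, rfl⟩ := exists_eq_point (coord_mem c (b, k)) h hbk
  rw [point_sectionProj] at hh
  have hu := isUnit_of_point_eq hh
  have hm (n : ℕ) {f} (hf : f ∈ polyGrading (Fin 4) n) :
      σ f = σ (X b) ^ n * φ (slice c k f) := by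
    have := mul_pow_eq_of_point_eq hh n (a := f) (by simpa using hf)
    simp only [RingHom.comp_apply, slice_X, hφ, one_pow, mul_one] at this
    rw [← this, mul_comm]
  have hX (i : Fin 4) : σ (X i) = σ (X b) * φ (coord c (i, k)) := by
    simpa using hm 1 (X_mem i)
  have hC (z : ℂ) : σ (C z) = φ (Ideal.Quotient.mk _ (C z)) := by
    simpa using hm 0 (isHomogeneous_C _ z)
  have hη : ∀ r, ∑ j, σ (linMatrix c r j) * φ (coord c (b, j)) = 0 := by
    intro r
    simp only [hm 1 (linMatrix_isHomogeneous r _), pow_one, mul_assoc, ← Finset.mul_sum,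
      sum_slice_mul_coord hφ, mul_zero]
  -- The kernel vector η is row b of the coordinate matrix; rescaling by `σ (X b)` matches the given
  -- first coordinates.
  refine ⟨_, hη, by rw [hφ]; exact isUnit_one, ?_⟩
  refine point_eq _ _ _ _ _ _ hu fun n x hx => ?_
  refine map_eq_pow_mul' (fun z => ?_) (fun p => ?_) n x hx
  · rw [pointHom_C, hC]
  · rw [pointHom_coord, hX, map_coord hφ p.1 p.2, mul_assoc]

end Projection

end SexticBlowup

namespace SexticBlowup

open AlgebraicGeometry CategoryTheory HomogeneousLocalization MvPolynomial

/-! ### The lifting property of the blowup -/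

noncomputable section Blowup

variable {c : Fin 3 → Fin 4 × Fin 4 → ℂ}

lemma exists_mem_basicOpen_coord (x : projSubscheme (segreSectionIdeal (sectionSpace c))) :
    ∃ p, x ∈ Proj.basicOpen (sectionGrading c) (coord c p) := by
  have := Proj.iSup_basicOpen_eq_top (sectionGrading c) (coord c) (irrelevant_le_span_coord c)
  exact TopologicalSpace.Opens.mem_iSup.1 (this.ge (TopologicalSpace.Opens.mem_top x))

variable {C : Scheme.{0}} {i : C ⟶ projSpace (Fin 4)} [IsIntegral C] [IsClosedImmersion i]

lemma span_eq_of_kernel {B : Type} [CommRing B] {M : Matrix (Fin 3) (Fin 4) B} {η : Fin 4 → B}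
    (hη : ∀ r, ∑ j, M r j * η j = 0) {k : Fin 4} (hk : IsUnit (η k)) :
    Ideal.span (Set.range (maxMinor M)) = Ideal.span {maxMinor M k} := by
  refine le_antisymm (Ideal.span_le.2 ?_) (Ideal.span_le.2 ?_)
  · rintro _ ⟨j, rfl⟩
    refine (Ideal.mul_unit_mem_iff_mem _ hk).1 ?_
    rw [maxMinor_mul_eq hη j k]
    exact Ideal.mul_mem_right _ _ (Ideal.mem_span_singleton_self _)
  · rintro _ rfl
    exact Ideal.subset_span ⟨k, rfl⟩

/-- The k-th minor and β generate the same ideal, so they differ by a unit, as β is a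
nonzerodivisor; the remaining minors follow by proportionality to η. -/
lemma exists_unit_of_span_eq {B : Type} [CommRing B] {M : Matrix (Fin 3) (Fin 4) B}
    {η : Fin 4 → B} (hη : ∀ r, ∑ j, M r j * η j = 0) {k : Fin 4} (hk : IsUnit (η k)) {β : B}
    (hβ : β ∈ nonZeroDivisors B) (h : Ideal.span (Set.range (maxMinor M)) = Ideal.span {β}) :
    ∃ w : Bˣ, ∀ j, maxMinor M j = β * w * η j := by
  rw [span_eq_of_kernel hη hk] at h
  obtain ⟨s, hs⟩ := Ideal.mem_span_singleton'.1 (h.le (Ideal.mem_span_singleton_self _))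
  obtain ⟨t, ht⟩ := Ideal.mem_span_singleton'.1 (h.ge (Ideal.mem_span_singleton_self _))
  have hst : (t * s - 1) * β = 0 := by rw [← hs, ← mul_assoc] at ht; rw [sub_mul, ht]; ring
  have hst' : t * s = 1 := sub_eq_zero.1 ((mem_nonZeroDivisors_iff_right.1 hβ) _ hst)
  obtain ⟨w, hw⟩ := hk
  refine ⟨⟨s, t, by rw [mul_comm, hst'], hst'⟩ * w⁻¹, fun j => ?_⟩
  have := maxMinor_mul_eq hη j k
  rw [← hs, ← hw] at this
  rw [← Units.mul_left_inj w, this]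
  push_cast
  rw [mul_assoc, mul_assoc, mul_assoc, mul_assoc, mul_comm (η j), ← mul_assoc (↑w⁻¹ : B),
    Units.inv_mul]
  ring

/-- Locally the two lifts are given by kernel vectors over the same x. Each equals the vector of
minors divided by β, up to a unit, so they define the same point. -/
lemma eq_of_comp_sectionProj_eq (hM : IsDeterminantal (idealOf i).toIdeal (linMatrix c))
    (hX : ∀ a, X a ∉ (idealOf i).toIdeal) {T : Scheme.{0}}
    {h₁ h₂ : T ⟶ projSubscheme (segreSectionIdeal (sectionSpace c))}
    (h : h₁ ≫ sectionProj c = h₂ ≫ sectionProj c)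
    (hI : IsInvertibleIdeal (i.ker.comap (h₁ ≫ sectionProj c))) : h₁ = h₂ := by
  refine Scheme.hom_ext_of_forall _ _ fun x => ?_
  obtain ⟨⟨b₁, k⟩, hp⟩ := exists_mem_basicOpen_coord (h₁ x)
  obtain ⟨⟨b₂, l⟩, hq⟩ := exists_mem_basicOpen_coord (h₂ x)
  obtain ⟨a, ha⟩ := exists_mem_basicOpen_X ((h₁ ≫ sectionProj c) x)
  obtain ⟨B, j, hj, hxj, hjW, β, hβ, hs⟩ := hI.exists_chart x
    (h₁ ⁻¹ᵁ Proj.basicOpen (sectionGrading c) (coord c (b₁, k)) ⊓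
      h₂ ⁻¹ᵁ Proj.basicOpen (sectionGrading c) (coord c (b₂, l)) ⊓
      (h₁ ≫ sectionProj c) ⁻¹ᵁ Proj.basicOpen (polyGrading (Fin 4)) (X a)) ⟨⟨hp, hq⟩, ha⟩
  refine ⟨j.opensRange, hxj, ?_⟩
  rw [← cancel_epi j.isoOpensRange.hom, Scheme.Hom.isoOpensRange_hom_ι_assoc,
    Scheme.Hom.isoOpensRange_hom_ι_assoc]
  have hW (y) : j y ∈ _ := hjW ⟨y, rfl⟩
  obtain ⟨σ, hσ, hg⟩ := exists_eq_point (X_mem a) (j ≫ h₁ ≫ sectionProj c)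
    (TopologicalSpace.Opens.ext (Set.eq_univ_of_forall fun y => (hW y).2))
  have hσu : IsUnit (σ (X a)) := by rw [hσ]; exact isUnit_one
  obtain ⟨η, hη, hk, e₁⟩ := exists_eq_point_pointHom (h := j ≫ h₁) (ha := hσu)
    (by rw [Category.assoc, hg])
    (TopologicalSpace.Opens.ext (Set.eq_univ_of_forall fun y => (hW y).1.1))
  obtain ⟨η', hη', hl, e₂⟩ := exists_eq_point_pointHom (h := j ≫ h₂) (ha := hσu)
    (by rw [Category.assoc, ← h, hg])
    (TopologicalSpace.Opens.ext (Set.eq_univ_of_forall fun y => (hW y).1.2))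
  rw [← Scheme.IdealSheafData.comap_comp, hg, specIdeal_comap_point hM (hX a)] at hs
  simp only [map_maxMinor] at hs
  obtain ⟨w, hw⟩ := exists_unit_of_span_eq (M := (linMatrix c).map σ) hη hk hβ hs
  obtain ⟨w', hw'⟩ := exists_unit_of_span_eq (M := (linMatrix c).map σ) hη' hl hβ hs
  have hηη (j : Fin 4) : η' j = (w'⁻¹ * w : Bˣ) * η j := by
    have h1 : (w' * η' j - w * η j) * β = 0 := by
      linear_combination hw j - hw' j
    have h2 := sub_eq_zero.1 ((mem_nonZeroDivisors_iff_right.1 hβ) _ h1)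
    rw [Units.val_mul, mul_assoc, ← h2, Units.inv_mul_cancel_left]
  rw [e₁, e₂]
  refine point_eq _ _ _ _ _ _ (Units.isUnit (w'⁻¹ * w)) fun n x hx => ?_
  refine map_eq_pow_mul' (fun z => by simp) (fun p => ?_) n x hx
  rw [pointHom_coord, pointHom_coord, hηη]
  ring

/-- Divide the minors by the local generator β. The quotients η form a kernel vector because β is a
nonzerodivisor, and they generate the unit ideal because the minors generate (β); invert one η_k
near the given point. -/
lemma exists_local_lift (hM : IsDeterminantal (idealOf i).toIdeal (linMatrix c))
    (hX : ∀ a, X a ∉ (idealOf i).toIdeal) {T : Scheme.{0}} {g : T ⟶ projSpace (Fin 4)}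
    (hI : IsInvertibleIdeal (i.ker.comap g)) (x : T) :
    ∃ (B : CommRingCat.{0}) (j : Spec B ⟶ T) (_ : IsOpenImmersion j) (_ : x ∈ Set.range j)
      (h : Spec B ⟶ projSubscheme (segreSectionIdeal (sectionSpace c))),
      h ≫ sectionProj c = j ≫ g := by
  obtain ⟨a, ha⟩ := exists_mem_basicOpen_X (g x)
  obtain ⟨B, j, hj, ⟨y, hy⟩, hjW, β, hβ, hs⟩ := hI.exists_chart x
    (g ⁻¹ᵁ Proj.basicOpen (polyGrading (Fin 4)) (X a)) ha
  obtain ⟨σ, hσ, hg⟩ := exists_eq_point (X_mem a) (j ≫ g)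
    (TopologicalSpace.Opens.ext (Set.eq_univ_of_forall fun y => hjW ⟨y, rfl⟩))
  have hσu : IsUnit (σ (X a)) := by rw [hσ]; exact isUnit_one
  rw [← Scheme.IdealSheafData.comap_comp, hg, specIdeal_comap_point hM (hX a)] at hs
  have hη (j : Fin 4) : ∃ e, e * β = σ (maxMinor (linMatrix c) j) :=
    Ideal.mem_span_singleton'.1 (hs.le (Ideal.subset_span ⟨j, rfl⟩))
  choose η hη using hη
  have hker (r : Fin 3) : ∑ j, σ (linMatrix c r j) * η j = 0 := by
    refine (mem_nonZeroDivisors_iff_right.1 hβ) _ ?_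
    rw [Finset.sum_mul]
    simp only [mul_assoc, hη]
    rw [← map_zero σ, ← sum_mul_maxMinor (M := linMatrix c) r, map_sum]
    simp only [map_mul]
  have hone : Ideal.span (Set.range η) = ⊤ := by
    have : β ∈ Ideal.span (Set.range fun j => σ (maxMinor (linMatrix c) j)) :=
      hs.ge (Ideal.mem_span_singleton_self β)
    obtain ⟨r, hr⟩ := Ideal.mem_span_range_iff_exists_fun.1 this
    rw [Ideal.eq_top_iff_one, Ideal.mem_span_range_iff_exists_fun]
    refine ⟨r, sub_eq_zero.1 ((mem_nonZeroDivisors_iff_right.1 hβ) _ ?_)⟩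
    rw [sub_mul, Finset.sum_mul, one_mul]
    simp only [mul_assoc, hη, hr, sub_self]
  obtain ⟨k, hk⟩ : ∃ k, η k ∉ y.asIdeal := by
    by_contra! h
    exact y.isPrime.ne_top (top_le_iff.1 (hone ▸ Ideal.span_le.2 (by rintro _ ⟨k, rfl⟩; exact h k)))
  let L := Localization.Away (η k)
  let l : Spec (.of L) ⟶ Spec (.of B) := Spec.map (CommRingCat.ofHom (algebraMap B L))
  have hl : IsOpenImmersion l := inferInstance
  have hyl : y ∈ Set.range l := by
    have : Set.range l = (PrimeSpectrum.basicOpen (η k)).1 :=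
      PrimeSpectrum.localization_away_comap_range L (η k)
    rw [this]
    exact hk
  obtain ⟨z, hz⟩ := hyl
  refine ⟨.of L, l ≫ j, inferInstance, ⟨z, by rw [Scheme.Hom.comp_apply, hz, hy]⟩, ?_⟩
  have hker' (r : Fin 3) : ∑ j, ((algebraMap B L).comp σ) (linMatrix c r j) * algebraMap B L (η j) = 0 := by
    rw [← map_zero (algebraMap B L), ← hker r, map_sum]
    simp only [map_mul, RingHom.comp_apply]
  refine ⟨_, (point_pointHom_sectionProj _ _ hker' (hσu.map (algebraMap B L))
    (IsLocalization.Away.algebraMap_isUnit (η k))).trans ?_⟩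
  rw [Category.assoc, hg, SpecMap_point]

/-- Local lifts agree on overlaps by uniqueness, since invertibility passes to open subschemes. -/
lemma exists_lift (hM : IsDeterminantal (idealOf i).toIdeal (linMatrix c))
    (hX : ∀ a, X a ∉ (idealOf i).toIdeal) {T : Scheme.{0}} {g : T ⟶ projSpace (Fin 4)}
    (hI : IsInvertibleIdeal (i.ker.comap g)) :
    ∃ h : T ⟶ projSubscheme (segreSectionIdeal (sectionSpace c)), h ≫ sectionProj c = g := by
  choose B j hj hx h hh using exists_local_lift hM hX hI
  let 𝒰 : T.OpenCover := {
    I₀ := T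
    X x := Spec (B x)
    f := j
    mem₀ := by
      rw [Scheme.presieve₀_mem_precoverage_iff]
      exact ⟨fun x => ⟨x, hx x⟩, hj⟩ }
  have hcompat (x y : T) : Limits.pullback.fst (j x) (j y) ≫ h x =
      Limits.pullback.snd (j x) (j y) ≫ h y := by
    refine eq_of_comp_sectionProj_eq hM hX ?_ ?_
    · rw [Category.assoc, Category.assoc, hh, hh, Limits.pullback.condition_assoc]
    · rw [Category.assoc, hh, ← Category.assoc, Scheme.IdealSheafData.comap_comp]
      exact hI.comap _
  refine ⟨𝒰.glueMorphisms h hcompat, 𝒰.hom_ext _ _ fun x => ?_⟩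
  rw [← Category.assoc, 𝒰.ι_glueMorphisms]
  exact hh x

end Blowup

end SexticBlowup

namespace SexticBlowup

open AlgebraicGeometry CategoryTheory HomogeneousLocalization MvPolynomial

/-! ### The exceptional divisor is Cartier -/

noncomputable section Invertible

/-- Regard a form in the coordinates `z_{(i,j)} = x_i y_j` as a polynomial in the `y_j`. -/
def bihom : MvPolynomial (Fin 4 × Fin 4) ℂ →+* MvPolynomial (Fin 4) (MvPolynomial (Fin 4) ℂ) :=
  eval₂Hom (C.comp C) fun p => C (X p.1) * X p.2

lemma eval₂_bihom {B : Type} [CommRing B] (σ : MvPolynomial (Fin 4) ℂ →+* B) (η : Fin 4 → B)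
    (f : MvPolynomial (Fin 4 × Fin 4) ℂ) :
    (bihom f).eval₂ σ η = f.eval₂ (σ.comp C) fun p => σ (X p.1) * η p.2 := by
  have : (eval₂Hom σ η).comp bihom = eval₂Hom (σ.comp C) fun p => σ (X p.1) * η p.2 := by
    ext <;> simp [bihom]
  exact RingHom.congr_fun this f

lemma isHomogeneous_bihom {f : MvPolynomial (Fin 4 × Fin 4) ℂ} {n : ℕ} (hf : f.IsHomogeneous n) :
    (bihom f).IsHomogeneous n := by
  have := hf.eval₂ (C.comp C : ℂ →+* MvPolynomial (Fin 4) (MvPolynomial (Fin 4) ℂ))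
    (fun p : Fin 4 × Fin 4 => C (X p.1) * X p.2) (n := 1)
    (fun z => isHomogeneous_C _ _) (fun p => isHomogeneous_C_mul_X _ _)
  rwa [one_mul] at this

variable {C : Scheme.{0}} {i : C ⟶ projSpace (Fin 4)} [IsIntegral C] [IsClosedImmersion i]
  [SmoothOfRelativeDimension 1 (i ≫ structureMap (polyGrading (Fin 4)))]
  {c : Fin 3 → Fin 4 × Fin 4 → ℂ}

lemma kernel_maxMinor (r : Fin 3) : ∑ j, RingHom.id (MvPolynomial (Fin 4) ℂ) (linMatrix c r j) *
    maxMinor (linMatrix c) j = 0 := sum_mul_maxMinor (M := linMatrix c) r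

/-- An element of a chart that is killed by the equation of the exceptional divisor vanishes at the
generic point `[x], [maxMinor x]` of the section. -/
lemma pointHom_maxMinor_eq_zero (hne : ∀ j, maxMinor (linMatrix c) j ≠ 0) {a k : Fin 4} {n : ℕ}
    {x : SectionRing c} (hx : x ∈ sectionGrading c n)
    (h : dehom _ (coord_mem c (a, k)) x *
      dehom _ (coord_mem c (a, k)) (slice c k (maxMinor (linMatrix c) k)) = 0) :
    pointHom c (RingHom.id _) (maxMinor (linMatrix c)) kernel_maxMinor x = 0 := by
  let S := MvPolynomial (Fin 4) ℂ
  let θ := pointHom c (RingHom.id _) (maxMinor (linMatrix c)) kernel_maxMinor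
  let θ' : SectionRing c →+* FractionRing S := (algebraMap S (FractionRing S)).comp θ
  have hθ (p) : θ (coord c p) = X p.1 * maxMinor (linMatrix c) p.2 := pointHom_coord _ _ _ _
  have hinj : Function.Injective (algebraMap S (FractionRing S)) :=
    IsFractionRing.injective S (FractionRing S)
  have hu : IsUnit (θ' (coord c (a, k))) := by
    rw [isUnit_iff_ne_zero]
    refine (map_ne_zero_iff _ hinj).2 (?_ : θ (coord c (a, k)) ≠ 0)
    rw [hθ]
    exact mul_ne_zero (X_ne_zero _) (hne k)
  have hd {m : ℕ} {y : SectionRing c} (hy : y ∈ sectionGrading c m) :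
      awayLift _ θ' hu (dehom _ (coord_mem c (a, k)) y) * θ' (coord c (a, k)) ^ m = θ' y := by
    rw [dehom_of_mem _ hy]
    exact awayLift_mk_mul _ _ _ _ _ _ _
  have hsl : slice c k (maxMinor (linMatrix c) k) ∈ sectionGrading c 3 := by
    have hh : (maxMinor (linMatrix c) k).IsHomogeneous 3 :=
      maxMinor_isHomogeneous linMatrix_isHomogeneous k
    have : slice c k = (Ideal.Quotient.mk _).comp (rename fun i => (i, k)).toRingHom := by
      ext <;> simp [coord]
    rw [this]
    exact mk_mem_quotientGrading _ hh.rename_isHomogeneous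
  -- At y = minors(x), the column k is x times the k-th minor, so a cubic form evaluates there to
  -- the cube of that minor times its value.
  have hval : θ (slice c k (maxMinor (linMatrix c) k)) ≠ 0 := by
    have : (θ.comp (slice c k)) (maxMinor (linMatrix c) k) =
        maxMinor (linMatrix c) k ^ 3 * RingHom.id S (maxMinor (linMatrix c) k) := by
      refine map_eq_pow_mul (fun z => ?_) (fun j => ?_) 3
        (maxMinor_isHomogeneous linMatrix_isHomogeneous k)
      · simp [θ]
      · rw [RingHom.comp_apply, slice_X, hθ, RingHom.id_apply, mul_comm]
    rw [RingHom.comp_apply] at this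
    rw [this]
    exact mul_ne_zero (pow_ne_zero _ (hne k)) (hne k)
  have h1 := congrArg (awayLift _ θ' hu) h
  rw [map_mul, map_zero, mul_eq_zero] at h1
  rcases h1 with h1 | h1
  · have := hd hx
    rw [h1, zero_mul] at this
    exact (map_eq_zero_iff _ hinj).1 this.symm
  · have := hd hsl
    rw [h1, zero_mul] at this
    exact absurd ((map_eq_zero_iff _ hinj).1 this.symm) hval

/-- If e ≠ 0, its annihilator lies in a maximal ideal, and in that residue field all 2 × 2 minors
vanish while X_a = 1, which smoothness excludes. -/
lemma eq_zero_of_minors_pow_mul_eq_zero {M : Matrix (Fin 3) (Fin 4) (MvPolynomial (Fin 4) ℂ)}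
    (hM : IsDeterminantal (idealOf i).toIdeal M) {E : Type} [CommRing E] {a : Fin 4}
    (hX : X a ∉ (idealOf i).toIdeal) {σ : MvPolynomial (Fin 4) ℂ →+* E} (hσ : σ (X a) = 1) {n : ℕ}
    {e : E} (he : ∀ r s p q, σ (minorTwo M r s p q) ^ n * e = 0) : e = 0 := by
  rw [← Ideal.torsionOf_eq_top_iff (R := E)]
  by_contra hne
  obtain ⟨m, hm, hle⟩ := Ideal.exists_le_maximal _ hne
  let _ := Ideal.Quotient.field m
  have h0 := eq_zero_of_minors_eq_zero hM ((Ideal.Quotient.mk m).comp σ) (fun r s p q => by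
    rw [RingHom.comp_apply, Ideal.Quotient.eq_zero_iff_mem]
    exact hm.isPrime.mem_of_pow_mem n (hle (he r s p q))) hX
  rw [RingHom.comp_apply, hσ, map_one] at h0
  exact one_ne_zero h0

/-- Read x as a form in y with coefficients in the coordinates of ℙ³. It vanishes at the minors, so
its value on the kernel vector given by row a is killed by powers of all 2 × 2 minors. -/
lemma eq_zero_of_pointHom_maxMinor_eq_zero (hM : IsDeterminantal (idealOf i).toIdeal (linMatrix c))
    (hX : ∀ a, X a ∉ (idealOf i).toIdeal) {E : Type} [CommRing E] {a k : Fin 4}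
    {φ : SectionRing c →+* E} (hφ : φ (coord c (a, k)) = 1) {n : ℕ} {x : SectionRing c}
    (hx : x ∈ sectionGrading c n)
    (h : pointHom c (RingHom.id _) (maxMinor (linMatrix c)) kernel_maxMinor x = 0) : φ x = 0 := by
  obtain ⟨f, hf, rfl⟩ := hx
  let σ := φ.comp (slice c k)
  have hfe : (bihom f).eval₂ σ (fun j => φ (coord c (a, j))) = φ (Ideal.Quotient.mk _ f) := by
    rw [eval₂_bihom]
    have : eval₂Hom (σ.comp MvPolynomial.C) (fun p => σ (X p.1) * φ (coord c (a, p.2))) =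
        φ.comp (Ideal.Quotient.mk _) := by
      refine MvPolynomial.ringHom_ext (fun z => ?_) fun p => ?_
      · rw [eval₂Hom_C, RingHom.comp_apply, RingHom.comp_apply, slice_C, RingHom.comp_apply]
      · simp only [eval₂Hom_X', RingHom.comp_apply, σ, slice_X]
        exact (map_coord hφ p.1 p.2).symm
    exact RingHom.congr_fun this f
  have hf0 : (bihom f).eval₂ (RingHom.id _) (maxMinor (linMatrix c)) = 0 := by
    rw [eval₂_bihom]
    exact h
  refine eq_zero_of_minors_pow_mul_eq_zero hM (hX a) (σ := σ)
    (by rw [RingHom.comp_apply, slice_X, hφ]) (n := n) fun r s p q => ?_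
  change _ * φ (Ideal.Quotient.mk _ f) = 0
  rw [← hfe]
  exact minorTwo_pow_mul_eval₂_eq_zero hM.ne_zero hM.isRelPrime (isHomogeneous_bihom hf) hf0
    (sum_slice_mul_coord hφ) r s p q

lemma dehom_maxMinor_mem_nonZeroDivisors (hM : IsDeterminantal (idealOf i).toIdeal (linMatrix c))
    (hX : ∀ a, X a ∉ (idealOf i).toIdeal) (a k : Fin 4) :
    dehom _ (coord_mem c (a, k)) (slice c k (maxMinor (linMatrix c) k)) ∈
      nonZeroDivisors (Away (sectionGrading c) (coord c (a, k))) := by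
  rw [mem_nonZeroDivisors_iff_right]
  intro e he
  obtain ⟨n, x, hx, rfl⟩ := Away.mk_surjective (sectionGrading c) (coord_mem c (a, k)) e
  have hx' : x ∈ sectionGrading c n := by simpa using hx
  rw [← dehom_of_mem (coord_mem c (a, k)) hx'] at he ⊢
  exact eq_zero_of_pointHom_maxMinor_eq_zero hM hX (dehom_self _) hx'
    (pointHom_maxMinor_eq_zero hM.ne_zero hx' he)

/-- On the chart of (a, k) the kernel vector has k-th entry 1, so the ideal of C becomes principal,
generated by the k-th minor. -/
lemma isInvertibleIdeal_comap_sectionProj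
    (hM : IsDeterminantal (idealOf i).toIdeal (linMatrix c))
    (hX : ∀ a, X a ∉ (idealOf i).toIdeal) :
    IsInvertibleIdeal (i.ker.comap (sectionProj c)) := by
  refine isInvertibleIdeal_of_charts fun x => ?_
  obtain ⟨⟨a, k⟩, hx⟩ := exists_mem_basicOpen_coord x
  refine ⟨.of (Away (sectionGrading c) (coord c (a, k))),
    Proj.awayι (sectionGrading c) (coord c (a, k)) (coord_mem c (a, k)) one_pos, inferInstance, ?_,
    _, dehom_maxMinor_mem_nonZeroDivisors hM hX a k, ?_⟩
  · rwa [Proj.opensRange_awayι]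
  · have hφ : dehom (sectionGrading c) (coord_mem c (a, k)) (coord c (a, k)) = 1 := dehom_self _
    rw [← Scheme.IdealSheafData.comap_comp, awayι_sectionProj, projChart,
      specIdeal_comap_point hM (hX a)]
    simp only [map_maxMinor]
    exact span_eq_of_kernel (sum_slice_mul_coord hφ) (k := k) (by rw [hφ]; exact isUnit_one)

lemma isBlowup_sectionProj (hM : IsDeterminantal (idealOf i).toIdeal (linMatrix c))
    (hX : ∀ a, X a ∉ (idealOf i).toIdeal) : IsBlowup (sectionProj c) i.ker where
  isInvertible_comap := isInvertibleIdeal_comap_sectionProj hM hX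
  existsUnique_lift g hI := by
    obtain ⟨h, rfl⟩ := exists_lift hM hX hI
    exact ⟨h, rfl, fun h' hh => eq_of_comp_sectionProj_eq hM hX hh (by rwa [hh])⟩

/-- Two blowups with the same center are isomorphic. -/
lemma IsBlowup.exists_iso {X Y Y' : Scheme.{0}} {I : X.IdealSheafData} {π : Y ⟶ X} {π' : Y' ⟶ X}
    (h : IsBlowup π I) (h' : IsBlowup π' I) : ∃ e : Y ≅ Y', e.hom ≫ π' = π := by
  obtain ⟨f, hf, -⟩ := h'.existsUnique_lift π h.isInvertible_comap
  obtain ⟨g, hg, -⟩ := h.existsUnique_lift π' h'.isInvertible_comap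
  exact ⟨⟨f, g, (h.existsUnique_lift π h.isInvertible_comap).unique
      (by rw [Category.assoc, hg, hf]) (Category.id_comp _),
    (h'.existsUnique_lift π' h'.isInvertible_comap).unique
      (by rw [Category.assoc, hf, hg]) (Category.id_comp _)⟩, hf⟩

/-- A matrix of linear forms is given by its coefficients. -/
lemma exists_eq_linMatrix {M : Matrix (Fin 3) (Fin 4) (MvPolynomial (Fin 4) ℂ)}
    (hM : ∀ r j, (M r j).IsHomogeneous 1) : ∃ c, M = linMatrix c := by
  choose b hb using fun r j => exists_eq_sum_C_mul_X (hM r j)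
  exact ⟨fun r p => b r p.2 p.1, Matrix.ext fun r j => hb r j⟩

end Invertible

end SexticBlowup
theorem mainTheorem8 (C : Scheme.{0}) (i : C ⟶ projSpace (Fin 4))
    [IsClosedImmersion i] [IsIntegral C]
    [SmoothOfRelativeDimension 1 (i ≫ structureMap (polyGrading (Fin 4)))]
    (hdg : HasDegreeGenus (idealOf i) 6 3)
    (hcubics : IsIntersectionOfDegree 3 (Set.range i)) :
    (∃ (Y : Scheme.{0}) (π : Y ⟶ projSpace (Fin 4)), IsBlowup π i.ker) ∧
    ∀ (Y : Scheme.{0}) (π : Y ⟶ projSpace (Fin 4)), IsBlowup π i.ker →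
      ∃ V : Submodule ℂ (Fin 4 × Fin 4 → ℂ), Module.finrank ℂ V = 13 ∧
        ∃ e : Y ≅ projSubscheme (segreSectionIdeal V),
          e.hom ≫ structureMap _ = π ≫ structureMap _ := by
  have hI := isCubicSexticIdeal_idealOf hdg hcubics
  obtain ⟨M, hM⟩ := hI.exists_isDeterminantal
  obtain ⟨c, rfl⟩ := exists_eq_linMatrix hM.isHomogeneous
  -- No linear form vanishes on C, so the affine description of its ideal is available on every
  -- standard chart.
  have hX (a : Fin 4) : MvPolynomial.X a ∉ (idealOf i).toIdeal := fun h =>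
    MvPolynomial.X_ne_zero a (hI.eq_zero one_le_two (MvPolynomial.isHomogeneous_X ℂ a) h)
  have hb := isBlowup_sectionProj hM hX
  -- The dimension 13 = 16 - 3 comes from the independence of the three bilinear forms, ensured by a
  -- nonzero maximal minor.
  refine ⟨⟨_, _, hb⟩, fun Y π hπ => ⟨sectionSpace c,
    finrank_sectionSpace c (linearIndependent_of_maxMinor_ne_zero c (hM.ne_zero 0)), ?_⟩⟩
  obtain ⟨e, he⟩ := hπ.exists_iso hb
  exact ⟨e, by rw [← he, Category.assoc, sectionProj_structureMap]⟩
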